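/- Let $(M,g)$ be a compact smooth Riemannian manifold without boundary, of dimension $n\ge 3$, with Riemannian volume measure $\mu$. Let $V\in L^\infty(M)$, and let $\omega\colon M\to\mathbb R$ be a function in the Lorentz space $L(n/2,\infty)(M,g)$, that is, $\omega$ is $\mu$-measurable and $\sup_{t>0}t^{2/n}\omega^*(t)<\infty$, where $\omega^*(t)=\inf\{s>0:\mu(\{|\omega|>s\})\le t\}$ for $t>0$. Assume that $\operatorname{ess\,inf}\omega>0$. Let $W^{1,2}(M)$ be the space of (classes of) functions in $L^2(M)$ with weak gradient in $L^2$. For the operator $L=\Delta+V$ let $$B_L[f,h]=\int_M \nabla f\cdot\nabla h-V f h\,d\mu ,\qquad f,h\in W^{1,2}(M),$$ and for $\lambda\in\mathbb R$ define the unweighted and the weighted eigenspaces $$\mathcal E(\lambda)=\Big\{f\in W^{1,2}(M): B_L[f,h]=\lambda\int_M f h\,d\mu\ \text{ for all } h\in W^{1,2}(M)\Big\},$$ $$\mathcal E_\omega(\lambda)=\Big\{f\in W^{1,2}(M): B_L[f,h]=\lambda\int_M f h\,\omega\,d\mu\ \text{ for all } h\in W^{1,2}(M)\Big\}.$$ Then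 for $\lambda\le 0$ these sets are linear subspaces of $W^{1,2}(M)$, and their sums over $\lambda\le 0$ are direct: $$\operatorname{span}\bigcup_{\lambda\le0}\mathcal E(\lambda)=\bigoplus_{\lambda\le0}\mathcal E(\lambda),\qquad \operatorname{span}\bigcup_{\lambda\le0}\mathcal E_\omega(\lambda)=\bigoplus_{\lambda\le0}\mathcal E_\omega(\lambda).$$ Moreover $$\dim\operatorname{span}\bigcup_{\lambda\le0}\mathcal E_\omega(\lambda)=\dim\operatorname{span}\bigcup_{\lambda\le0}\mathcal E(\lambda),$$ and this common dimension is the maximum of $\dim\Pi$ over all linear subspaces $\Pi\subseteq W^{1,2}(M)$ with $B_L[f,f]\le0$ for every $f\in\Pi$. -/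

import Mathlib

open MeasureTheory Manifold Bundle Set
open scoped ContDiff Topology NNReal

noncomputable section

namespace RiemannianSobolev

/-! ### Lorentz spaces -/

section Lorentz

variable {X : Type*} [MeasurableSpace X]

/-- The decreasing rearrangement `f^*` of `f`, for the arguments `t ≥ 0`. -/
def decreasingRearrangement (μ : Measure X) (f : X → ℝ) (t : ℝ) : ENNReal :=
  if t = 0 then essSup (fun x => ‖f x‖ₑ) μ
  else sInf {s : ENNReal | 0 < s ∧ μ {x | s < ‖f x‖ₑ} ≤ ENNReal.ofReal t}

/-- The Lorentz quasi-norm `‖f‖_(p,q)`, for `1 ≤ p < ∞` and `1 ≤ q ≤ ∞`. -/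
def lorentzNorm (μ : Measure X) (f : X → ℝ) (p : ℝ) (q : ENNReal) : ENNReal :=
  if q = ⊤ then
    ⨆ t ∈ Ioi (0 : ℝ), ENNReal.ofReal (t ^ (1 / p)) * decreasingRearrangement μ f t
  else
    (∫⁻ t in Ioi (0 : ℝ), ENNReal.ofReal (t ^ (q.toReal / p)) *
      decreasingRearrangement μ f t ^ q.toReal * ENNReal.ofReal t⁻¹) ^ (1 / q.toReal)

/-- Membership in the Lorentz space `L(p,q)`. -/
def MemLorentz (μ : Measure X) (f : X → ℝ) (p : ℝ) (q : ENNReal) : Prop :=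
  AEStronglyMeasurable f μ ∧ lorentzNorm μ f p q < ⊤

end Lorentz

/-! ### Riemannian manifolds

`M` is a smooth `n`-manifold without boundary, modelled on Euclidean space, and `g` is a smooth
Riemannian metric on it. -/

/-- Smooth Riemannian metrics on the `n`-manifold `M`. -/
abbrev SmoothMetric (n : ℕ) (M : Type*) [TopologicalSpace M]
    [ChartedSpace (EuclideanSpace ℝ (Fin n)) M] [IsManifold (𝓡 n) ∞ M] :=
  ContMDiffRiemannianMetric (𝓡 n) ∞ (EuclideanSpace ℝ (Fin n))
    (fun x : M => TangentSpace (𝓡 n) x)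

section Geometry

variable {n : ℕ} {M : Type*} [TopologicalSpace M] [ChartedSpace (EuclideanSpace ℝ (Fin n)) M]

/-- The preferred chart at `p`. -/
abbrev chart (n : ℕ) {M : Type*} [TopologicalSpace M]
    [ChartedSpace (EuclideanSpace ℝ (Fin n)) M] (p : M) :
    OpenPartialHomeomorph M (EuclideanSpace ℝ (Fin n)) :=
  chartAt (EuclideanSpace ℝ (Fin n)) p

/-- The coordinate vector field `∂_v` of the chart at `p`, at the point of `M` whose coordinates
are `y`: the image of `v` under the differential of the inverse chart. -/
def coordVec (p : M) (y v : EuclideanSpace ℝ (Fin n)) :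
    TangentSpace (𝓡 n) ((chart n p).symm y) :=
  mfderiv (𝓡 n) (𝓡 n) (chart n p).symm y v

variable [IsManifold (𝓡 n) ∞ M]

/-- The matrix `(g_ij)` of the metric in the chart at `p`, at the coordinates `y`. -/
def metricMatrix (g : SmoothMetric n M) (p : M) (y : EuclideanSpace ℝ (Fin n)) :
    Matrix (Fin n) (Fin n) ℝ :=
  Matrix.of fun i j => g.inner ((chart n p).symm y)
    (coordVec p y (EuclideanSpace.single i 1)) (coordVec p y (EuclideanSpace.single j 1))

/-- `√(det g_ij) dy` on the target of the chart at `p`. -/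
def coordVolume (g : SmoothMetric n M) (p : M) : Measure (EuclideanSpace ℝ (Fin n)) :=
  (volume.restrict (chart n p).target).withDensity
    fun y => ENNReal.ofReal (Real.sqrt (metricMatrix g p y).det)

/-- `X` is the weak gradient of `f`: in every chart, `f` and the components `g(X, ∂_v)` are
locally integrable, and `g(X, ∂_v)` is the weak derivative of `f` in the direction `v`. -/
def IsWeakGradient (g : SmoothMetric n M) (f : M → ℝ) (X : (x : M) → TangentSpace (𝓡 n) x) : Prop :=
  ∀ (p : M) (v : EuclideanSpace ℝ (Fin n)),
    LocallyIntegrableOn (fun y => f ((chart n p).symm y)) (chart n p).target ∧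
    LocallyIntegrableOn
      (fun y => g.inner ((chart n p).symm y) (X ((chart n p).symm y)) (coordVec p y v))
      (chart n p).target ∧
    ∀ η : EuclideanSpace ℝ (Fin n) → ℝ, ContDiff ℝ ∞ η → HasCompactSupport η →
      tsupport η ⊆ (chart n p).target →
      ∫ y in (chart n p).target, f ((chart n p).symm y) * fderiv ℝ η y v =
        -∫ y in (chart n p).target,
          g.inner ((chart n p).symm y) (X ((chart n p).symm y)) (coordVec p y v) * η y

lemma continuousOn_metric_coordVec (g : SmoothMetric n M) (p : M)
    (v w : EuclideanSpace ℝ (Fin n)) :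
    ContinuousOn (fun y => g.inner ((chart n p).symm y) (coordVec p y v) (coordVec p y w))
      (chart n p).target := by
  have key : ∀ v : EuclideanSpace ℝ (Fin n), ContinuousOn
      (fun y => (TotalSpace.mk' (EuclideanSpace ℝ (Fin n)) ((chart n p).symm y)
        (coordVec p y v) : TangentBundle (𝓡 n) M)) (chart n p).target := by
    intro v
    have h1 : ContMDiffOn (𝓡 n) (𝓡 n) ∞ (chart n p).symm (chart n p).target :=
      contMDiffOn_chart_symm
    have h2 := h1.continuousOn_tangentMapWithin (by simp)
      (chart n p).open_target.uniqueMDiffOn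
    have h3 : Continuous fun y : EuclideanSpace ℝ (Fin n) =>
        (⟨y, v⟩ : TangentBundle (𝓡 n) (EuclideanSpace ℝ (Fin n))) := by
      have := (tangentBundleModelSpaceHomeomorph (𝓡 n)).symm.continuous.comp
        (Continuous.prodMk continuous_id (continuous_const (y := v)))
      exact this
    refine (h2.comp h3.continuousOn (fun y hy => hy)).congr fun y hy => ?_
    simp only [Function.comp, tangentMapWithin, coordVec]
    rw [mfderivWithin_of_isOpen (chart n p).open_target hy]
  let _ : RiemannianBundle (fun x : M => TangentSpace (𝓡 n) x) := ⟨g.toRiemannianMetric⟩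
  have _ : IsContinuousRiemannianBundle (EuclideanSpace ℝ (Fin n))
      (fun x : M => TangentSpace (𝓡 n) x) := ⟨g.inner, g.contMDiff.continuous, fun _ _ _ => rfl⟩
  exact (key v).inner_bundle (key w)

lemma metricMatrix_det_pos (g : SmoothMetric n M) (p : M) {y : EuclideanSpace ℝ (Fin n)}
    (hy : y ∈ (chart n p).target) : 0 < (metricMatrix g p y).det := by
  let _ : RiemannianBundle (fun x : M => TangentSpace (𝓡 n) x) := ⟨g.toRiemannianMetric⟩
  have hd := (mdifferentiable_chart (I := 𝓡 n) p).symm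
  have hinj := hd.mfderiv_injective (x := y) hy
  have hli : LinearIndependent ℝ (fun i : Fin n =>
      coordVec p y (EuclideanSpace.single i 1)) := by
    have h0 : LinearIndependent ℝ (EuclideanSpace.basisFun (Fin n) ℝ) :=
      (EuclideanSpace.basisFun (Fin n) ℝ).toBasis.linearIndependent
    have h1 := h0.map' (M' := TangentSpace (𝓡 n) ((chart n p).symm y))
      (mfderiv (𝓡 n) (𝓡 n) (chart n p).symm y).toLinearMap
      (LinearMap.ker_eq_bot.2 hinj)
    have e : (fun i : Fin n => coordVec (M := M) p y (EuclideanSpace.single i 1)) =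
        (mfderiv (𝓡 n) (𝓡 n) (chart n p).symm y).toLinearMap ∘
          (EuclideanSpace.basisFun (Fin n) ℝ) := by
      funext i
      exact congrArg (mfderiv (𝓡 n) (𝓡 n) (chart n p).symm y)
        (EuclideanSpace.basisFun_apply (Fin n) ℝ i).symm
    rw [e]
    exact h1
  exact (Matrix.posDef_gram_iff_linearIndependent (𝕜 := ℝ)).2 hli |>.det_pos

lemma integrableOn_mul_test {U : Set (EuclideanSpace ℝ (Fin n))}
    {u η : EuclideanSpace ℝ (Fin n) → ℝ} (hu : LocallyIntegrableOn u U) (hη : Continuous η)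
    (hc : HasCompactSupport η) (hs : tsupport η ⊆ U) : IntegrableOn (fun y => u y * η y) U := by
  have h1 : IntegrableOn u (tsupport η) := hu.integrableOn_compact_subset hs hc
  have h2 : IntegrableOn (fun y => u y * η y) (tsupport η) :=
    h1.mul_continuousOn hη.continuousOn hc
  refine (IntegrableOn.integrable_of_forall_notMem_eq_zero h2 fun y hy => ?_).integrableOn
  simp [image_eq_zero_of_notMem_tsupport hy]

lemma IsWeakGradient.add {g : SmoothMetric n M} {f f' : M → ℝ}
    {X X' : (x : M) → TangentSpace (𝓡 n) x} (h : IsWeakGradient g f X)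
    (h' : IsWeakGradient g f' X') : IsWeakGradient g (f + f') (X + X') := by
  intro p v
  obtain ⟨h1, h2, h3⟩ := h p v
  obtain ⟨h1', h2', h3'⟩ := h' p v
  refine ⟨h1.add h1', ?_, fun η hη hc hs => ?_⟩
  · have e := h2.add h2'
    intro y hy
    obtain ⟨U, hU, hi⟩ := e y hy
    exact ⟨U, hU, hi.congr (Filter.Eventually.of_forall fun z => by simp)⟩
  · have hd : Continuous fun y => fderiv ℝ η y v :=
      (hη.continuous_fderiv (by simp)).clm_apply continuous_const
    have hdc : HasCompactSupport fun y => fderiv ℝ η y v := hc.fderiv_apply ℝ v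
    have hds : tsupport (fun y => fderiv ℝ η y v) ⊆ (chart n p).target :=
      (tsupport_fderiv_apply_subset ℝ v).trans hs
    have e3 := h3 η hη hc hs
    have e3' := h3' η hη hc hs
    simp only [Pi.add_apply, map_add, add_apply, add_mul]
    rw [integral_add (integrableOn_mul_test h1 hd hdc hds) (integrableOn_mul_test h1' hd hdc hds),
      integral_add (integrableOn_mul_test h2 hη.continuous hc hs)
        (integrableOn_mul_test h2' hη.continuous hc hs), e3, e3']
    ring

lemma IsWeakGradient.smul {g : SmoothMetric n M} {f : M → ℝ}
    {X : (x : M) → TangentSpace (𝓡 n) x} (h : IsWeakGradient g f X) (c : ℝ) :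
    IsWeakGradient g (c • f) (c • X) := by
  intro p v
  obtain ⟨h1, h2, h3⟩ := h p v
  refine ⟨h1.smul c, ?_, fun η hη hc hs => ?_⟩
  · have e := h2.smul c
    intro y hy
    obtain ⟨U, hU, hi⟩ := e y hy
    exact ⟨U, hU, hi.congr (Filter.Eventually.of_forall fun z => by simp)⟩
  · have e3 := h3 η hη hc hs
    simp only [Pi.smul_apply, map_smul, smul_apply, smul_eq_mul, mul_assoc,
      integral_const_mul, e3]
    ring

lemma IsWeakGradient.zero (g : SmoothMetric n M) : IsWeakGradient g (0 : M → ℝ) 0 := by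
  intro p v
  refine ⟨?_, ?_, fun η hη hc hs => ?_⟩
  · exact locallyIntegrableOn_zero
  · simpa using locallyIntegrableOn_zero
  · simp

lemma sqrt_metric_add_le (g : SmoothMetric n M) (x : M) (v w : TangentSpace (𝓡 n) x) :
    Real.sqrt (g.inner x (v + w) (v + w)) ≤
      Real.sqrt (g.inner x v v) + Real.sqrt (g.inner x w w) := by
  let _ : RiemannianBundle (fun x : M => TangentSpace (𝓡 n) x) := ⟨g.toRiemannianMetric⟩
  have h : ∀ u : TangentSpace (𝓡 n) x, Real.sqrt (g.inner x u u) = ‖u‖ := fun u =>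
    (norm_eq_sqrt_real_inner u).symm
  simpa only [h] using norm_add_le v w

variable [MeasurableSpace M]

/-- The Riemannian volume measure: the least measure that dominates, for every chart, the
measure given by `√(det g_ij) dy` in the chart. These local measures agree on overlaps of charts,
so this is their common extension. -/
def riemannianVolume (g : SmoothMetric n M) : Measure M :=
  ⨆ p : M, Measure.map (chart n p).symm (coordVolume g p)

/-- The pointwise length `|X|` lies in `L²`. It is stated as a bound by an `L²` function, which is
the same thing for vector fields with measurable components. -/
def MemL2Field (g : SmoothMetric n M) (X : (x : M) → TangentSpace (𝓡 n) x) : Prop :=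
  ∃ G : M → ℝ, MemLp G 2 (riemannianVolume g) ∧
    ∀ᵐ x ∂riemannianVolume g, Real.sqrt (g.inner x (X x) (X x)) ≤ G x

lemma aemeasurable_chart_symm [BorelSpace M] (g : SmoothMetric n M) (p : M) :
    AEMeasurable (chart n p).symm (coordVolume g p) :=
  ((chart n p).symm.continuousOn.aemeasurable (chart n p).open_target.measurableSet).mono_ac
    (withDensity_absolutelyContinuous _ _)

lemma ae_chart_of_ae [BorelSpace M] (g : SmoothMetric n M) (p : M) {P : M → Prop}
    (h : ∀ᵐ x ∂riemannianVolume g, P x) :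
    ∀ᵐ y ∂(volume.restrict (chart n p).target), P ((chart n p).symm y) := by
  have h1 : ∀ᵐ x ∂(Measure.map (chart n p).symm (coordVolume g p)), P x :=
    ae_mono (le_iSup (fun p : M => Measure.map (chart n p).symm (coordVolume g p)) p) h
  have h2 := ae_of_ae_map (aemeasurable_chart_symm g p) h1
  have hc : ContinuousOn (fun y => (metricMatrix g p y).det) (chart n p).target := by
    simp only [Matrix.det_apply]
    refine continuousOn_finsetSum _ fun σ _ => ContinuousOn.const_smul ?_ _
    exact continuousOn_finsetProd _ fun i _ => continuousOn_metric_coordVec g p _ _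
  have hm : AEMeasurable (fun y => ENNReal.ofReal (Real.sqrt (metricMatrix g p y).det))
      (volume.restrict (chart n p).target) :=
    (((Real.continuous_sqrt.comp_continuousOn hc).aemeasurable
      (chart n p).open_target.measurableSet)).ennreal_ofReal
  rw [coordVolume, ae_withDensity_iff' hm] at h2
  filter_upwards [h2, ae_restrict_mem (chart n p).open_target.measurableSet] with y hy hy'
  apply hy
  simpa using metricMatrix_det_pos g p hy'

/-! ### The Sobolev space and the forms -/

lemma IsWeakGradient.congr [BorelSpace M] {g : SmoothMetric n M} {f f' : M → ℝ}
    {X : (x : M) → TangentSpace (𝓡 n) x} (h : IsWeakGradient g f X)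
    (hf : f' =ᵐ[riemannianVolume g] f) : IsWeakGradient g f' X := by
  intro p v
  obtain ⟨h1, h2, h3⟩ := h p v
  have hae := ae_chart_of_ae g p hf
  refine ⟨?_, h2, fun η hη hc hs => ?_⟩
  · intro y hy
    obtain ⟨U, hU, hi⟩ := h1 y hy
    refine ⟨U ∩ (chart n p).target, Filter.inter_mem hU self_mem_nhdsWithin, ?_⟩
    refine (hi.mono_set inter_subset_left).congr ?_
    filter_upwards [ae_restrict_of_ae_restrict_of_subset inter_subset_right hae] with z hz
    exact hz.symm
  · rw [← h3 η hη hc hs]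
    apply integral_congr_ae
    filter_upwards [hae] with z hz
    rw [hz]

/-- The Sobolev space `W^{1,2}(M)`: the classes of functions in `L²` that have a weak gradient
in `L²`. -/
def W12 [BorelSpace M] (g : SmoothMetric n M) : Submodule ℝ (Lp ℝ 2 (riemannianVolume g)) where
  carrier := {f | ∃ X : (x : M) → TangentSpace (𝓡 n) x, IsWeakGradient g f X ∧ MemL2Field g X}
  add_mem' := by
    rintro f f' ⟨X, hX, G, hG, hXG⟩ ⟨X', hX', G', hG', hXG'⟩
    refine ⟨X + X', (hX.add hX').congr (Lp.coeFn_add f f'), G + G', hG.add hG', ?_⟩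
    filter_upwards [hXG, hXG'] with x h1 h2
    exact (sqrt_metric_add_le g x _ _).trans (add_le_add h1 h2)
  zero_mem' := by
    refine ⟨0, (IsWeakGradient.zero g).congr (Lp.coeFn_zero _ _ _), 0, MemLp.zero, ?_⟩
    filter_upwards with x
    simp
  smul_mem' := by
    rintro c f ⟨X, hX, G, hG, hXG⟩
    refine ⟨c • X, (hX.smul c).congr (Lp.coeFn_smul c f), |c| • G, hG.const_smul |c|, ?_⟩
    filter_upwards [hXG] with x h1
    have : g.inner x ((c • X) x) ((c • X) x) = c ^ 2 * g.inner x (X x) (X x) := by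
      simp [pow_two, mul_assoc]
    rw [this, Real.sqrt_mul (sq_nonneg c), Real.sqrt_sq_eq_abs]
    exact mul_le_mul_of_nonneg_left h1 (abs_nonneg c)

/-- The weak gradient `∇f` of `f ∈ W^{1,2}(M)`; it is unique up to null sets. -/
def weakGradient [BorelSpace M] {g : SmoothMetric n M} (f : W12 g) :
    (x : M) → TangentSpace (𝓡 n) x :=
  f.2.choose

/-- The bilinear form `B_L[f, h] = ∫ ∇f · ∇h - V f h` on `W^{1,2}(M)` of `L = Δ + V`. -/
def bilinForm [BorelSpace M] (g : SmoothMetric n M) (V : M → ℝ) (f h : W12 g) : ℝ :=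
  ∫ x, (g.inner x (weakGradient f x) (weakGradient h x) - V x * f.1 x * h.1 x)
    ∂riemannianVolume g

/-- The weighted eigenspace `{f ∈ W^{1,2}(M) : B_L[f, h] = lam ∫ f h w for all h ∈ W^{1,2}(M)}`
of `L = Δ + V`. -/
def weightedEigenspace [BorelSpace M] (g : SmoothMetric n M) (V w : M → ℝ) (lam : ℝ) :
    Set (W12 g) :=
  {f | ∀ h : W12 g, bilinForm g V f h = lam * ∫ x, f.1 x * h.1 x * w x ∂riemannianVolume g}

/-- The unweighted eigenspace `{f ∈ W^{1,2}(M) : B_L[f, h] = lam ∫ f h for all h ∈ W^{1,2}(M)}`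
of `L = Δ + V`. -/
def eigenspace [BorelSpace M] (g : SmoothMetric n M) (V : M → ℝ) (lam : ℝ) : Set (W12 g) :=
  {f | ∀ h : W12 g, bilinForm g V f h = lam * ∫ x, f.1 x * h.1 x ∂riemannianVolume g}

/-- `span (⋃ i, E i) = ⨁ i, E i`: the sets `E i` are linear subspaces, they are independent,
and their (hence direct) sum is the span of their union. -/
def SpanIsDirectSum {ι W : Type*} [AddCommGroup W] [Module ℝ W] (E : ι → Set W) : Prop :=
  ∃ S : ι → Submodule ℝ W, (∀ i, (S i : Set W) = E i) ∧ iSupIndep S ∧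
    Submodule.span ℝ (⋃ i, E i) = ⨆ i, S i

end Geometry

end RiemannianSobolev

end

open RiemannianSobolev

/-! The common dimension is the maximal dimension of a `B_L`-nonpositive subspace, a number that
does not see the weight. Write `H = W^{1,2}(M)`, `D(f, h) = ∫ ∇f · ∇h + f h`, `B = B_L`, and `a(f,
h) = ∫ f h ρ` with `ρ = ω` or `ρ = 1`. For `f`, `h` in the eigenspaces of `λ ≠ λ'`, symmetry gives
`λ a(f, h) = B(f, h) = λ' a(f, h)`, so the eigenspaces are `a`-orthogonal. Hence their sum `E` over
`λ ≤ 0` is direct, and `B` is diagonal and nonpositive on it.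

It remains to see that `E` has maximal dimension (`isGreatest_rank_formEigenspace`). `B` is coercive
on the common kernel of finitely many bounded functionals. So `E` is finite-dimensional, and `H = E
⊕ F` with `F` the `a`-orthogonal complement. If `B` were not positive definite on `F`, the infimum
`m` of `B(f, f) / a(f, f)` over `F` would be nonpositive. The form `Q = B - m a` is nonnegative on
`F`, and a null vector of `Q` in `F` would be an eigenvector for `m ≤ 0`, thus in `E ∩ F = 0`. A
positive definite form that is coercive in finite codimension is coercive (`exists_coercive`), so
`m` could be raised, a contradiction. Therefore `B > 0` on `F`, and every nonpositive subspace meets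
`F` trivially and embeds in the dual of `E`.

This argument never extracts a minimiser for `B / a`. That matters because a weight in `L(n/2, ∞)`
makes `a` bounded on `W^{1,2}`, but in general not compact. Compactness is needed only for the
unweighted `L²` norm, which controls the difference of `B` and `D`.

The analytic inputs are the completeness of `W^{1,2}` (`exists_tendsto_sobolevForm`), a quantitative
Rellich theorem (`exists_finite_norm_sq_le`) and the bound `a(f, f) ≤ C D(f, f)`
(`exists_lintegral_mul_le`). The last two are proved on the model space and carried to `M` by
cutting off in finitely many charts, where the Riemannian volume is comparable to Lebesgue measure.
The weighted bound comes from applying the Sobolev inequality to truncations at dyadic levels and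
summing the levels. -/

noncomputable section

namespace RiemannianSobolev

/-! ### Eigenspaces of a pair of symmetric forms -/

section Forms

variable {H : Type*} [AddCommGroup H] [Module ℝ H]

/-- The eigenspace `{f : B(f, h) = lam a(f, h) for all h}` of the form `B` relative to `a`. -/
def formEigenspace (B a : H →ₗ[ℝ] H →ₗ[ℝ] ℝ) (lam : ℝ) : Submodule ℝ H :=
  LinearMap.ker (B - lam • a)

lemma mem_formEigenspace {B a : H →ₗ[ℝ] H →ₗ[ℝ] ℝ} {lam : ℝ} {f : H} :
    f ∈ formEigenspace B a lam ↔ ∀ h, B f h = lam * a f h := by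
  simp [formEigenspace, LinearMap.ext_iff, sub_eq_zero]

variable {B a : H →ₗ[ℝ] H →ₗ[ℝ] ℝ}

lemma formEigenspace_orthogonal (hB : ∀ f h, B f h = B h f) (ha : ∀ f h, a f h = a h f)
    {lam lam' : ℝ} (hne : lam ≠ lam') {f h : H} (hf : f ∈ formEigenspace B a lam)
    (hh : h ∈ formEigenspace B a lam') : a f h = 0 := by
  have h1 := mem_formEigenspace.1 hf h
  have h2 := mem_formEigenspace.1 hh f
  rw [hB h f, ha h f, h1] at h2
  have : (lam - lam') * a f h = 0 := by linarith
  exact (mul_eq_zero.1 this).resolve_left (sub_ne_zero.2 hne)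

/-- A vector in one eigenspace and in the sum of the others is `a`-orthogonal to itself, hence zero.
-/
lemma iSupIndep_formEigenspace (hB : ∀ f h, B f h = B h f) (ha : ∀ f h, a f h = a h f)
    (hpos : ∀ f, f ≠ 0 → 0 < a f f) :
    iSupIndep fun lam : Set.Iic (0 : ℝ) => formEigenspace B a lam := by
  intro i
  rw [Submodule.disjoint_def]
  intro x hx hx'
  have hle : (⨆ j, ⨆ (_ : j ≠ i), formEigenspace B a (j : ℝ)) ≤ LinearMap.ker (a x) := by
    refine iSup₂_le fun j hj y hy => ?_
    exact formEigenspace_orthogonal hB ha (fun e => hj (Subtype.ext e.symm)) hx hy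
  by_contra hne
  exact (hpos x hne).ne' (hle hx')

lemma spanIsDirectSum_formEigenspace (hB : ∀ f h, B f h = B h f) (ha : ∀ f h, a f h = a h f)
    (hpos : ∀ f, f ≠ 0 → 0 < a f f) :
    SpanIsDirectSum fun lam : Set.Iic (0 : ℝ) => {f : H | ∀ h, B f h = lam * a f h} := by
  refine ⟨fun lam => formEigenspace B a lam, fun i => ?_, iSupIndep_formEigenspace hB ha hpos, ?_⟩
  · ext f
    exact mem_formEigenspace
  · rw [Submodule.iSup_eq_span]
    congr 2
    ext f
    simp [mem_formEigenspace]

/-- In an expansion into eigenvectors the cross terms of `B` vanish by orthogonality, and the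
diagonal terms are `λ a(φ, φ)` with `λ ≤ 0`. -/
lemma form_nonpos_of_mem_iSup (hB : ∀ f h, B f h = B h f) (ha : ∀ f h, a f h = a h f)
    (hpos : ∀ f, f ≠ 0 → 0 < a f f) {f : H}
    (hf : f ∈ ⨆ lam : Set.Iic (0 : ℝ), formEigenspace B a (lam : ℝ)) : B f f ≤ 0 := by
  classical
  obtain ⟨φ, hφ, rfl⟩ := (Submodule.mem_iSup_iff_exists_finsupp _ _).1 hf
  rw [Finsupp.sum, map_sum]
  simp only [LinearMap.sum_apply, map_sum]
  refine Finset.sum_nonpos fun i _ => Finset.sum_nonpos fun j _ => ?_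
  rw [mem_formEigenspace.1 (hφ j)]
  by_cases h : j = i
  · subst h
    have h0 : 0 ≤ a (φ j) (φ j) := by
      by_cases h0 : φ j = 0
      · simp [h0]
      · exact (hpos _ h0).le
    exact mul_nonpos_of_nonpos_of_nonneg j.2 h0
  · rw [formEigenspace_orthogonal hB ha (fun e => h (Subtype.ext e)) (hφ j) (hφ i), mul_zero]

/-- The Cauchy–Schwarz consequence: a null vector of a nonnegative form is in its radical. -/
lemma form_eq_zero_of_self_eq_zero {Q : H →ₗ[ℝ] H →ₗ[ℝ] ℝ} (hQ : ∀ f h, Q f h = Q h f)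
    {F : Submodule ℝ H} (hnn : ∀ f ∈ F, 0 ≤ Q f f) {f : H} (hf : f ∈ F) (h0 : Q f f = 0)
    {h : H} (hh : h ∈ F) : Q f h = 0 := by
  -- As `Q(f, f) = 0`, the value `Q(t f + h, t f + h)` is affine in `t`; the quadratic term is
  -- written with the factor `0`. An affine function bounded below is constant, and the `t` chosen
  -- below would give it the value `-1`.
  have key : ∀ t : ℝ, 0 ≤ 2 * t * Q f h + Q h h * t ^ 2 * 0 + Q h h := by
    intro t
    have := hnn (t • f + h) (F.add_mem (F.smul_mem t hf) hh)
    simp only [map_add, map_smul, LinearMap.add_apply, LinearMap.smul_apply, smul_eq_mul, h0,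
      hQ h f] at this
    linarith
  by_contra hne
  have := key (-(Q h h + 1) / (2 * Q f h))
  have e : 2 * (-(Q h h + 1) / (2 * Q f h)) * Q f h = -(Q h h + 1) := by field_simp
  rw [e] at this
  linarith

end Forms

/-! ### Coercivity and the maximality of the nonpositive eigenspaces in a Hilbert space. -/

section Hilbert

variable {H : Type*} [NormedAddCommGroup H] [InnerProductSpace ℝ H]

/-- The constant is the minimum of `Q` over the compact unit sphere, and homogeneity does the rest.
-/
lemma exists_coercive_of_finiteDimensional (Q : H →ₗ[ℝ] H →ₗ[ℝ] ℝ)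
    [FiniteDimensional ℝ H] {C : ℝ} (hC : ∀ f h, |Q f h| ≤ C * ‖f‖ * ‖h‖)
    (hpos : ∀ f, f ≠ 0 → 0 < Q f f) : ∃ δ > 0, ∀ f, δ * ‖f‖ ^ 2 ≤ Q f f := by
  have : ProperSpace H := FiniteDimensional.proper ℝ H
  let Qc : H →L[ℝ] H →L[ℝ] ℝ := LinearMap.mkContinuous₂ Q C hC
  have hcont : Continuous fun f => Q f f := by
    change Continuous fun f => Qc f f
    fun_prop
  by_cases hne : (Metric.sphere (0 : H) 1).Nonempty
  · obtain ⟨x, hx, hmin⟩ := (isCompact_sphere (0 : H) 1).exists_isMinOn hne hcont.continuousOn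
    have hx1 : ‖x‖ = 1 := by simpa using hx
    have hx0 : x ≠ 0 := by
      rintro rfl
      simp at hx1
    refine ⟨Q x x, hpos x hx0, fun f => ?_⟩
    by_cases hf : f = 0
    · simp [hf]
    have hf' : ‖f‖ ≠ 0 := norm_ne_zero_iff.2 hf
    have h1 : Q x x ≤ Q (‖f‖⁻¹ • f) (‖f‖⁻¹ • f) := hmin (by simp [norm_smul, hf'])
    simp only [map_smul, LinearMap.smul_apply, smul_eq_mul] at h1
    calc Q x x * ‖f‖ ^ 2 ≤ (‖f‖⁻¹ * (‖f‖⁻¹ * Q f f)) * ‖f‖ ^ 2 := by gcongr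
      _ = Q f f := by field_simp
  -- The unit sphere is empty only if the space is zero, and then any constant serves.
  · refine ⟨1, one_pos, fun f => ?_⟩
    by_cases hf : f = 0
    · simp [hf]
    refine (hne ⟨‖f‖⁻¹ • f, ?_⟩).elim
    simp [norm_smul, norm_ne_zero_iff.2 hf]

/-- A positive definite bounded form that is coercive on a closed subspace of finite codimension
is coercive. -/
lemma exists_coercive [CompleteSpace H] (Q : H →ₗ[ℝ] H →ₗ[ℝ] ℝ) (hQ : ∀ f h, Q f h = Q h f) {C : ℝ}
    (hC : ∀ f h, |Q f h| ≤ C * ‖f‖ * ‖h‖) {W : Type*} [AddCommGroup W] [Module ℝ W]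
    [FiniteDimensional ℝ W] (l : H →ₗ[ℝ] W) (hl : IsClosed (LinearMap.ker l : Set H)) {c : ℝ}
    (hc : 0 < c) (hcoer : ∀ f, l f = 0 → c * ‖f‖ ^ 2 ≤ Q f f)
    (hpos : ∀ f, f ≠ 0 → 0 < Q f f) : ∃ δ > 0, ∀ f, δ * ‖f‖ ^ 2 ≤ Q f f := by
  set G : Submodule ℝ H := LinearMap.ker l with hG
  have : CompleteSpace G := hl.completeSpace_coe
  let BG : G →L[ℝ] G →L[ℝ] ℝ :=
    LinearMap.mkContinuous₂ (Q.compl₁₂ G.subtype G.subtype) C fun f h => hC f h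
  have hBG : ∀ x y : G, BG x y = Q x y := fun x y => rfl
  have hBGc : IsCoercive BG := ⟨c, hc, fun u => by
    have := hcoer u u.2
    rw [hBG]
    simpa [pow_two, mul_assoc] using this⟩
  -- `K` is the `Q`-orthogonal complement of `G = ker l`. Positive definiteness gives `K ∩ G = 0`,
  -- so `l` embeds `K` in the finite-dimensional space `W`.
  let K : Submodule ℝ H := LinearMap.ker (Q.compl₁₂ (LinearMap.id) G.subtype)
  have hK : ∀ k, k ∈ K ↔ ∀ x ∈ G, Q k x = 0 := by
    intro k
    simp [K, LinearMap.ext_iff]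
  have hKfin : FiniteDimensional ℝ K := by
    refine FiniteDimensional.of_injective (l.comp K.subtype) ?_
    rw [← LinearMap.ker_eq_bot, LinearMap.ker_eq_bot']
    intro k hk
    by_contra hne
    have h1 : (k : H) ≠ 0 := fun e => hne (Subtype.ext e)
    exact (hpos k h1).ne' ((hK k).1 k.2 k hk)
  obtain ⟨δ, hδ, hδK⟩ := exists_coercive_of_finiteDimensional (Q.compl₁₂ K.subtype K.subtype)
    (fun f h => hC f h) (fun f hf => hpos f fun e => hf (Subtype.ext e))
  -- Lax–Milgram on `G`: the functional `Q(f, ·)` on `G` is `Q(x, ·)` for some `x` in `G`, and then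
  -- `f - x` is `Q`-orthogonal to `G`.
  have hdec : ∀ f : H, ∃ x ∈ G, f - x ∈ K := by
    intro f
    let φ : G →L[ℝ] ℝ := LinearMap.mkContinuous (Q f ∘ₗ G.subtype) (C * ‖f‖) fun h => hC f h
    let r : G := (InnerProductSpace.toDual ℝ G).symm φ
    refine ⟨hBGc.continuousLinearEquivOfBilin.symm r, Submodule.coe_mem _, (hK _).2 ?_⟩
    intro x hx
    have h1 := hBGc.continuousLinearEquivOfBilin_apply
      (hBGc.continuousLinearEquivOfBilin.symm r) ⟨x, hx⟩
    rw [ContinuousLinearEquiv.apply_symm_apply, InnerProductSpace.toDual_symm_apply, hBG] at h1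
    have h2 : φ ⟨x, hx⟩ = Q f x := rfl
    rw [map_sub, LinearMap.sub_apply, ← h2, h1, sub_self]
  -- `Q` splits along `f = x + (f - x)` without cross terms; the factor `1 / 2` pays for `‖x + k‖² ≤
  -- 2 (‖x‖² + ‖k‖²)`.
  refine ⟨min c δ / 2, by positivity, fun f => ?_⟩
  obtain ⟨x, hx, hk⟩ := hdec f
  have h1 := hcoer x hx
  have h2 := hδK ⟨f - x, hk⟩
  have h3 := (hK _).1 hk x hx
  have h4 : Q f f = Q x x + Q (f - x) (f - x) := by
    have := hQ x (f - x)
    rw [h3] at this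
    have e : f = x + (f - x) := by abel
    conv_lhs => rw [e]
    rw [map_add, map_add, LinearMap.add_apply, LinearMap.add_apply, this, h3]
    ring
  have h5 : ‖f‖ ≤ ‖x‖ + ‖f - x‖ := by
    have := norm_add_le x (f - x)
    rwa [add_sub_cancel] at this
  have h6 : ‖f‖ ^ 2 ≤ 2 * (‖x‖ ^ 2 + ‖f - x‖ ^ 2) := by
    nlinarith [norm_nonneg f, norm_nonneg x, norm_nonneg (f - x), sq_nonneg (‖x‖ - ‖f - x‖)]
  have h7 : min c δ * ‖x‖ ^ 2 ≤ c * ‖x‖ ^ 2 := by gcongr; exact min_le_left _ _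
  have h8 : min c δ * ‖f - x‖ ^ 2 ≤ δ * ‖f - x‖ ^ 2 := by gcongr; exact min_le_right _ _
  have h9 : δ * ‖f - x‖ ^ 2 ≤ Q (f - x) (f - x) := h2
  have h10 : 0 < min c δ := lt_min hc hδ
  rw [h4]
  nlinarith

/-- The span of the eigenspaces with nonpositive eigenvalues is a nonpositive subspace of maximal
dimension. -/
theorem isGreatest_rank_formEigenspace [CompleteSpace H] {B a : H →ₗ[ℝ] H →ₗ[ℝ] ℝ}
    (hB : ∀ f h, B f h = B h f)
    (ha : ∀ f h, a f h = a h f) {C : ℝ} (hBC : ∀ f h, |B f h| ≤ C * ‖f‖ * ‖h‖) {C' : ℝ}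
    (haC : ∀ f h, |a f h| ≤ C' * ‖f‖ * ‖h‖) (hpos : ∀ f, f ≠ 0 → 0 < a f f) {W : Type*}
    [AddCommGroup W] [Module ℝ W] [FiniteDimensional ℝ W] (l : H →ₗ[ℝ] W)
    (hl : IsClosed (LinearMap.ker l : Set H)) {c : ℝ} (hc : 0 < c)
    (hcoer : ∀ f, l f = 0 → c * ‖f‖ ^ 2 ≤ B f f) {K : ℝ} (hK : ∀ f, 0 ≤ B f f + K * a f f) :
    IsGreatest {d : Cardinal | ∃ P : Submodule ℝ H, (∀ f ∈ P, B f f ≤ 0) ∧ Module.rank ℝ P = d}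
      (Module.rank ℝ (Submodule.span ℝ
        (⋃ lam : Set.Iic (0 : ℝ), {f : H | ∀ h, B f h = lam * a f h}))) := by
  set E : Submodule ℝ H := ⨆ lam : Set.Iic (0 : ℝ), formEigenspace B a (lam : ℝ) with hE
  have hspan : Submodule.span ℝ (⋃ lam : Set.Iic (0 : ℝ), {f : H | ∀ h, B f h = lam * a f h}) =
      E := by
    rw [hE, Submodule.iSup_eq_span]
    congr 2
    ext f
    simp [mem_formEigenspace]
  rw [hspan]
  have hEn : ∀ f ∈ E, B f f ≤ 0 := fun f hf => form_nonpos_of_mem_iSup hB ha hpos hf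
  refine ⟨⟨E, hEn, rfl⟩, ?_⟩
  -- On `E ∩ ker l` the form is both nonpositive and coercive, so `l` is injective on `E`.
  have hEfin : FiniteDimensional ℝ E := by
    refine FiniteDimensional.of_injective (l.comp E.subtype) ?_
    rw [← LinearMap.ker_eq_bot, LinearMap.ker_eq_bot']
    intro f hf
    have h1 := hcoer f hf
    have h2 := hEn f f.2
    have h3 : ‖(f : H)‖ ^ 2 = 0 := by
      have := sq_nonneg ‖(f : H)‖
      nlinarith
    exact Subtype.ext (norm_eq_zero.1 (pow_eq_zero_iff two_ne_zero |>.1 h3))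
  -- `T` sends `f` to `a(f, ·)` on `E`; its kernel is the `a`-orthogonal complement of `E`.
  let T : H →ₗ[ℝ] Module.Dual ℝ E := a.compl₁₂ LinearMap.id E.subtype
  have hT : ∀ f (e : E), T f e = a f e := fun _ _ => rfl
  set F : Submodule ℝ H := LinearMap.ker T with hF
  have hmemF : ∀ f, f ∈ F ↔ ∀ e ∈ E, a f e = 0 := by
    intro f
    simp [hF, LinearMap.ext_iff, hT]
  have hEF : ∀ f ∈ E, f ∈ F → f = 0 := by
    intro f hf hf'
    by_contra hne
    exact (hpos f hne).ne' ((hmemF f).1 hf' f hf)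
  have hdual : Module.finrank ℝ (Module.Dual ℝ E) = Module.finrank ℝ E :=
    Subspace.dual_finrank_eq
  -- `T` is injective on `E`, hence maps `E` onto its dual, so some `e` in `E` has `T e = T h`.
  have hdec : ∀ h : H, ∃ e ∈ E, h - e ∈ F := by
    intro h
    have hinj : Function.Injective (T.comp E.subtype) := by
      rw [← LinearMap.ker_eq_bot, LinearMap.ker_eq_bot']
      intro f hf
      exact Subtype.ext (hEF f f.2 hf)
    obtain ⟨e, he⟩ := (LinearMap.injective_iff_surjective_of_finrank_eq_finrank hdual.symm).1
      hinj (T h)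
    refine ⟨e, e.2, ?_⟩
    rw [hF, LinearMap.mem_ker, map_sub, sub_eq_zero]
    exact he.symm
  have hBEF : ∀ e ∈ E, ∀ f ∈ F, B f e = 0 := by
    intro e he f hf
    have hle : E ≤ LinearMap.ker (B f) := by
      refine iSup_le fun i x hx => ?_
      rw [LinearMap.mem_ker, hB, mem_formEigenspace.1 hx, ha, (hmemF f).1 hf x
        (Submodule.mem_iSup_of_mem i hx), mul_zero]
    exact hle he
  -- The heart of the proof: otherwise the infimum of the Rayleigh quotient on `F` is a finite
  -- number `m ≤ 0`, and it turns out not to be an infimum.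
  have hBF : ∀ f ∈ F, f ≠ 0 → 0 < B f f := by
    by_contra! hcon
    obtain ⟨f₀, hf₀, hne₀, hBf₀⟩ := hcon
    set S : Set ℝ := {t | ∃ f ∈ F, f ≠ 0 ∧ B f f / a f f = t} with hS
    have hbdd : BddBelow S := by
      refine ⟨-K, ?_⟩
      rintro _ ⟨f, -, hne, rfl⟩
      rw [le_div_iff₀ (hpos f hne)]
      linarith [hK f]
    set m := sInf S with hm
    have hm0 : m ≤ 0 := (csInf_le hbdd ⟨f₀, hf₀, hne₀, rfl⟩).trans
      (div_nonpos_of_nonpos_of_nonneg hBf₀ (hpos f₀ hne₀).le)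
    let Q : H →ₗ[ℝ] H →ₗ[ℝ] ℝ := B - m • a
    have hQ : ∀ f h, Q f h = B f h - m * a f h := fun _ _ => rfl
    have hQs : ∀ f h, Q f h = Q h f := fun f h => by rw [hQ, hQ, hB, ha]
    have hQnn : ∀ f ∈ F, 0 ≤ Q f f := by
      intro f hf
      by_cases hne : f = 0
      · simp [hne]
      have := csInf_le hbdd ⟨f, hf, hne, rfl⟩
      rw [le_div_iff₀ (hpos f hne)] at this
      rw [hQ]
      linarith
    -- A null vector of `Q` in `F` is `Q`-orthogonal to `F` by Cauchy–Schwarz, and it is orthogonal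
    -- to `E` for both `B` and `a`. So it satisfies the eigenvalue equation for `m` against all of
    -- `H = E + F`.
    have hQpos : ∀ f ∈ F, f ≠ 0 → 0 < Q f f := by
      intro f hf hne
      refine (hQnn f hf).lt_of_ne' fun h0 => hne ?_
      refine hEF f (Submodule.mem_iSup_of_mem (⟨m, hm0⟩ : Set.Iic (0 : ℝ)) ?_) hf
      refine mem_formEigenspace.2 fun h => ?_
      obtain ⟨e, he, hhe⟩ := hdec h
      have h1 := form_eq_zero_of_self_eq_zero hQs hQnn hf h0 hhe
      rw [hQ, map_sub, map_sub, hBEF e he f hf, (hmemF f).1 hf e he] at h1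
      simpa [sub_eq_zero] using h1
    have hQC : ∀ f h, |Q f h| ≤ (C + |m| * C') * ‖f‖ * ‖h‖ := by
      intro f h
      rw [hQ]
      calc |B f h - m * a f h| ≤ |B f h| + |m * a f h| := abs_sub _ _
        _ ≤ C * ‖f‖ * ‖h‖ + |m| * (C' * ‖f‖ * ‖h‖) := by
          rw [abs_mul]
          gcongr
          exacts [hBC f h, haC f h]
        _ = _ := by ring
    have hFc : IsClosed (F : Set H) := by
      have : (F : Set H) = ⋂ e : E, (LinearMap.mkContinuous (a e) (C' * ‖(e : H)‖)
          fun h => haC e h) ⁻¹' {0} := by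
        ext f
        simp only [SetLike.mem_coe, hmemF, mem_iInter, mem_preimage, mem_singleton_iff,
          LinearMap.mkContinuous_apply, Subtype.forall]
        exact forall₂_congr fun e _ => by rw [ha]
      rw [this]
      exact isClosed_iInter fun e => isClosed_singleton.preimage (ContinuousLinearMap.continuous _)
    have : CompleteSpace F := hFc.completeSpace_coe
    -- Since `m ≤ 0` and `a ≥ 0`, we have `Q ≥ B`, so `Q` inherits the coercivity of `B` on the
    -- kernel of `l`.
    obtain ⟨δ, hδ, hδF⟩ := exists_coercive (Q.compl₁₂ F.subtype F.subtype)
      (fun f h => hQs f h) (fun f h => hQC f h) (l.comp F.subtype)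
      (hl.preimage continuous_subtype_val) hc
      (fun f hf => by
        have h1 := hcoer f hf
        have h2 : a f f ≥ 0 := by
          by_cases hne : (f : H) = 0
          · simp [hne]
          · exact (hpos f hne).le
        change c * ‖(f : H)‖ ^ 2 ≤ Q f f
        rw [hQ]
        nlinarith)
      (fun f hf => hQpos f f.2 fun e => hf (Subtype.ext e))
    have hC'0 : 0 < |C'| + 1 := by positivity
    -- Boundedness of `a` turns `Q(f, f) ≥ δ ‖f‖²` into a gap above `m`. The constant `|C'| + 1`
    -- replaces `C'` because `C'` need not be positive.
    have hlb : ∀ t ∈ S, m + δ / (|C'| + 1) ≤ t := by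
      rintro _ ⟨f, hf, hne, rfl⟩
      rw [le_div_iff₀ (hpos f hne)]
      have h1 : δ * ‖f‖ ^ 2 ≤ B f f - m * a f f := hδF ⟨f, hf⟩
      have h2 : a f f ≤ (|C'| + 1) * ‖f‖ ^ 2 := by
        have := (le_abs_self _).trans (haC f f)
        have h3 := le_abs_self C'
        nlinarith [sq_nonneg ‖f‖]
      have h3 : δ / (|C'| + 1) * a f f ≤ δ * ‖f‖ ^ 2 := by
        calc δ / (|C'| + 1) * a f f ≤ δ / (|C'| + 1) * ((|C'| + 1) * ‖f‖ ^ 2) := by gcongr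
          _ = _ := by field_simp
      linarith
    have hSne : S.Nonempty := ⟨_, f₀, hf₀, hne₀, rfl⟩
    have h1 := le_csInf hSne hlb
    have h2 : 0 < δ / (|C'| + 1) := by positivity
    linarith
  rintro _ ⟨P, hP, rfl⟩
  -- A vector of `P` in the kernel of `T` lies in `F`, where `B` is positive, while `B ≤ 0` on `P`.
  have hinj : Function.Injective (T.comp P.subtype) := by
    rw [← LinearMap.ker_eq_bot, LinearMap.ker_eq_bot']
    intro f hf
    by_contra hne
    exact (hBF f hf fun e => hne (Subtype.ext e)).not_ge (hP f f.2)
  have hPfin : FiniteDimensional ℝ P := FiniteDimensional.of_injective _ hinj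
  rw [← Module.finrank_eq_rank, ← Module.finrank_eq_rank, ← hdual]
  exact_mod_cast LinearMap.finrank_le_finrank_of_injective hinj

end Hilbert

/-- `isGreatest_rank_formEigenspace`, for a space whose complete norm comes from a form `D`. -/
theorem isGreatest_rank_formEigenspace_of_core {H : Type*} [AddCommGroup H] [Module ℝ H]
    {D B a : H →ₗ[ℝ] H →ₗ[ℝ] ℝ} (hD : ∀ f h, D f h = D h f) (hDpos : ∀ f, f ≠ 0 → 0 < D f f)
    (hcomplete : ∀ u : ℕ → H, (∀ N k m, N ≤ k → N ≤ m → D (u k - u m) (u k - u m) < (1 / 4) ^ N) →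
      ∃ f, Filter.Tendsto (fun k => D (u k - f) (u k - f)) Filter.atTop (𝓝 0))
    (hB : ∀ f h, B f h = B h f) (ha : ∀ f h, a f h = a h f)
    {C : ℝ} (hBC : ∀ f h, |B f h| ≤ C * √(D f f) * √(D h h))
    {C' : ℝ} (haC : ∀ f h, |a f h| ≤ C' * √(D f f) * √(D h h)) (hpos : ∀ f, f ≠ 0 → 0 < a f f)
    {J : Type*} [Finite J] (l : J → H →ₗ[ℝ] ℝ) (hl : ∀ j, ∃ A, ∀ f, |l j f| ≤ A * √(D f f))
    {c : ℝ} (hc : 0 < c) (hcoer : ∀ f, (∀ j, l j f = 0) → c * D f f ≤ B f f)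
    {K : ℝ} (hK : ∀ f, 0 ≤ B f f + K * a f f) :
    IsGreatest {d : Cardinal | ∃ P : Submodule ℝ H, (∀ f ∈ P, B f f ≤ 0) ∧ Module.rank ℝ P = d}
      (Module.rank ℝ (Submodule.span ℝ
        (⋃ lam : Set.Iic (0 : ℝ), {f : H | ∀ h, B f h = lam * a f h}))) := by
  have hD0 : ∀ f, 0 ≤ D f f := by
    intro f
    by_cases h : f = 0
    · simp [h]
    · exact (hDpos f h).le
  let core : InnerProductSpace.Core ℝ H :=
    { inner := fun f h => D f h
      conj_inner_symm := fun f h => by simpa using hD h f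
      re_inner_nonneg := fun f => by simpa using hD0 f
      add_left := fun f f' h => by simp
      smul_left := fun f h r => by simp
      definite := fun f hf => by
        by_contra hne
        exact (hDpos f hne).ne' hf }
  let _ : NormedAddCommGroup H := core.toNormedAddCommGroup
  let _ : InnerProductSpace ℝ H := InnerProductSpace.ofCore core.toCore
  have hnorm : ∀ f : H, ‖f‖ = √(D f f) := fun f => rfl
  have hsq : ∀ f : H, ‖f‖ ^ 2 = D f f := fun f => by rw [hnorm, Real.sq_sqrt (hD0 f)]
  have : CompleteSpace H := by
    -- Distances controlled by `2⁻ᴺ` are values of `D` controlled by `4⁻ᴺ`, which is the form of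
    -- `hcomplete`.
    refine Metric.complete_of_convergent_controlled_sequences (fun N => (1 / 2 : ℝ) ^ N)
      (fun N => by positivity) fun u hu => ?_
    obtain ⟨f, hf⟩ := hcomplete u fun N k m hk hm => by
      have := hu N k m hk hm
      rw [dist_eq_norm] at this
      rw [← hsq]
      calc ‖u k - u m‖ ^ 2 < ((1 / 2) ^ N) ^ 2 := by gcongr
        _ = (1 / 4) ^ N := by rw [← pow_mul, mul_comm, pow_mul]; norm_num
    refine ⟨f, tendsto_iff_norm_sub_tendsto_zero.2 ?_⟩
    have := (Real.continuous_sqrt.tendsto 0).comp hf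
    simpa only [Real.sqrt_zero, Function.comp_def, ← hnorm] using this
  simp only [← hnorm] at hBC haC hl
  simp only [← hsq] at hcoer
  choose A hA using hl
  refine isGreatest_rank_formEigenspace hB ha hBC haC hpos (LinearMap.pi l) ?_ hc
    (fun f hf => hcoer f fun j => congrFun hf j) hK
  have : (LinearMap.ker (LinearMap.pi l) : Set H) =
      ⋂ j, (LinearMap.mkContinuous (l j) (A j) (hA j)) ⁻¹' {0} := by
    ext f
    simp [funext_iff]
  rw [this]
  exact isClosed_iInter fun j => isClosed_singleton.preimage (ContinuousLinearMap.continuous _)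

/-! ### Weak derivatives and mollification on a vector space -/

/-! ### Cauchy–Schwarz and Jensen inequalities for lower integrals of squares. -/

section Jensen

variable {α : Type*} [MeasurableSpace α] {μ : Measure α}

/-- Hölder with exponents `2, 2` for the factors `√ψ` and `√ψ F`. -/
lemma sq_lintegral_mul_le_mul {ψ F : α → ENNReal} (hψ : AEMeasurable ψ μ) (hF : AEMeasurable F μ) :
    (∫⁻ x, ψ x * F x ∂μ) ^ 2 ≤ (∫⁻ x, ψ x ∂μ) * ∫⁻ x, ψ x * F x ^ 2 ∂μ := by
  have h2 : Real.HolderConjugate 2 2 := Real.HolderConjugate.two_two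
  have hs : ∀ x, (ψ x ^ (1 / 2 : ℝ)) ^ (2 : ℝ) = ψ x := fun x => by
    rw [← ENNReal.rpow_mul]; norm_num
  have hm : ∀ x, ψ x ^ (1 / 2 : ℝ) * ψ x ^ (1 / 2 : ℝ) = ψ x := fun x => by
    rw [← ENNReal.rpow_add_of_nonneg _ _ (by norm_num) (by norm_num)]; norm_num
  have key := ENNReal.lintegral_mul_le_Lp_mul_Lq μ h2 (hψ.pow_const (1 / 2 : ℝ))
    ((hψ.pow_const (1 / 2 : ℝ)).mul hF)
  simp only [Pi.mul_apply, ENNReal.mul_rpow_of_nonneg _ _ (zero_le_two (α := ℝ)), hs,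
    ← mul_assoc, hm] at key
  calc (∫⁻ x, ψ x * F x ∂μ) ^ 2
      ≤ ((∫⁻ x, ψ x ∂μ) ^ (1 / 2 : ℝ) * (∫⁻ x, ψ x * F x ^ (2 : ℝ) ∂μ) ^ (1 / 2 : ℝ)) ^ 2 := by
        gcongr
    _ = (∫⁻ x, ψ x ∂μ) * ∫⁻ x, ψ x * F x ^ 2 ∂μ := by
        rw [mul_pow, ← ENNReal.rpow_natCast, ← ENNReal.rpow_mul, ← ENNReal.rpow_natCast,
          ← ENNReal.rpow_mul]
        norm_num

lemma sq_lintegral_mul_le {ψ F : α → ENNReal} (hψ : AEMeasurable ψ μ) (hF : AEMeasurable F μ)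
    (h1 : ∫⁻ x, ψ x ∂μ ≤ 1) :
    (∫⁻ x, ψ x * F x ∂μ) ^ 2 ≤ ∫⁻ x, ψ x * F x ^ 2 ∂μ := by
  refine (sq_lintegral_mul_le_mul hψ hF).trans ?_
  calc _ ≤ 1 * ∫⁻ x, ψ x * F x ^ 2 ∂μ := by gcongr
    _ = _ := one_mul _

lemma sq_lintegral_le {F : α → ENNReal} (hF : AEMeasurable F μ) :
    (∫⁻ x, F x ∂μ) ^ 2 ≤ μ univ * ∫⁻ x, F x ^ 2 ∂μ := by
  simpa using sq_lintegral_mul_le_mul (ψ := fun _ => 1) aemeasurable_const hF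

lemma enorm_sq_le_of_sub {G : Type*} [NormedAddCommGroup G] (x y : G) :
    ‖x‖ₑ ^ 2 ≤ 2 * (‖x - y‖ₑ ^ 2 + ‖y‖ₑ ^ 2) := by
  have h1 : ‖x‖ₑ ≤ ‖x - y‖ₑ + ‖y‖ₑ := by
    simpa using enorm_add_le (x - y) y
  calc ‖x‖ₑ ^ 2 ≤ (‖x - y‖ₑ + ‖y‖ₑ) ^ 2 := by gcongr
    _ ≤ 2 * (‖x - y‖ₑ ^ 2 + ‖y‖ₑ ^ 2) := by
      have := ENNReal.rpow_add_le_mul_rpow_add_rpow ‖x - y‖ₑ ‖y‖ₑ (p := 2) (by norm_num)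
      norm_num at this
      exact this

lemma sq_enorm_integral_smul_le {G : Type*} [NormedAddCommGroup G] [NormedSpace ℝ G] {ψ : α → ℝ}
    {F : α → G} (hψ : AEMeasurable ψ μ) (hF : AEStronglyMeasurable F μ)
    (h1 : ∫⁻ x, ‖ψ x‖ₑ ∂μ ≤ 1) :
    ‖∫ x, ψ x • F x ∂μ‖ₑ ^ 2 ≤ ∫⁻ x, ‖ψ x‖ₑ * ‖F x‖ₑ ^ 2 ∂μ := by
  refine le_trans ?_ (sq_lintegral_mul_le hψ.enorm hF.enorm h1)
  gcongr
  refine (enorm_integral_le_lintegral_enorm _).trans_eq ?_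
  simp only [enorm_smul]

end Jensen

section VectorSpace

variable {E : Type*} [NormedAddCommGroup E] [NormedSpace ℝ E] [FiniteDimensional ℝ E]
  [MeasurableSpace E] [BorelSpace E] {μ : Measure E} [μ.IsAddHaarMeasure]

/-- `c` is the weak derivative of `u` on the whole space, and both are integrable. -/
structure IsWeakFDeriv (μ : Measure E) (u : E → ℝ) (c : E → E →L[ℝ] ℝ) : Prop where
  integrable : Integrable u μ
  integrable_deriv : Integrable c μ
  integral_eq : ∀ η : E → ℝ, ContDiff ℝ ∞ η → HasCompactSupport η → ∀ v,
    ∫ y, u y * fderiv ℝ η y v ∂μ = -∫ y, c y v * η y ∂μ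

lemma lintegral_enorm_normed (φ : ContDiffBump (0 : E)) : ∫⁻ x, ‖φ.normed μ x‖ₑ ∂μ = 1 := by
  rw [← ofReal_integral_norm_eq_lintegral_enorm φ.integrable_normed]
  simp [abs_of_nonneg (φ.nonneg_normed _), φ.integral_normed]

/-- The mollification `∫ φ(x - y) u(y) dy`. -/
def mollify (μ : Measure E) (φ : ContDiffBump (0 : E)) {G : Type*} [NormedAddCommGroup G]
    [NormedSpace ℝ G] (u : E → G) (x : E) : G :=
  ∫ y, φ.normed μ (x - y) • u y ∂μ

lemma mollify_eq_convolution {G : Type*} [NormedAddCommGroup G] [NormedSpace ℝ G]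
    (φ : ContDiffBump (0 : E)) (u : E → G) :
    mollify μ φ u = convolution (φ.normed μ) u (ContinuousLinearMap.lsmul ℝ ℝ) μ := by
  ext x
  rw [convolution_eq_swap]
  rfl

/-- Jensen's inequality for the probability density `φ(x - ·)`, then Tonelli and translation
invariance. -/
lemma lintegral_sq_mollify_le {G : Type*} [NormedAddCommGroup G] [NormedSpace ℝ G]
    (φ : ContDiffBump (0 : E)) {c : E → G} (hc : AEStronglyMeasurable c μ) :
    ∫⁻ x, ‖mollify μ φ c x‖ₑ ^ 2 ∂μ ≤ ∫⁻ x, ‖c x‖ₑ ^ 2 ∂μ := by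
  have hψ : Continuous (φ.normed μ) := φ.continuous_normed
  have hm : AEMeasurable (Function.uncurry fun x y => ‖φ.normed μ (x - y)‖ₑ * ‖c y‖ₑ ^ 2)
      (μ.prod μ) := by
    have h1 : Measurable fun z : E × E => ‖φ.normed μ (z.1 - z.2)‖ₑ :=
      (hψ.comp (by fun_prop)).enorm.measurable
    exact h1.aemeasurable.mul (hc.comp_snd.enorm.pow_const 2)
  calc ∫⁻ x, ‖mollify μ φ c x‖ₑ ^ 2 ∂μ
      ≤ ∫⁻ x, ∫⁻ y, ‖φ.normed μ (x - y)‖ₑ * ‖c y‖ₑ ^ 2 ∂μ ∂μ := by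
        refine lintegral_mono fun x => sq_enorm_integral_smul_le ?_ hc ?_
        · exact (hψ.comp (by fun_prop)).aemeasurable
        · rw [lintegral_sub_left_eq_self (fun y => ‖φ.normed μ y‖ₑ) x, lintegral_enorm_normed]
    _ = ∫⁻ y, ∫⁻ x, ‖φ.normed μ (x - y)‖ₑ * ‖c y‖ₑ ^ 2 ∂μ ∂μ := lintegral_lintegral_swap hm
    _ = ∫⁻ y, ‖c y‖ₑ ^ 2 ∂μ := by
        refine lintegral_congr fun y => ?_
        rw [lintegral_mul_const'', lintegral_sub_right_eq_self (fun x => ‖φ.normed μ x‖ₑ) y,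
          lintegral_enorm_normed, one_mul]
        exact (hψ.comp (by fun_prop)).enorm.aemeasurable

lemma IsWeakFDeriv.contDiff_mollify {u : E → ℝ} {c : E → E →L[ℝ] ℝ} (h : IsWeakFDeriv μ u c)
    (φ : ContDiffBump (0 : E)) : ContDiff ℝ 1 (mollify μ φ u) := by
  rw [mollify_eq_convolution]
  exact φ.hasCompactSupport_normed.contDiff_convolution_left (n := 1) _ φ.contDiff_normed
    h.integrable.locallyIntegrable

lemma hasCompactSupport_mollify {u : E → ℝ} (hu : HasCompactSupport u)
    (φ : ContDiffBump (0 : E)) : HasCompactSupport (mollify μ φ u) := by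
  rw [mollify_eq_convolution]
  exact φ.hasCompactSupport_normed.convolution _ hu

lemma IsWeakFDeriv.fderiv_mollify {u : E → ℝ} {c : E → E →L[ℝ] ℝ} (h : IsWeakFDeriv μ u c)
    (φ : ContDiffBump (0 : E)) (x : E) : fderiv ℝ (mollify μ φ u) x = mollify μ φ c x := by
  have hd := φ.hasCompactSupport_normed (μ := μ) |>.hasFDerivAt_convolution_left
    (ContinuousLinearMap.lsmul ℝ ℝ) (φ.contDiff_normed (n := 1)) h.integrable.locallyIntegrable x
  rw [← mollify_eq_convolution] at hd
  rw [hd.fderiv]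
  have hc1 : ContDiff ℝ 1 (φ.normed μ) := φ.contDiff_normed
  have he := (φ.hasCompactSupport_normed (μ := μ)).fderiv (𝕜 := ℝ) |>.convolutionExists_left
    (ContinuousLinearMap.precompL E (ContinuousLinearMap.lsmul ℝ ℝ))
    (hc1.continuous_fderiv (by simp)) h.integrable.locallyIntegrable x
  have he2 : Integrable (fun y => φ.normed μ (x - y) • c y) μ :=
    ((φ.hasCompactSupport_normed (μ := μ)).convolutionExists_left
      (ContinuousLinearMap.lsmul ℝ ℝ : ℝ →L[ℝ] (E →L[ℝ] ℝ) →L[ℝ] (E →L[ℝ] ℝ))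
      φ.continuous_normed h.integrable_deriv.locallyIntegrable x).integrable_swap
  ext v
  rw [convolution_eq_swap, ContinuousLinearMap.integral_apply he.integrable_swap, mollify,
    ContinuousLinearMap.integral_apply he2]
  -- The derivative of the convolution falls on the kernel. The test function is the kernel
  -- reflected at `x`; the sign from the reflection cancels the one in the integration by parts.
  let η : E → ℝ := fun y => φ.normed μ (x - y)
  have hη : ContDiff ℝ ∞ η := φ.contDiff_normed.comp (contDiff_const.sub contDiff_id)
  have hηc : HasCompactSupport η :=
    (φ.hasCompactSupport_normed (μ := μ)).comp_homeomorph (Homeomorph.subLeft x)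
  have hηd : ∀ y, fderiv ℝ η y v = -fderiv ℝ (φ.normed μ) (x - y) v := by
    intro y
    have h1 : HasFDerivAt (fun y => x - y) (-ContinuousLinearMap.id ℝ E) y := by
      simpa using (hasFDerivAt_id y).const_sub x
    have h2 := (hc1.differentiable (by simp) (x - y)).hasFDerivAt.comp y h1
    rw [show fderiv ℝ η y = _ from h2.fderiv]
    simp
  have key := h.integral_eq η hη hηc v
  simp only [hηd, mul_neg, integral_neg, neg_inj] at key
  simp only [smul_apply, smul_eq_mul]
  rw [← integral_congr_ae (Filter.Eventually.of_forall fun y => mul_comm (c y v) (η y)), ← key]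
  refine integral_congr_ae (Filter.Eventually.of_forall fun y => ?_)
  simp [ContinuousLinearMap.precompL_apply, mul_comm]

/-- A compactly supported function with a weak derivative in `L²` is the a.e. limit of `C¹`
functions with compact support whose derivatives are bounded in `L²`. -/
lemma IsWeakFDeriv.exists_approx {u : E → ℝ} {c : E → E →L[ℝ] ℝ} (h : IsWeakFDeriv μ u c)
    (hu : HasCompactSupport u) : ∃ U : ℕ → E → ℝ, (∀ k, ContDiff ℝ 1 (U k)) ∧
      (∀ k, HasCompactSupport (U k)) ∧
      (∀ k, ∫⁻ x, ‖fderiv ℝ (U k) x‖ₑ ^ 2 ∂μ ≤ ∫⁻ x, ‖c x‖ₑ ^ 2 ∂μ) ∧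
      ∀ᵐ x ∂μ, Filter.Tendsto (fun k => U k x) Filter.atTop (𝓝 (u x)) := by
  -- Radii tending to `0` with outer radius at most twice the inner one; the bounded ratio is what
  -- makes the mollifications converge almost everywhere.
  let φ : ℕ → ContDiffBump (0 : E) := fun k =>
    ⟨1 / ((k : ℝ) + 1), 2 * (1 / ((k : ℝ) + 1)), by positivity, by
      have : 0 < 1 / ((k : ℝ) + 1) := by positivity
      linarith⟩
  refine ⟨fun k => mollify μ (φ k) u, fun k => h.contDiff_mollify _,
    fun k => hasCompactSupport_mollify hu _, fun k => ?_, ?_⟩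
  · simp only [h.fderiv_mollify]
    exact lintegral_sq_mollify_le _ h.integrable_deriv.aestronglyMeasurable
  · simp only [mollify_eq_convolution]
    refine ContDiffBump.ae_convolution_tendsto_right_of_locallyIntegrable (K := 2) ?_ ?_
      h.integrable.locallyIntegrable
    · have := (tendsto_one_div_add_atTop_nhds_zero_nat (𝕜 := ℝ)).const_mul 2
      simpa [φ] using this
    · exact Filter.Eventually.of_forall fun k => le_rfl

lemma lintegral_sq_le_of_tendsto {α : Type*} [MeasurableSpace α] {ν : Measure α} {F : ℕ → α → ℝ}
    {f : α → ℝ} {A : ENNReal} (hF : ∀ k, AEMeasurable (F k) ν)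
    (hlim : ∀ᵐ x ∂ν, Filter.Tendsto (fun k => F k x) Filter.atTop (𝓝 (f x)))
    (hA : ∀ k, ∫⁻ x, ‖F k x‖ₑ ^ 2 ∂ν ≤ A) : ∫⁻ x, ‖f x‖ₑ ^ 2 ∂ν ≤ A := by
  calc ∫⁻ x, ‖f x‖ₑ ^ 2 ∂ν
      = ∫⁻ x, Filter.liminf (fun k => ‖F k x‖ₑ ^ 2) Filter.atTop ∂ν := by
        refine lintegral_congr_ae ?_
        filter_upwards [hlim] with x hx
        exact (((ENNReal.continuous_pow 2).tendsto _).comp hx.enorm).liminf_eq.symm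
    _ ≤ Filter.liminf (fun k => ∫⁻ x, ‖F k x‖ₑ ^ 2 ∂ν) Filter.atTop :=
        lintegral_liminf_le' fun k => (hF k).enorm.pow_const 2
    _ ≤ A := by
        refine Filter.liminf_le_of_le (by isBoundedDefault) fun b hb => ?_
        obtain ⟨k, hk⟩ := hb.exists
        exact hk.trans (hA k)

/-! ### Translations and the compactness estimate -/

/-- The difference is the integral of the derivative along the segment from `x` to `x - y`; Jensen
on `[0, 1]`, Tonelli and translation invariance give the bound. -/
lemma lintegral_sq_translate_le_of_contDiff {u : E → ℝ} (hu : ContDiff ℝ 1 u) (y : E) :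
    ∫⁻ x, ‖u x - u (x - y)‖ₑ ^ 2 ∂μ ≤ ‖y‖ₑ ^ 2 * ∫⁻ x, ‖fderiv ℝ u x‖ₑ ^ 2 ∂μ := by
  have hcd : Continuous (fderiv ℝ u) := hu.continuous_fderiv (by simp)
  have hpt : ∀ x, ‖u x - u (x - y)‖ₑ ^ 2 ≤
      ∫⁻ s in Ioc (0 : ℝ) 1, ‖y‖ₑ ^ 2 * ‖fderiv ℝ u (x - s • y)‖ₑ ^ 2 := by
    intro x
    have hder : ∀ s : ℝ, HasDerivAt (fun s : ℝ => u (x - s • y))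
        (-fderiv ℝ u (x - s • y) y) s := by
      intro s
      have h1 : HasDerivAt (fun s : ℝ => x - s • y) (-y) s := by
        simpa using ((hasDerivAt_id s).smul_const y).const_sub x
      have h2 := ((hu.differentiable (by simp) _).hasFDerivAt).comp_hasDerivAt s h1
      exact h2.congr_deriv (map_neg _ _)
    have hint := intervalIntegral.integral_eq_sub_of_hasDerivAt (a := 0) (b := 1)
      (fun s _ => hder s) (Continuous.intervalIntegrable (by fun_prop) _ _)
    simp only [one_smul, zero_smul, sub_zero] at hint
    rw [← neg_sub, enorm_neg, ← hint, intervalIntegral.integral_of_le zero_le_one]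
    have h3 := sq_enorm_integral_smul_le (μ := volume.restrict (Ioc (0 : ℝ) 1))
      (ψ := fun _ => (1 : ℝ)) (F := fun s : ℝ => -fderiv ℝ u (x - s • y) y) (by fun_prop)
      (Continuous.aestronglyMeasurable (by fun_prop)) (by simp)
    simp only [one_smul, enorm_one, one_mul, enorm_neg] at h3
    refine h3.trans (lintegral_mono fun s => ?_)
    rw [← mul_pow, mul_comm]
    gcongr
    exact ContinuousLinearMap.le_opENorm _ _
  have hm : AEMeasurable (Function.uncurry fun (x : E) (s : ℝ) =>
      ‖y‖ₑ ^ 2 * ‖fderiv ℝ u (x - s • y)‖ₑ ^ 2) (μ.prod (volume.restrict (Ioc (0 : ℝ) 1))) := by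
    have : Continuous fun z : E × ℝ => fderiv ℝ u (z.1 - z.2 • y) := by fun_prop
    exact (this.enorm.measurable.pow_const 2).const_mul _ |>.aemeasurable
  calc ∫⁻ x, ‖u x - u (x - y)‖ₑ ^ 2 ∂μ
      ≤ ∫⁻ x, ∫⁻ s in Ioc (0 : ℝ) 1, ‖y‖ₑ ^ 2 * ‖fderiv ℝ u (x - s • y)‖ₑ ^ 2 ∂volume ∂μ :=
        lintegral_mono hpt
    _ = ∫⁻ s in Ioc (0 : ℝ) 1, ∫⁻ x, ‖y‖ₑ ^ 2 * ‖fderiv ℝ u (x - s • y)‖ₑ ^ 2 ∂μ ∂volume :=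
        lintegral_lintegral_swap hm
    _ = ∫⁻ s in Ioc (0 : ℝ) 1, ‖y‖ₑ ^ 2 * ∫⁻ x, ‖fderiv ℝ u x‖ₑ ^ 2 ∂μ ∂volume := by
        refine lintegral_congr fun s => ?_
        rw [lintegral_const_mul' _ _ (by simp),
          lintegral_sub_right_eq_self (fun x => ‖fderiv ℝ u x‖ₑ ^ 2) (s • y)]
    _ = _ := by simp

lemma IsWeakFDeriv.lintegral_sq_translate_le {u : E → ℝ} {c : E → E →L[ℝ] ℝ}
    (h : IsWeakFDeriv μ u c) (hu : HasCompactSupport u) (y : E) :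
    ∫⁻ x, ‖u x - u (x - y)‖ₑ ^ 2 ∂μ ≤ ‖y‖ₑ ^ 2 * ∫⁻ x, ‖c x‖ₑ ^ 2 ∂μ := by
  obtain ⟨U, hU, -, hUc, hlim⟩ := h.exists_approx hu
  refine lintegral_sq_le_of_tendsto (F := fun k x => U k x - U k (x - y)) (fun k => ?_) ?_
    fun k => (lintegral_sq_translate_le_of_contDiff (hU k) y).trans (by gcongr _ * ?_; exact hUc k)
  · have := (hU k).continuous
    exact Continuous.aemeasurable (by fun_prop)
  · have := (measurePreserving_sub_right μ y).quasiMeasurePreserving.ae hlim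
    filter_upwards [hlim, this] with x h1 h2 using h1.sub h2

/-- `u - φ * u` is an average of the differences `u(x) - u(x - t)` over `|t| < rOut`, and each of
these is controlled by the translation estimate. -/
lemma IsWeakFDeriv.lintegral_sq_sub_mollify_le {u : E → ℝ} {c : E → E →L[ℝ] ℝ}
    (h : IsWeakFDeriv μ u c) (hu : HasCompactSupport u) (φ : ContDiffBump (0 : E)) :
    ∫⁻ x, ‖u x - mollify μ φ u x‖ₑ ^ 2 ∂μ ≤
      ENNReal.ofReal φ.rOut ^ 2 * ∫⁻ x, ‖c x‖ₑ ^ 2 ∂μ := by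
  have hψ : Continuous (φ.normed μ) := φ.continuous_normed
  have hum := h.integrable.aestronglyMeasurable
  have hsub : AEStronglyMeasurable (fun z : E × E => u (z.1 - z.2)) (μ.prod μ) :=
    hum.comp_quasiMeasurePreserving (quasiMeasurePreserving_sub_of_right_invariant μ μ)
  have hm : AEMeasurable (Function.uncurry fun x t => ‖φ.normed μ t‖ₑ * ‖u x - u (x - t)‖ₑ ^ 2)
      (μ.prod μ) := by
    have h1 : Measurable fun z : E × E => ‖φ.normed μ z.2‖ₑ :=
      (hψ.comp (by fun_prop)).enorm.measurable
    exact h1.aemeasurable.mul ((hum.comp_fst.sub hsub).enorm.pow_const 2)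
  have hpt : ∀ x, ‖u x - mollify μ φ u x‖ₑ ^ 2 ≤
      ∫⁻ t, ‖φ.normed μ t‖ₑ * ‖u x - u (x - t)‖ₑ ^ 2 ∂μ := by
    intro x
    have hex : Integrable (fun t => φ.normed μ t • u (x - t)) μ :=
      (φ.hasCompactSupport_normed (μ := μ)).convolutionExists_left
        (ContinuousLinearMap.lsmul ℝ ℝ : ℝ →L[ℝ] ℝ →L[ℝ] ℝ) φ.continuous_normed
        h.integrable.locallyIntegrable x
    have e : u x - mollify μ φ u x = ∫ t, φ.normed μ t • (u x - u (x - t)) ∂μ := by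
      simp only [smul_sub]
      rw [integral_sub (φ.integrable_normed.smul_const _) hex, integral_smul_const,
        φ.integral_normed, one_smul, mollify_eq_convolution]
      rfl
    rw [e]
    refine sq_enorm_integral_smul_le hψ.aemeasurable ?_ (lintegral_enorm_normed φ).le
    exact aestronglyMeasurable_const.sub
      (hum.comp_quasiMeasurePreserving (quasiMeasurePreserving_sub_left μ x))
  calc ∫⁻ x, ‖u x - mollify μ φ u x‖ₑ ^ 2 ∂μ
      ≤ ∫⁻ x, ∫⁻ t, ‖φ.normed μ t‖ₑ * ‖u x - u (x - t)‖ₑ ^ 2 ∂μ ∂μ := lintegral_mono hpt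
    _ = ∫⁻ t, ∫⁻ x, ‖φ.normed μ t‖ₑ * ‖u x - u (x - t)‖ₑ ^ 2 ∂μ ∂μ := lintegral_lintegral_swap hm
    _ ≤ ∫⁻ t, ‖φ.normed μ t‖ₑ * (ENNReal.ofReal φ.rOut ^ 2 * ∫⁻ x, ‖c x‖ₑ ^ 2 ∂μ) ∂μ := by
        refine lintegral_mono fun t => ?_
        rw [lintegral_const_mul' _ _ (by simp)]
        by_cases ht : t ∈ Metric.ball (0 : E) φ.rOut
        · gcongr
          refine (h.lintegral_sq_translate_le hu t).trans ?_
          gcongr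
          rw [mem_ball_zero_iff] at ht
          rw [← ofReal_norm]
          exact ENNReal.ofReal_le_ofReal ht.le
        · rw [← φ.support_normed_eq (μ := μ), Function.notMem_support] at ht
          simp [ht]
    _ = _ := by
        rw [lintegral_mul_const'' _ hψ.enorm.aemeasurable, lintegral_enorm_normed, one_mul]

end VectorSpace

section Rellich

variable {E : Type*} [NormedAddCommGroup E] [NormedSpace ℝ E] [FiniteDimensional ℝ E]
  [MeasurableSpace E] [BorelSpace E] {μ : Measure E} [μ.IsAddHaarMeasure]

/-- A quantitative form of the compactness of the Sobolev embedding: up to finitely many linear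
conditions on `u`, the `L²` norm of `u` is small compared with the Sobolev norm. -/
lemma exists_finite_mollify_test {K : Set E} (hK : IsCompact K) {ε : ℝ} (hε : 0 < ε) :
    ∃ (φ : ContDiffBump (0 : E)) (s : Finset E), ∀ (u : E → ℝ) (c : E → E →L[ℝ] ℝ),
      IsWeakFDeriv μ u c → (∀ x, x ∉ K → u x = 0) → (∀ x ∈ s, mollify μ φ u x = 0) →
      ∫⁻ x, ‖u x‖ₑ ^ 2 ∂μ ≤
        ENNReal.ofReal ε * (∫⁻ x, ‖u x‖ₑ ^ 2 ∂μ + ∫⁻ x, ‖c x‖ₑ ^ 2 ∂μ) := by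
  -- The estimate `|u|² ≤ 2 |u - φ * u|² + 2 |φ * u|²` costs a factor `2`. The first term gives `2
  -- r²` times the gradient energy, with `r` the mollification radius.
  obtain ⟨r, hr, hrε⟩ : ∃ r : ℝ, 0 < r ∧ 2 * r ^ 2 ≤ ε :=
    ⟨√(ε / 2), by positivity, by rw [Real.sq_sqrt (by positivity)]; linarith⟩
  let φ : ContDiffBump (0 : E) := ⟨r / 2, r, by positivity, by linarith⟩
  have hφ : UniformContinuous (φ.normed μ) :=
    φ.hasCompactSupport_normed.uniformContinuous_of_continuous φ.continuous_normed
  set m := (μ K).toReal with hm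
  have hμK : μ K = ENNReal.ofReal m := (ENNReal.ofReal_toReal hK.measure_lt_top.ne).symm
  -- With `m` the measure of `K`, an oscillation of the kernel of at most `τ` bounds the second term
  -- by `2 τ² m²` times the `L²` norm squared; `τ = r / (m + 1)` gives `τ m ≤ r`.
  have hm0 : 0 ≤ m := ENNReal.toReal_nonneg
  set τ := r / (m + 1) with hτ
  have hτ0 : 0 < τ := by positivity
  obtain ⟨δ, hδ, hδφ⟩ := Metric.uniformContinuous_iff.1 hφ τ hτ0
  -- The finite set of test points is a `δ`-net of `K`: if `φ * u` vanishes on the net, it is small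
  -- on all of `K` by uniform continuity of the kernel.
  obtain ⟨s, -, hs⟩ := hK.elim_nhds_subcover (fun x => Metric.ball x δ)
    fun x _ => Metric.ball_mem_nhds x hδ
  refine ⟨φ, s, fun u c hu hsupp htest => ?_⟩
  have hum := hu.integrable.aestronglyMeasurable
  have huc : HasCompactSupport u := HasCompactSupport.intro hK hsupp
  have hKm : MeasurableSet K := hK.measurableSet
  have hres : ∫⁻ x in K, ‖u x‖ₑ ^ 2 ∂μ = ∫⁻ x, ‖u x‖ₑ ^ 2 ∂μ := by
    rw [← lintegral_indicator hKm]
    refine lintegral_congr fun x => ?_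
    by_cases hx : x ∈ K
    · simp [hx]
    · simp [hx, hsupp x hx]
  have hmoll : ∀ x ∈ K, ‖mollify μ φ u x‖ₑ ^ 2 ≤
      ENNReal.ofReal (τ ^ 2 * m) * ∫⁻ y, ‖u y‖ₑ ^ 2 ∂μ := by
    intro x hx
    obtain ⟨z, hz, hxz⟩ := mem_iUnion₂.1 (hs hx)
    have hint : ∀ x, Integrable (fun y => φ.normed μ (x - y) • u y) μ := fun x =>
      ((φ.hasCompactSupport_normed (μ := μ)).convolutionExists_left
        (ContinuousLinearMap.lsmul ℝ ℝ : ℝ →L[ℝ] ℝ →L[ℝ] ℝ) φ.continuous_normed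
        hu.integrable.locallyIntegrable x).integrable_swap
    -- Subtract the mollification at the nearby net point `z`, which is zero.
    have e : mollify μ φ u x = ∫ y, (φ.normed μ (x - y) - φ.normed μ (z - y)) • u y ∂μ := by
      simp only [sub_smul]
      rw [integral_sub (hint x) (hint z)]
      change _ = _ - mollify μ φ u z
      rw [htest z hz, sub_zero]
      rfl
    have h1 : ‖mollify μ φ u x‖ₑ ≤ ENNReal.ofReal τ * ∫⁻ y in K, ‖u y‖ₑ ∂μ := by
      rw [e, ← lintegral_const_mul' _ _ (by simp), ← lintegral_indicator hKm]
      refine (enorm_integral_le_lintegral_enorm _).trans (lintegral_mono fun y => ?_)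
      by_cases hy : y ∈ K
      · rw [indicator_of_mem hy, enorm_smul]
        gcongr
        have := hδφ (a := x - y) (b := z - y) (by simpa using hxz)
        rw [Real.dist_eq] at this
        rw [Real.enorm_eq_ofReal_abs]
        exact ENNReal.ofReal_le_ofReal this.le
      · simp [hy, hsupp y hy]
    calc ‖mollify μ φ u x‖ₑ ^ 2 ≤ (ENNReal.ofReal τ * ∫⁻ y in K, ‖u y‖ₑ ∂μ) ^ 2 := by gcongr
      _ = ENNReal.ofReal τ ^ 2 * (∫⁻ y in K, ‖u y‖ₑ ∂μ) ^ 2 := mul_pow _ _ _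
      _ ≤ ENNReal.ofReal τ ^ 2 * (ENNReal.ofReal m * ∫⁻ y in K, ‖u y‖ₑ ^ 2 ∂μ) := by
        gcongr _ * ?_
        refine (sq_lintegral_le hum.enorm.restrict).trans_eq ?_
        rw [Measure.restrict_apply_univ, hμK]
      _ = _ := by
        rw [hres, ENNReal.ofReal_mul (by positivity), ENNReal.ofReal_pow hτ0.le, mul_assoc]
  have hmoll' : ∫⁻ x in K, ‖mollify μ φ u x‖ₑ ^ 2 ∂μ ≤
      ENNReal.ofReal (τ ^ 2 * m * m) * ∫⁻ y, ‖u y‖ₑ ^ 2 ∂μ := by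
    calc ∫⁻ x in K, ‖mollify μ φ u x‖ₑ ^ 2 ∂μ
        ≤ ∫⁻ x in K, ENNReal.ofReal (τ ^ 2 * m) * ∫⁻ y, ‖u y‖ₑ ^ 2 ∂μ ∂μ :=
          setLIntegral_mono' hKm hmoll
      _ = _ := by
          rw [setLIntegral_const, hμK, ENNReal.ofReal_mul (p := τ ^ 2 * m) (by positivity)]
          ring
  have hdiff : ∫⁻ x in K, ‖u x - mollify μ φ u x‖ₑ ^ 2 ∂μ ≤
      ENNReal.ofReal (r ^ 2) * ∫⁻ x, ‖c x‖ₑ ^ 2 ∂μ := by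
    rw [ENNReal.ofReal_pow hr.le]
    exact (setLIntegral_le_lintegral _ _).trans (hu.lintegral_sq_sub_mollify_le huc φ)
  have hmm : AEMeasurable (fun x => ‖mollify μ φ u x‖ₑ ^ 2) (μ.restrict K) :=
    ((hu.contDiff_mollify φ).continuous.enorm.measurable.pow_const 2).aemeasurable
  have hτm : 2 * (τ ^ 2 * m * m) ≤ ε := by
    refine le_trans ?_ hrε
    have : τ * m ≤ r := by
      rw [hτ, div_mul_eq_mul_div, div_le_iff₀ (by positivity)]
      nlinarith
    have h0 : 0 ≤ τ * m := by positivity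
    nlinarith
  calc ∫⁻ x, ‖u x‖ₑ ^ 2 ∂μ = ∫⁻ x in K, ‖u x‖ₑ ^ 2 ∂μ := hres.symm
    _ ≤ ∫⁻ x in K, 2 * (‖u x - mollify μ φ u x‖ₑ ^ 2 + ‖mollify μ φ u x‖ₑ ^ 2) ∂μ :=
      lintegral_mono fun x => enorm_sq_le_of_sub _ _
    _ = 2 * (∫⁻ x in K, ‖u x - mollify μ φ u x‖ₑ ^ 2 ∂μ +
        ∫⁻ x in K, ‖mollify μ φ u x‖ₑ ^ 2 ∂μ) := by
      rw [lintegral_const_mul' _ _ (by simp), lintegral_add_right' _ hmm]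
    _ ≤ 2 * (ENNReal.ofReal (r ^ 2) * ∫⁻ x, ‖c x‖ₑ ^ 2 ∂μ +
        ENNReal.ofReal (τ ^ 2 * m * m) * ∫⁻ y, ‖u y‖ₑ ^ 2 ∂μ) := by gcongr
    _ = ENNReal.ofReal (2 * r ^ 2) * ∫⁻ x, ‖c x‖ₑ ^ 2 ∂μ +
        ENNReal.ofReal (2 * (τ ^ 2 * m * m)) * ∫⁻ y, ‖u y‖ₑ ^ 2 ∂μ := by
      rw [ENNReal.ofReal_mul zero_le_two, ENNReal.ofReal_mul zero_le_two (q := τ ^ 2 * m * m),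
        ENNReal.ofReal_ofNat]
      ring
    _ ≤ ENNReal.ofReal ε * ∫⁻ x, ‖c x‖ₑ ^ 2 ∂μ + ENNReal.ofReal ε * ∫⁻ y, ‖u y‖ₑ ^ 2 ∂μ := by
      gcongr
    _ = _ := by ring

end Rellich

/-! ### The weighted Sobolev inequality -/

section Weighted

lemma exists_truncation : ∃ (θ : ℝ → ℝ) (L : ℝ), ContDiff ℝ 1 θ ∧ θ 0 = 0 ∧
    (∀ t, 2 ≤ |t| → θ t = 1) ∧ (∀ t, |deriv θ t| ≤ L) ∧
    ∀ t, |t| ∉ Ioc (1 : ℝ) 2 → deriv θ t = 0 := by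
  -- A smooth step in `t²`, equal to `0` for `|t| ≤ 1` and to `1` for `|t| ≥ 2`.
  let θ : ℝ → ℝ := fun t => Real.smoothTransition ((t ^ 2 - 1) / 3)
  have hθ : ContDiff ℝ 1 θ :=
    Real.smoothTransition.contDiff.comp (((contDiff_id.pow 2).sub contDiff_const).div_const 3)
  have h0 : ∀ t, |t| ≤ 1 → θ t = 0 := fun t ht => by
    have h1 := sq_le_one_iff_abs_le_one t |>.2 ht
    exact Real.smoothTransition.zero_of_nonpos (by linarith)
  have h1 : ∀ t, 2 ≤ |t| → θ t = 1 := fun t ht => by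
    have h2 : (2 : ℝ) ^ 2 ≤ t ^ 2 := sq_le_sq.2 (by simpa using ht)
    exact Real.smoothTransition.one_of_one_le (by linarith)
  have hd : ∀ t, |t| ∉ Ioc (1 : ℝ) 2 → deriv θ t = 0 := by
    intro t ht
    -- Where `θ` takes its extreme values `0` or `1` its derivative vanishes, endpoints included. So
    -- the half-open zone suffices, and the dyadic shells are disjoint.
    by_cases h : |t| ≤ 1
    · exact IsLocalMin.deriv_eq_zero (Filter.Eventually.of_forall fun s => by
        rw [h0 t h]; exact Real.smoothTransition.nonneg _)
    · have h2 : 2 ≤ |t| := by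
        by_contra h2
        exact ht ⟨not_le.1 h, (not_le.1 h2).le⟩
      exact IsLocalMax.deriv_eq_zero (Filter.Eventually.of_forall fun s => by
        rw [h1 t h2]; exact Real.smoothTransition.le_one _)
  obtain ⟨L, hL⟩ := (isCompact_Icc (a := (-2 : ℝ)) (b := 2)).exists_bound_of_continuousOn
    (hθ.continuous_deriv (by simp)).continuousOn
  refine ⟨θ, L, hθ, h0 0 (by simp), h1, fun t => ?_, hd⟩
  by_cases ht : |t| ∈ Ioc (1 : ℝ) 2
  · exact hL t (abs_le.1 ht.2)
  · rw [hd t ht, abs_zero]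
    exact (norm_nonneg _).trans (hL 0 (by simp))

/-- The set where `|u|` lies between `2 ^ k` and `2 ^ (k + 1)`. -/
def dyadicShell {α : Type*} (u : α → ℝ) (k : ℤ) : Set α :=
  {x | |u x| ∈ Ioc ((2 : ℝ) ^ k) (2 ^ (k + 1))}

lemma measurableSet_dyadicShell {α : Type*} [MeasurableSpace α] {u : α → ℝ} (hu : Measurable u)
    (k : ℤ) :
    MeasurableSet (dyadicShell u k) :=
  hu.abs measurableSet_Ioc

lemma pairwise_disjoint_dyadicShell {α : Type*} (u : α → ℝ) :
    Pairwise (Function.onFun Disjoint (dyadicShell u)) := by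
  intro i j hij
  refine Set.disjoint_left.2 fun x hi hj => hij ?_
  rcases lt_trichotomy i j with h | h | h
  · have : (2 : ℝ) ^ (i + 1) ≤ 2 ^ j := zpow_le_zpow_right₀ one_le_two h
    exact absurd (hi.2.trans this) (not_le.2 hj.1)
  · exact h
  · have : (2 : ℝ) ^ (j + 1) ≤ 2 ^ i := zpow_le_zpow_right₀ one_le_two h
    exact absurd (hj.2.trans this) (not_le.2 hi.1)

variable {E : Type*} [NormedAddCommGroup E] [NormedSpace ℝ E] [FiniteDimensional ℝ E]
  [MeasurableSpace E] [BorelSpace E] {μ : Measure E} [μ.IsAddHaarMeasure]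

/-- The Sobolev inequality, applied to a truncation of `u` between the levels `2 ^ k` and
`2 ^ (k + 1)`. -/
lemma exists_level_estimate (hdim : 2 < Module.finrank ℝ E) : ∃ C : ℝ≥0, ∀ u : E → ℝ,
    ContDiff ℝ 1 u → HasCompactSupport u → ∀ k : ℤ,
      μ {x | (2 : ℝ) ^ (k + 1) ≤ |u x|} ^ (1 - 2 / (Module.finrank ℝ E : ℝ)) ≤
        C * ENNReal.ofReal (2 ^ k)⁻¹ ^ 2 *
          ∫⁻ x in dyadicShell u k, ‖fderiv ℝ u x‖ₑ ^ 2 ∂μ := by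
  obtain ⟨θ, L, hθ, hθ0, hθ1, hθL, hθd⟩ := exists_truncation
  have hL0 : 0 ≤ L := (abs_nonneg _).trans (hθL 0)
  set N : ℝ := (Module.finrank ℝ E : ℝ) with hN
  have hN2 : 2 < N := by rw [hN]; exact_mod_cast hdim
  have hN0 : 0 < N := by linarith
  have hq0 : 0 < 1 / 2 - 1 / N := by
    rw [sub_pos]
    exact one_div_lt_one_div_of_lt two_pos hN2
  -- The Sobolev exponent `2 N / (N - 2)` conjugate to `2`.
  let p' : ℝ≥0 := ⟨(1 / 2 - 1 / N)⁻¹, by positivity⟩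
  have hp' : (p' : ℝ) = (1 / 2 - 1 / N)⁻¹ := rfl
  have hp'0 : (0 : ℝ) < p' := by rw [hp']; positivity
  set C₀ := SNormLESNormFDerivOfEqConst ℝ μ (2 : ℝ≥0) with hC₀
  refine ⟨(C₀ * L.toNNReal) ^ 2, fun u hu huc k => ?_⟩
  have h2k : (0 : ℝ) < 2 ^ k := by positivity
  let v : E → ℝ := fun x => θ (u x / 2 ^ k)
  have hv : ContDiff ℝ 1 v := hθ.comp (hu.div_const _)
  have hvc : HasCompactSupport v :=
    (huc.comp_left (g := fun t => θ (t / 2 ^ k)) (by simpa using hθ0))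
  have hvd : ∀ x, fderiv ℝ v x = (deriv θ (u x / 2 ^ k) * (2 ^ k)⁻¹) • fderiv ℝ u x := by
    intro x
    have h1 := ((hu.differentiable (by simp) x).hasFDerivAt).mul_const ((2 : ℝ) ^ k)⁻¹
    have h2 := ((hθ.differentiable (by simp)) (u x * (2 ^ k)⁻¹)).hasDerivAt.comp_hasFDerivAt x h1
    rw [smul_smul] at h2
    exact h2.fderiv
  have hvd' : ∀ x, ‖fderiv ℝ v x‖ₑ ^ 2 ≤ (dyadicShell u k).indicator (fun x =>
      (L.toNNReal : ENNReal) ^ 2 * ENNReal.ofReal (2 ^ k)⁻¹ ^ 2 * ‖fderiv ℝ u x‖ₑ ^ 2) x := by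
    intro x
    rw [hvd]
    by_cases hx : x ∈ dyadicShell u k
    · rw [indicator_of_mem hx, enorm_smul, ← mul_pow, ← mul_pow, enorm_mul]
      gcongr
      · rw [Real.enorm_eq_ofReal_abs]
        exact ENNReal.ofReal_le_ofReal (hθL _)
      · rw [Real.enorm_eq_ofReal (by positivity)]
    · rw [hθd]
      · rw [zero_mul, enorm_smul, enorm_zero, zero_mul, zero_pow two_ne_zero]
        exact bot_le
      · rw [abs_div, abs_of_pos h2k]
        intro h
        refine hx ⟨?_, ?_⟩
        · simpa using (lt_div_iff₀ h2k).1 h.1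
        · have := (div_le_iff₀ h2k).1 h.2
          rwa [zpow_add_one₀ two_ne_zero, mul_comm]
  have hGNS := eLpNorm_le_eLpNorm_fderiv_of_eq μ hv hvc (p := 2) (p' := p') (by norm_num)
    (by omega) (by rw [← hN]; push_cast; rw [← one_div (N), hp', inv_inv]; norm_num)
  -- Chebyshev at level `1`, since the truncation `v` equals `1` where `|u| ≥ 2 ^ (k + 1)`.
  have hmeas : μ {x | (2 : ℝ) ^ (k + 1) ≤ |u x|} ≤ eLpNorm v p' μ ^ (p' : ℝ) := by
    have h1 := mul_meas_ge_le_pow_eLpNorm' μ (p := p') (by simpa using hp'0.ne') (by simp)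
      hv.continuous.aestronglyMeasurable 1
    rw [ENNReal.one_rpow, one_mul] at h1
    refine le_trans (measure_mono fun x hx => ?_) h1
    have h2 : v x = 1 := by
      refine hθ1 _ ?_
      rw [abs_div, abs_of_pos h2k, le_div_iff₀ h2k, mul_comm, ← zpow_add_one₀ two_ne_zero]
      exact hx
    simp [h2]
  have hexp : (p' : ℝ) * (1 - 2 / N) = 2 := by
    rw [hp']
    have : 1 - 2 / N = 2 * (1 / 2 - 1 / N) := by ring
    rw [this, mul_comm, mul_assoc, mul_inv_cancel₀ hq0.ne', mul_one]
  have hL2 : eLpNorm (fderiv ℝ v) (2 : ℝ≥0) μ ^ 2 = ∫⁻ x, ‖fderiv ℝ v x‖ₑ ^ 2 ∂μ := by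
    have := eLpNorm_nnreal_pow_eq_lintegral (μ := μ) (f := fderiv ℝ v) (p := 2) two_ne_zero
    simpa using this
  calc μ {x | (2 : ℝ) ^ (k + 1) ≤ |u x|} ^ (1 - 2 / N)
      ≤ (eLpNorm v p' μ ^ (p' : ℝ)) ^ (1 - 2 / N) := by
        refine ENNReal.rpow_le_rpow hmeas ?_
        have : 2 / N < 1 := by rw [div_lt_one hN0]; exact hN2
        linarith
    _ = eLpNorm v p' μ ^ 2 := by
        rw [← ENNReal.rpow_mul, hexp]
        norm_num
    _ ≤ (C₀ * eLpNorm (fderiv ℝ v) (2 : ℝ≥0) μ) ^ 2 := by gcongr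
    _ = (C₀ : ENNReal) ^ 2 * ∫⁻ x, ‖fderiv ℝ v x‖ₑ ^ 2 ∂μ := by rw [mul_pow, hL2]
    _ ≤ (C₀ : ENNReal) ^ 2 * ∫⁻ x, (dyadicShell u k).indicator (fun x =>
          (L.toNNReal : ENNReal) ^ 2 * ENNReal.ofReal (2 ^ k)⁻¹ ^ 2 *
            ‖fderiv ℝ u x‖ₑ ^ 2) x ∂μ := by
        gcongr with x
        exact hvd' x
    _ = _ := by
        rw [lintegral_indicator (measurableSet_dyadicShell hu.continuous.measurable k),
          lintegral_const_mul' _ _ (ENNReal.mul_ne_top (by simp) (by simp))]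
        push_cast
        ring

/-- Truncation argument. On the shell of index `k + 1` one has `|u| ≤ 4 · 2 ^ k`, and the
`ν`-measure of the shell is controlled, through the level estimate, by `4⁻ᵏ` times the energy on the
shell of index `k`. The powers of `2` cancel and leave `4² = 16`. Disjoint shells carry disjoint
parts of the energy, so the sum over `k` costs nothing. Only the growth condition on `ν` is used,
which is why a weak Lorentz weight is enough. -/
lemma exists_weighted_sobolev_of_contDiff (hdim : 2 < Module.finrank ℝ E) : ∃ C : ℝ≥0,
    ∀ (ν : Measure E) (A : ENNReal), (∀ S, MeasurableSet S →
      ν S ≤ A * μ S ^ (1 - 2 / (Module.finrank ℝ E : ℝ))) → ∀ u : E → ℝ,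
    ContDiff ℝ 1 u → HasCompactSupport u →
      ∫⁻ x, ‖u x‖ₑ ^ 2 ∂ν ≤ C * A * ∫⁻ x, ‖fderiv ℝ u x‖ₑ ^ 2 ∂μ := by
  obtain ⟨C, hC⟩ := exists_level_estimate (μ := μ) hdim
  refine ⟨16 * C, fun ν A hν u hu huc => ?_⟩
  have hexp : 0 ≤ 1 - 2 / (Module.finrank ℝ E : ℝ) := by
    have h2 : (2 : ℝ) < Module.finrank ℝ E := by exact_mod_cast hdim
    have : 2 / (Module.finrank ℝ E : ℝ) < 1 := by rw [div_lt_one (by linarith)]; exact h2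
    linarith
  have hms := fun k => measurableSet_dyadicShell hu.continuous.measurable k
  have hcover : ∀ x, u x ≠ 0 → x ∈ ⋃ k : ℤ, dyadicShell u (k + 1) := by
    intro x hx
    obtain ⟨k, hk⟩ := exists_mem_Ioc_zpow (abs_pos.2 hx) one_lt_two
    refine mem_iUnion.2 ⟨k - 1, ?_⟩
    rw [sub_add_cancel]
    exact hk
  have hshell : ∀ k : ℤ, ∫⁻ x in dyadicShell u (k + 1), ‖u x‖ₑ ^ 2 ∂ν ≤
      16 * C * A * ∫⁻ x in dyadicShell u k, ‖fderiv ℝ u x‖ₑ ^ 2 ∂μ := by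
    intro k
    have h2k : (0 : ℝ) < 2 ^ k := by positivity
    calc ∫⁻ x in dyadicShell u (k + 1), ‖u x‖ₑ ^ 2 ∂ν
        ≤ ∫⁻ x in dyadicShell u (k + 1), ENNReal.ofReal (4 * 2 ^ k) ^ 2 ∂ν := by
          refine setLIntegral_mono' (hms _) fun x hx => ?_
          gcongr
          rw [Real.enorm_eq_ofReal_abs]
          refine ENNReal.ofReal_le_ofReal (hx.2.trans_eq ?_)
          rw [zpow_add_one₀ two_ne_zero, zpow_add_one₀ two_ne_zero]
          ring
      _ = ENNReal.ofReal (4 * 2 ^ k) ^ 2 * ν (dyadicShell u (k + 1)) := setLIntegral_const _ _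
      _ ≤ ENNReal.ofReal (4 * 2 ^ k) ^ 2 * (A * (C * ENNReal.ofReal (2 ^ k)⁻¹ ^ 2 *
          ∫⁻ x in dyadicShell u k, ‖fderiv ℝ u x‖ₑ ^ 2 ∂μ)) := by
          gcongr _ * ?_
          refine (hν _ (hms _)).trans ?_
          gcongr _ * ?_
          refine le_trans (ENNReal.rpow_le_rpow (measure_mono fun x hx => ?_) hexp) (hC u hu huc k)
          exact hx.1.le
      _ = (ENNReal.ofReal (4 * 2 ^ k) * ENNReal.ofReal (2 ^ k)⁻¹) ^ 2 * C * A *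
          ∫⁻ x in dyadicShell u k, ‖fderiv ℝ u x‖ₑ ^ 2 ∂μ := by ring
      _ = _ := by
          rw [← ENNReal.ofReal_mul (by positivity), mul_inv_cancel_right₀ h2k.ne',
            ENNReal.ofReal_ofNat]
          norm_num
  calc ∫⁻ x, ‖u x‖ₑ ^ 2 ∂ν
      ≤ ∫⁻ x in ⋃ k : ℤ, dyadicShell u (k + 1), ‖u x‖ₑ ^ 2 ∂ν := by
        rw [← lintegral_indicator (MeasurableSet.iUnion fun k => hms _)]
        refine lintegral_mono fun x => ?_
        by_cases hx : u x = 0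
        · simp [hx]
        · rw [indicator_of_mem (hcover x hx)]
    _ ≤ ∑' k : ℤ, ∫⁻ x in dyadicShell u (k + 1), ‖u x‖ₑ ^ 2 ∂ν := lintegral_iUnion_le _ _
    _ ≤ ∑' k : ℤ, 16 * C * A * ∫⁻ x in dyadicShell u k, ‖fderiv ℝ u x‖ₑ ^ 2 ∂μ :=
        ENNReal.tsum_le_tsum hshell
    _ = 16 * C * A * ∫⁻ x in ⋃ k, dyadicShell u k, ‖fderiv ℝ u x‖ₑ ^ 2 ∂μ := by
        rw [ENNReal.tsum_mul_left, lintegral_iUnion hms (pairwise_disjoint_dyadicShell u)]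
    _ ≤ 16 * C * A * ∫⁻ x, ‖fderiv ℝ u x‖ₑ ^ 2 ∂μ := by
        gcongr _ * ?_
        exact setLIntegral_le_lintegral _ _
    _ = _ := by push_cast; rfl

/-- A measure `ν` with `ν(S) ≤ A |S| ^ (1 - 2 / n)` is dominated by the Dirichlet form. -/
lemma exists_weighted_sobolev (μ : Measure E) [μ.IsAddHaarMeasure]
    (hdim : 2 < Module.finrank ℝ E) : ∃ C : ℝ≥0,
    ∀ (ν : Measure E) (A : ENNReal), (∀ S, MeasurableSet S →
      ν S ≤ A * μ S ^ (1 - 2 / (Module.finrank ℝ E : ℝ))) → ∀ (u : E → ℝ) (c : E → E →L[ℝ] ℝ),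
    IsWeakFDeriv μ u c → HasCompactSupport u →
      ∫⁻ x, ‖u x‖ₑ ^ 2 ∂ν ≤ C * A * ∫⁻ x, ‖c x‖ₑ ^ 2 ∂μ := by
  obtain ⟨C, hC⟩ := exists_weighted_sobolev_of_contDiff (μ := μ) hdim
  refine ⟨C, fun ν A hν u c hu huc => ?_⟩
  have hexp : 0 < 1 - 2 / (Module.finrank ℝ E : ℝ) := by
    have h2 : (2 : ℝ) < Module.finrank ℝ E := by exact_mod_cast hdim
    have : 2 / (Module.finrank ℝ E : ℝ) < 1 := by rw [div_lt_one (by linarith)]; exact h2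
    linarith
  -- Absolute continuity makes the a.e. convergence of the mollifications valid for `ν`, so that
  -- Fatou applies.
  have hac : ν ≪ μ := by
    refine Measure.AbsolutelyContinuous.mk fun S hS h0 => ?_
    have := hν S hS
    rw [h0, ENNReal.zero_rpow_of_pos hexp, mul_zero] at this
    exact nonpos_iff_eq_zero.1 this
  obtain ⟨U, hU, hUs, hUc, hlim⟩ := hu.exists_approx huc
  refine lintegral_sq_le_of_tendsto (fun k => (hU k).continuous.aemeasurable) (hac.ae_le hlim)
    fun k => (hC ν A hν (U k) (hU k) (hUs k)).trans ?_
  gcongr _ * ?_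
  exact hUc k

end Weighted

/-! ### Weak Lorentz spaces -/

section Lorentz

variable {X : Type*} [MeasurableSpace X] {μ : Measure X}

lemma meas_lt_le_of_lorentzNorm_le {w : X → ℝ} {p a : ℝ} (hp : 0 < p) (ha : 0 < a)
    (h : lorentzNorm μ w p ⊤ ≤ ENNReal.ofReal a) {s : ℝ} (hs : 0 < s) :
    μ {x | s < |w x|} ≤ ENNReal.ofReal ((a / s) ^ p) := by
  -- The strict inequality forces the rearrangement at `t` to be strictly below `s`, so some
  -- admissible level `s' < s` exists; then `t` decreases to `(a / s) ^ p`.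
  have key : ∀ t : ℝ, (a / s) ^ p < t → μ {x | s < |w x|} ≤ ENNReal.ofReal t := by
    intro t ht
    have ht0 : 0 < t := lt_of_le_of_lt (by positivity) ht
    have h1 : ENNReal.ofReal (t ^ (1 / p)) * decreasingRearrangement μ w t ≤ ENNReal.ofReal a := by
      refine le_trans ?_ h
      rw [lorentzNorm, if_pos rfl]
      exact le_iSup₂ (f := fun t (_ : t ∈ Ioi (0 : ℝ)) =>
        ENNReal.ofReal (t ^ (1 / p)) * decreasingRearrangement μ w t) t ht0
    have ht1 : 0 < t ^ (1 / p) := by positivity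
    have hlt : a / s < t ^ (1 / p) := by
      rw [one_div]
      exact (Real.lt_rpow_inv_iff_of_pos (by positivity) ht0.le hp).2 ht
    have h2 : decreasingRearrangement μ w t < ENNReal.ofReal s := by
      have h3 : decreasingRearrangement μ w t ≤ ENNReal.ofReal (a / t ^ (1 / p)) := by
        rw [ENNReal.ofReal_div_of_pos ht1,
          ENNReal.le_div_iff_mul_le (by left; simpa using ht1) (by left; simp), mul_comm]
        exact h1
      refine h3.trans_lt ((ENNReal.ofReal_lt_ofReal_iff hs).2 ?_)
      rw [div_lt_iff₀ ht1]
      rwa [div_lt_iff₀ hs, mul_comm] at hlt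
    rw [decreasingRearrangement, if_neg ht0.ne'] at h2
    obtain ⟨s', ⟨-, hs'⟩, hlt'⟩ := sInf_lt_iff.1 h2
    refine le_trans (measure_mono fun x hx => ?_) hs'
    change s' < ‖w x‖ₑ
    rw [Real.enorm_eq_ofReal_abs]
    exact hlt'.trans ((ENNReal.ofReal_lt_ofReal_iff (hs.trans hx)).2 hx)
  refine ENNReal.le_of_forall_pos_le_add fun ε hε _ => ?_
  have := key ((a / s) ^ p + ε) (by simpa using hε)
  rwa [ENNReal.ofReal_add (by positivity) (by positivity), ENNReal.ofReal_coe_nnreal] at this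

/-- The integral of a function in the weak Lorentz space `L(p, ∞)` over a set is bounded by a
power of the measure of the set. -/
lemma exists_setLIntegral_le_of_memLorentz {w : X → ℝ} {p : ℝ} (hp : 1 < p)
    (h : MemLorentz μ w p ⊤) : ∃ C : ℝ≥0, ∀ S, μ S < ⊤ →
      ∫⁻ x in S, ‖w x‖ₑ ∂μ ≤ C * μ S ^ (1 - 1 / p) := by
  have hp0 : 0 < p := by linarith
  -- The added `1` keeps `a` positive when the norm is zero.
  set a := (lorentzNorm μ w p ⊤).toReal + 1 with ha
  have ha0 : 0 < a := by positivity
  have hle : lorentzNorm μ w p ⊤ ≤ ENNReal.ofReal a := by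
    rw [← ENNReal.ofReal_toReal h.2.ne]
    exact ENNReal.ofReal_le_ofReal (by rw [ha]; linarith)
  refine ⟨(a * (1 + 1 / (p - 1))).toNNReal, fun S hS => ?_⟩
  have hp1 : 0 < p - 1 := by linarith
  by_cases hS0 : μ S = 0
  · rw [Measure.restrict_eq_zero.2 hS0, lintegral_zero_measure]
    exact bot_le
  set m := (μ S).toReal with hm
  have hm0 : 0 < m := ENNReal.toReal_pos hS0 hS.ne
  have hμS : μ S = ENNReal.ofReal m := (ENNReal.ofReal_toReal hS.ne).symm
  -- The layer-cake integral is split at the level where the two bounds for the distribution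
  -- function, `m` and `(a / s) ^ p`, agree. The upper part converges because `p > 1`.
  set s₀ := a * m ^ (-(1 / p)) with hs₀
  have hs₀0 : 0 < s₀ := by positivity
  have h1 : ∫⁻ x in S, ‖w x‖ₑ ∂μ = ∫⁻ s in Ioi (0 : ℝ), (μ.restrict S) {x | s < |w x|} := by
    rw [← lintegral_eq_lintegral_meas_lt (μ.restrict S) (f := fun x => |w x|)
      (Filter.Eventually.of_forall fun x => abs_nonneg _)
      (by simpa using h.1.aemeasurable.restrict.norm)]
    simp only [Real.enorm_eq_ofReal_abs]
  have h2 : ∫⁻ s in Ioc (0 : ℝ) s₀, (μ.restrict S) {x | s < |w x|} ≤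
      ENNReal.ofReal (a * m ^ (1 - 1 / p)) := by
    calc ∫⁻ s in Ioc (0 : ℝ) s₀, (μ.restrict S) {x | s < |w x|}
        ≤ ∫⁻ s in Ioc (0 : ℝ) s₀, ENNReal.ofReal m := by
          refine lintegral_mono fun s => ?_
          change (μ.restrict S) {x | s < |w x|} ≤ ENNReal.ofReal m
          rw [← hμS, ← Measure.restrict_apply_univ S]
          exact measure_mono (subset_univ _)
      _ = _ := by
          rw [setLIntegral_const, Real.volume_Ioc, sub_zero, ← ENNReal.ofReal_mul hm0.le, hs₀,
            sub_eq_add_neg, Real.rpow_add hm0, Real.rpow_one]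
          congr 1
          ring
  have h3 : ∫⁻ s in Ioi s₀, (μ.restrict S) {x | s < |w x|} ≤
      ENNReal.ofReal (a * m ^ (1 - 1 / p) * (1 / (p - 1))) := by
    have hint : IntegrableOn (fun s : ℝ => a ^ p * s ^ (-p)) (Ioi s₀) :=
      (integrableOn_Ioi_rpow_of_lt (by linarith) hs₀0).const_mul _
    calc ∫⁻ s in Ioi s₀, (μ.restrict S) {x | s < |w x|}
        ≤ ∫⁻ s in Ioi s₀, ENNReal.ofReal (a ^ p * s ^ (-p)) := by
          refine setLIntegral_mono' measurableSet_Ioi fun s hs => ?_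
          have hs0 : 0 < s := hs₀0.trans hs
          refine (Measure.restrict_apply_le _ _).trans
            ((meas_lt_le_of_lorentzNorm_le hp0 ha0 hle hs0).trans_eq ?_)
          rw [Real.div_rpow ha0.le hs0.le, Real.rpow_neg hs0.le, div_eq_mul_inv]
      _ = ENNReal.ofReal (∫ s in Ioi s₀, a ^ p * s ^ (-p)) := by
          rw [ofReal_integral_eq_lintegral_ofReal hint]
          filter_upwards [ae_restrict_mem measurableSet_Ioi] with s hs
          have hs0 : 0 < s := hs₀0.trans hs
          positivity
      _ = _ := by
          rw [integral_const_mul, integral_Ioi_rpow_of_lt (by linarith) hs₀0, hs₀,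
            Real.mul_rpow ha0.le (by positivity), ← Real.rpow_mul hm0.le]
          congr 1
          have e1 : a ^ p * a ^ (-p + 1) = a := by
            rw [← Real.rpow_add ha0]
            simp
          have e2 : -(1 / p) * (-p + 1) = 1 - 1 / p := by field_simp; ring
          rw [e2]
          calc a ^ p * (-(a ^ (-p + 1) * m ^ (1 - 1 / p)) / (-p + 1))
              = (a ^ p * a ^ (-p + 1)) * m ^ (1 - 1 / p) * (1 / (p - 1)) := by
                rw [show -p + 1 = -(p - 1) by ring, neg_div_neg_eq]
                ring
            _ = _ := by rw [e1]
  rw [h1, ← Ioc_union_Ioi_eq_Ioi hs₀0.le]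
  refine (lintegral_union_le _ _ _).trans ((add_le_add h2 h3).trans_eq ?_)
  rw [← ENNReal.ofReal_add (by positivity) (by positivity), hμS, ENNReal.ofReal_rpow_of_pos hm0]
  change _ = ENNReal.ofReal _ * _
  rw [← ENNReal.ofReal_mul (by positivity)]
  congr 1
  ring

end Lorentz

/-! ### The Riemannian volume in charts -/

lemma measurableSet_inter_preimage_of_continuousOn {α β : Type*} [TopologicalSpace α]
    [MeasurableSpace α] [BorelSpace α] [TopologicalSpace β] [MeasurableSpace β] [BorelSpace β]
    {f : α → β} {s : Set α} (hf : ContinuousOn f s) (hs : MeasurableSet s) {S : Set β}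
    (hS : MeasurableSet S) : MeasurableSet (s ∩ f ⁻¹' S) := by
  have h1 := hs.subtype_image ((continuousOn_iff_continuous_domRestrict.1 hf).measurable hS)
  convert h1 using 1
  ext x
  simp [and_comm]

section ChartSet

variable {n : ℕ} {M : Type*} [TopologicalSpace M] [ChartedSpace (EuclideanSpace ℝ (Fin n)) M]

/-- The part of the domain of the chart at `p` with coordinates in `K`. -/
def chartSet (p : M) (K : Set (EuclideanSpace ℝ (Fin n))) : Set M :=
  (chart n p).source ∩ chart n p ⁻¹' K

variable [MeasurableSpace M] [BorelSpace M]

lemma measurableSet_target_inter (p : M) {S : Set M} (hS : MeasurableSet S) :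
    MeasurableSet ((chart n p).target ∩ (chart n p).symm ⁻¹' S) :=
  measurableSet_inter_preimage_of_continuousOn (chart n p).symm.continuousOn
    (chart n p).open_target.measurableSet hS

lemma measurableSet_chartSet (p : M) {K : Set (EuclideanSpace ℝ (Fin n))} (hK : MeasurableSet K) :
    MeasurableSet (chartSet p K) :=
  measurableSet_inter_preimage_of_continuousOn (chart n p).continuousOn
    (chart n p).open_source.measurableSet hK

lemma aemeasurable_chart (p : M) (μ : Measure M) {K : Set (EuclideanSpace ℝ (Fin n))} :
    AEMeasurable (chart n p) (μ.restrict (chartSet p K)) :=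
  ((chart n p).continuousOn.aemeasurable (chart n p).open_source.measurableSet).mono_measure
    (Measure.restrict_mono inter_subset_left le_rfl)

end ChartSet

section Volume

variable {n : ℕ} {M : Type*} [TopologicalSpace M] [ChartedSpace (EuclideanSpace ℝ (Fin n)) M]
  [IsManifold (𝓡 n) ∞ M]

/-- The metric, with the tangent spaces identified with the model space. -/
def modelInner (g : SmoothMetric n M) (x : M) (v w : EuclideanSpace ℝ (Fin n)) : ℝ :=
  g.inner x v w

/-- `coordVec`, as a linear endomorphism of the model space. -/
def coordMap (p : M) (y : EuclideanSpace ℝ (Fin n)) :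
    EuclideanSpace ℝ (Fin n) →L[ℝ] EuclideanSpace ℝ (Fin n) :=
  mfderiv (𝓡 n) (𝓡 n) (chart n p).symm y

/-- The transition map from the chart at `q` to the chart at `p`. -/
def transition (p q : M) (z : EuclideanSpace ℝ (Fin n)) : EuclideanSpace ℝ (Fin n) :=
  chart n p ((chart n q).symm z)

lemma differentiableAt_transition (p q : M) {z : EuclideanSpace ℝ (Fin n)}
    (hz : z ∈ (chart n q).target) (hz' : (chart n q).symm z ∈ (chart n p).source) :
    DifferentiableAt ℝ (transition p q) z := by
  rw [← mdifferentiableAt_iff_differentiableAt]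
  exact ((mdifferentiable_chart (I := 𝓡 n) p).mdifferentiableAt hz').comp z
    ((mdifferentiable_chart (I := 𝓡 n) q).symm.mdifferentiableAt hz)

/-- The chain rule for `(chart q)⁻¹ = (chart p)⁻¹ ∘ transition`, valid near `z`. -/
lemma coordMap_transition (p q : M) {z : EuclideanSpace ℝ (Fin n)}
    (hz : z ∈ (chart n q).target) (hz' : (chart n q).symm z ∈ (chart n p).source) :
    coordMap q z = (coordMap p (transition p q z)).comp (fderiv ℝ (transition p q) z) := by
  have hT := differentiableAt_transition p q hz hz'
  have hmem : transition p q z ∈ (chart n p).target := (chart n p).map_source hz'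
  have hev : (chart n q).symm =ᶠ[𝓝 z] (chart n p).symm ∘ transition p q := by
    have h1 : ∀ᶠ y in 𝓝 z, (chart n q).symm y ∈ (chart n p).source :=
      ((chart n q).continuousAt_symm hz).eventually ((chart n p).open_source.mem_nhds hz')
    filter_upwards [h1] with y hy
    exact ((chart n p).left_inv hy).symm
  have h2 := hev.mfderiv_eq (I := 𝓡 n) (I' := 𝓡 n)
  have h3 := mfderiv_comp (I := 𝓡 n) (I' := 𝓡 n) (I'' := 𝓡 n) z
    ((mdifferentiable_chart (I := 𝓡 n) p).symm.mdifferentiableAt hmem)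
    (mdifferentiableAt_iff_differentiableAt.2 hT)
  rw [mfderiv_eq_fderiv] at h3
  exact h2.trans h3

lemma metricMatrix_apply (g : SmoothMetric n M) (p : M) (y : EuclideanSpace ℝ (Fin n))
    (i j : Fin n) : metricMatrix g p y i j = modelInner g ((chart n p).symm y)
      (coordMap p y (EuclideanSpace.single i 1)) (coordMap p y (EuclideanSpace.single j 1)) := rfl

lemma modelInner_sum (g : SmoothMetric n M) (p : M) (y v w : EuclideanSpace ℝ (Fin n)) :
    modelInner g ((chart n p).symm y) (coordMap p y v) (coordMap p y w) =
      ∑ i, ∑ j, v i * metricMatrix g p y i j * w j := by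
  let b : EuclideanSpace ℝ (Fin n) →L[ℝ] EuclideanSpace ℝ (Fin n) →L[ℝ] ℝ :=
    g.inner ((chart n p).symm y)
  have hb : ∀ v w, modelInner g ((chart n p).symm y) v w = b v w := fun _ _ => rfl
  have hexp : ∀ v : EuclideanSpace ℝ (Fin n),
      coordMap p y v = ∑ i, v i • coordMap p y (EuclideanSpace.single i 1) := by
    intro v
    conv_lhs => rw [← (EuclideanSpace.basisFun (Fin n) ℝ).sum_repr v]
    simp
  rw [hb, hexp v, hexp w]
  simp only [map_sum, map_smul, sum_apply, smul_apply, metricMatrix_apply, hb,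
    smul_eq_mul]
  simp only [Finset.mul_sum]
  rw [Finset.sum_comm]
  exact Finset.sum_congr rfl fun i _ => Finset.sum_congr rfl fun j _ => by ring

/-- The Gram matrices are related by `G_q = Jᵀ G_p J`, with `J` the Jacobian matrix of the
transition map. -/
lemma metricMatrix_det_transition (g : SmoothMetric n M) (p q : M)
    {z : EuclideanSpace ℝ (Fin n)} (hz : z ∈ (chart n q).target)
    (hz' : (chart n q).symm z ∈ (chart n p).source) :
    (metricMatrix g q z).det =
      (fderiv ℝ (transition p q) z).det ^ 2 * (metricMatrix g p (transition p q z)).det := by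
  set T' := fderiv ℝ (transition p q) z with hT'
  let b := (EuclideanSpace.basisFun (Fin n) ℝ).toBasis
  let J : Matrix (Fin n) (Fin n) ℝ := LinearMap.toMatrix b b T'
  have hJ : ∀ i j, J i j = T' (EuclideanSpace.single j 1) i := by
    intro i j
    simp [J, b, LinearMap.toMatrix_apply]
  have hx : (chart n q).symm z = (chart n p).symm (transition p q z) :=
    ((chart n p).left_inv hz').symm
  have key : metricMatrix g q z = J.transpose * metricMatrix g p (transition p q z) * J := by
    ext i j
    rw [metricMatrix_apply, coordMap_transition p q hz hz', hx]
    simp only [ContinuousLinearMap.comp_apply]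
    rw [modelInner_sum]
    simp only [Matrix.mul_apply, Matrix.transpose_apply, hJ, Finset.sum_mul]
    rw [Finset.sum_comm]
  rw [key, Matrix.det_mul, Matrix.det_mul, Matrix.det_transpose]
  have : J.det = T'.det := LinearMap.det_toMatrix b _
  rw [this]
  ring

lemma continuousOn_metricMatrix_det (g : SmoothMetric n M) (p : M) :
    ContinuousOn (fun y => (metricMatrix g p y).det) (chart n p).target := by
  simp only [Matrix.det_apply]
  refine continuousOn_finsetSum _ fun σ _ => ContinuousOn.const_smul ?_ _
  exact continuousOn_finsetProd _ fun i _ => continuousOn_metric_coordVec g p _ _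

/-- On a compact part of a chart, the Riemannian volume is comparable to Lebesgue measure. -/
lemma exists_coordVolume_comparable (g : SmoothMetric n M) (p : M)
    {K : Set (EuclideanSpace ℝ (Fin n))} (hK : IsCompact K) (hKt : K ⊆ (chart n p).target) :
    ∃ C : ℝ≥0, (coordVolume g p).restrict K ≤ (C : ENNReal) • volume.restrict K ∧
      volume.restrict K ≤ (C : ENNReal) • coordVolume g p := by
  have hKm := hK.measurableSet
  have hc : ContinuousOn (fun y => √(metricMatrix g p y).det) K :=
    (Real.continuous_sqrt.comp_continuousOn (continuousOn_metricMatrix_det g p)).mono hKt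
  have hpos : ∀ y ∈ K, 0 < √(metricMatrix g p y).det := fun y hy =>
    Real.sqrt_pos.2 (metricMatrix_det_pos g p (hKt hy))
  obtain ⟨C₁, hC₁⟩ := hK.exists_bound_of_continuousOn hc
  obtain ⟨C₂, hC₂⟩ := hK.exists_bound_of_continuousOn (hc.inv₀ fun y hy => (hpos y hy).ne')
  have hvol : ∀ S : Set (EuclideanSpace ℝ (Fin n)), coordVolume g p (S ∩ K) =
      ∫⁻ y in S ∩ K, ENNReal.ofReal (√(metricMatrix g p y).det) := by
    intro S
    rw [coordVolume, withDensity_apply',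
      Measure.restrict_restrict' (chart n p).open_target.measurableSet,
      inter_eq_self_of_subset_left (inter_subset_right.trans hKt)]
  refine ⟨C₁.toNNReal + C₂.toNNReal, Measure.le_iff.2 fun S hS => ?_,
    Measure.le_iff.2 fun S hS => ?_⟩
  · rw [Measure.restrict_apply hS, hvol, Measure.smul_apply, Measure.restrict_apply hS, smul_eq_mul]
    calc _ ≤ ∫⁻ y in S ∩ K, ENNReal.ofReal C₁ := by
          refine setLIntegral_mono' (hS.inter hKm) fun y hy => ENNReal.ofReal_le_ofReal ?_
          exact (le_abs_self _).trans (hC₁ y hy.2)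
      _ = ENNReal.ofReal C₁ * volume (S ∩ K) := setLIntegral_const _ _
      _ ≤ _ := by
          gcongr
          exact ENNReal.coe_le_coe.2 (le_add_of_nonneg_right bot_le)
  · rw [Measure.restrict_apply hS, Measure.smul_apply, smul_eq_mul]
    calc volume (S ∩ K) = ∫⁻ y in S ∩ K, 1 := by simp
      _ ≤ ∫⁻ y in S ∩ K, ENNReal.ofReal C₂ * ENNReal.ofReal (√(metricMatrix g p y).det) := by
          refine setLIntegral_mono' (hS.inter hKm) fun y hy => ?_
          have h1 := (le_abs_self _).trans (hC₂ y hy.2)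
          have h2 := hpos y hy.2
          rw [← ENNReal.ofReal_mul' h2.le, ← ENNReal.ofReal_one]
          refine ENNReal.ofReal_le_ofReal ?_
          calc (1 : ℝ) = (√(metricMatrix g p y).det)⁻¹ * √(metricMatrix g p y).det :=
                (inv_mul_cancel₀ h2.ne').symm
            _ ≤ _ := mul_le_mul_of_nonneg_right h1 h2.le
      _ = ENNReal.ofReal C₂ * coordVolume g p (S ∩ K) := by
          rw [lintegral_const_mul' _ _ (by simp), hvol]
      _ ≤ _ := by
          gcongr
          · exact ENNReal.coe_le_coe.2 (le_add_of_nonneg_left bot_le)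
          · exact inter_subset_left

variable [MeasurableSpace M] [BorelSpace M]

lemma map_coordVolume_apply (g : SmoothMetric n M) (p : M) {S : Set M} (hS : MeasurableSet S) :
    Measure.map (chart n p).symm (coordVolume g p) S =
      ∫⁻ y in (chart n p).target ∩ (chart n p).symm ⁻¹' S,
        ENNReal.ofReal (√(metricMatrix g p y).det) := by
  rw [Measure.map_apply_of_aemeasurable (aemeasurable_chart_symm g p) hS, coordVolume,
    withDensity_apply', Measure.restrict_restrict' (chart n p).open_target.measurableSet,
    inter_comm]

/-- The local volume measures agree on the overlaps of charts. -/
lemma map_coordVolume_overlap (g : SmoothMetric n M) (p q : M) {S : Set M}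
    (hS : MeasurableSet S) :
    Measure.map (chart n p).symm (coordVolume g p) (S ∩ (chart n q).source) ≤
      Measure.map (chart n q).symm (coordVolume g q) S := by
  have hSp := hS.inter (chart n p).open_source.measurableSet
  have hSq := hS.inter (chart n q).open_source.measurableSet
  set A := (chart n q).target ∩ (chart n q).symm ⁻¹' (S ∩ (chart n p).source) with hA
  have hAm : MeasurableSet A := measurableSet_target_inter q hSp
  have himg : (chart n p).target ∩ (chart n p).symm ⁻¹' (S ∩ (chart n q).source) =
      transition p q '' A := by
    ext y
    constructor
    · rintro ⟨hy, hyS, hyq⟩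
      refine ⟨chart n q ((chart n p).symm y), ⟨(chart n q).map_source hyq, ?_⟩, ?_⟩
      · rw [mem_preimage, (chart n q).left_inv hyq]
        exact ⟨hyS, (chart n p).map_target hy⟩
      · rw [transition, (chart n q).left_inv hyq, (chart n p).right_inv hy]
    · rintro ⟨z, ⟨hz, hzS, hzp⟩, rfl⟩
      refine ⟨(chart n p).map_source hzp, ?_⟩
      rw [mem_preimage, transition, (chart n p).left_inv hzp]
      exact ⟨hzS, (chart n q).map_target hz⟩
  -- The transition map is injective on the overlap, so the change of variables formula applies; its
  -- Jacobian factor is absorbed by `√det G_q = |det J| √det G_p`.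
  have hinj : InjOn (transition p q) A := by
    rintro z ⟨hz, -, hzp⟩ z' ⟨hz', -, hzp'⟩ h
    exact (chart n q).symm.injOn hz hz' ((chart n p).injOn hzp hzp' h)
  rw [map_coordVolume_apply g p hSq, himg, lintegral_image_eq_lintegral_abs_det_fderiv_mul volume
    hAm (fun z hz => (differentiableAt_transition p q hz.1 hz.2.2).hasFDerivAt.hasFDerivWithinAt)
    hinj, map_coordVolume_apply g q hS]
  calc _ = ∫⁻ z in A, ENNReal.ofReal (√(metricMatrix g q z).det) := by
        refine setLIntegral_congr_fun hAm fun z hz => ?_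
        rw [← ENNReal.ofReal_mul (abs_nonneg _), metricMatrix_det_transition g p q hz.1 hz.2.2,
          Real.sqrt_mul (sq_nonneg _), Real.sqrt_sq_eq_abs]
    _ ≤ _ := lintegral_mono_set (inter_subset_inter_right _ (preimage_mono inter_subset_left))

/-- On the domain of a chart, the Riemannian volume is `√(det g_ij) dy`. -/
lemma riemannianVolume_restrict_source (g : SmoothMetric n M) (q : M) :
    (riemannianVolume g).restrict (chart n q).source =
      Measure.map (chart n q).symm (coordVolume g q) := by
  have hq := (chart n q).open_source.measurableSet
  apply le_antisymm
  -- To bound the supremum, bound each local measure: its part in the domain of the chart at `q` by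
  -- the local measure of `q`, the rest by the volume off that domain. Restricting to the domain
  -- removes the second summand.
  · have hle : riemannianVolume g ≤ Measure.map (chart n q).symm (coordVolume g q) +
        (riemannianVolume g).restrict (chart n q).sourceᶜ := by
      refine iSup_le fun p => Measure.le_iff.2 fun S hS => ?_
      rw [← measure_inter_add_sdiff S hq, Measure.add_apply, Measure.restrict_apply hS]
      refine add_le_add (map_coordVolume_overlap g p q hS) ?_
      exact Measure.le_iff.1 (le_iSup (fun p : M =>
        Measure.map (chart n p).symm (coordVolume g p)) p) _ (hS.diff hq)
    refine (Measure.restrict_mono_measure hle _).trans ?_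
    rw [Measure.restrict_add, Measure.restrict_restrict hq, inter_compl_self,
      Measure.restrict_empty, add_zero]
    exact Measure.restrict_le_self
  · refine Measure.le_iff.2 fun S hS => ?_
    have h0 : Measure.map (chart n q).symm (coordVolume g q) (S \ (chart n q).source) = 0 := by
      rw [map_coordVolume_apply g q (hS.diff hq)]
      have : (chart n q).target ∩ (chart n q).symm ⁻¹' (S \ (chart n q).source) = ∅ := by
        ext y
        simp only [mem_inter_iff, mem_preimage, mem_sdiff, mem_empty_iff_false, iff_false]
        exact fun h => h.2.2 ((chart n q).map_target h.1)
      rw [this, Measure.restrict_empty, lintegral_zero_measure]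
    rw [← measure_inter_add_sdiff S hq, h0, add_zero, Measure.restrict_apply hS]
    exact Measure.le_iff.1 (le_iSup (fun p : M =>
        Measure.map (chart n p).symm (coordVolume g p)) q) _ (hS.inter hq)

/-- The first inequality carries estimates from a compact part of a chart to `M`, the second one
from `M` to the chart. -/
lemma exists_volume_comparable (g : SmoothMetric n M) (p : M)
    {K : Set (EuclideanSpace ℝ (Fin n))} (hK : IsCompact K) (hKt : K ⊆ (chart n p).target) :
    ∃ C : ℝ≥0, Measure.map (chart n p) ((riemannianVolume g).restrict (chartSet p K)) ≤
        (C : ENNReal) • volume.restrict K ∧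
      Measure.map (chart n p).symm (volume.restrict K) ≤ (C : ENNReal) • riemannianVolume g := by
  obtain ⟨C, hC1, hC2⟩ := exists_coordVolume_comparable g p hK hKt
  have hKm := hK.measurableSet
  have hq := (chart n p).open_source.measurableSet
  refine ⟨C, Measure.le_iff.2 fun S hS => ?_, ?_⟩
  · rw [Measure.map_apply_of_aemeasurable (aemeasurable_chart p _) hS]
    have hS' : MeasurableSet (chartSet p (S ∩ K)) := measurableSet_chartSet p (hS.inter hKm)
    have e : (chart n p ⁻¹' S) ∩ chartSet p K = chartSet p (S ∩ K) := by
      ext x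
      simp only [chartSet, mem_inter_iff, mem_preimage]
      tauto
    have hsub : chartSet p (S ∩ K) ⊆ (chart n p).source := inter_subset_left
    have e2 : (riemannianVolume g) (chartSet p (S ∩ K)) = coordVolume g p (S ∩ K) := by
      have h1 := congrArg (fun ν : Measure M => ν (chartSet p (S ∩ K)))
        (riemannianVolume_restrict_source g p)
      rw [Measure.restrict_apply hS', inter_eq_self_of_subset_left
        hsub,
        Measure.map_apply_of_aemeasurable (aemeasurable_chart_symm g p) hS'] at h1
      rw [h1]
      have hz : ∀ A B : Set (EuclideanSpace ℝ (Fin n)),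
          A ∩ (chart n p).target = B ∩ (chart n p).target →
          coordVolume g p A = coordVolume g p B := by
        intro A B hAB
        rw [coordVolume, withDensity_apply', withDensity_apply',
          Measure.restrict_restrict' (chart n p).open_target.measurableSet,
          Measure.restrict_restrict' (chart n p).open_target.measurableSet, hAB]
      refine hz _ _ ?_
      ext y
      simp only [chartSet, mem_inter_iff, mem_preimage]
      constructor
      · rintro ⟨⟨h1, h2, h3⟩, h4⟩
        rw [(chart n p).right_inv h4] at h2 h3
        exact ⟨⟨h2, h3⟩, h4⟩
      · rintro ⟨⟨h2, h3⟩, h4⟩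
        rw [(chart n p).right_inv h4]
        exact ⟨⟨(chart n p).map_target h4, h2, h3⟩, h4⟩
    rw [Measure.restrict_apply₀' (measurableSet_chartSet p hKm).nullMeasurableSet, e, e2,
      ← Measure.restrict_apply hS]
    exact Measure.le_iff.1 hC1 S hS
  · have hsymm : AEMeasurable (chart n p).symm (volume.restrict K) :=
      ((chart n p).symm.continuousOn.aemeasurable
        (chart n p).open_target.measurableSet).mono_measure (Measure.restrict_mono hKt le_rfl)
    refine Measure.le_iff.2 fun S hS => ?_
    rw [Measure.map_apply_of_aemeasurable hsymm hS, Measure.smul_apply, smul_eq_mul]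
    refine (hC2 _).trans ?_
    rw [Measure.smul_apply, smul_eq_mul]
    gcongr
    rw [← Measure.map_apply_of_aemeasurable (aemeasurable_chart_symm g p) hS]
    exact le_iSup (fun p : M => Measure.map (chart n p).symm (coordVolume g p)) p _

end Volume

/-! ### Finite covers by charts, and the transfer of a.e. statements -/

section Cover

variable {n : ℕ} {M : Type*} [TopologicalSpace M] [ChartedSpace (EuclideanSpace ℝ (Fin n)) M]

lemma exists_chartBump (p : M) : ∃ b : ContDiffBump (chart n p p),
    Metric.closedBall (chart n p p) b.rOut ⊆ (chart n p).target := by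
  obtain ⟨r, hr, hsub⟩ := Metric.isOpen_iff.1 (chart n p).open_target _
    ((chart n p).map_source (mem_chart_source _ p))
  refine ⟨⟨r / 4, r / 2, by positivity, by linarith⟩, ?_⟩
  exact (Metric.closedBall_subset_ball (by linarith)).trans hsub

/-- A bump function around `p`, in the coordinates of the chart at `p`. -/
def chartBump (n : ℕ) {M : Type*} [TopologicalSpace M]
    [ChartedSpace (EuclideanSpace ℝ (Fin n)) M] (p : M) : ContDiffBump (chart n p p) :=
  (exists_chartBump p).choose

/-- The closed ball that supports `chartBump`. -/
def outerBall (n : ℕ) {M : Type*} [TopologicalSpace M]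
    [ChartedSpace (EuclideanSpace ℝ (Fin n)) M] (p : M) : Set (EuclideanSpace ℝ (Fin n)) :=
  Metric.closedBall (chart n p p) (chartBump n p).rOut

/-- The closed ball on which `chartBump` is `1`. -/
def innerBall (n : ℕ) {M : Type*} [TopologicalSpace M]
    [ChartedSpace (EuclideanSpace ℝ (Fin n)) M] (p : M) : Set (EuclideanSpace ℝ (Fin n)) :=
  Metric.closedBall (chart n p p) (chartBump n p).rIn

lemma outerBall_subset (p : M) : outerBall n p ⊆ (chart n p).target :=
  (exists_chartBump p).choose_spec

lemma isCompact_outerBall (p : M) : IsCompact (outerBall n p) := isCompact_closedBall _ _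

lemma isCompact_innerBall (p : M) : IsCompact (innerBall n p) := isCompact_closedBall _ _

lemma innerBall_subset_outerBall (p : M) : innerBall n p ⊆ outerBall n p :=
  Metric.closedBall_subset_closedBall (chartBump n p).rIn_lt_rOut.le

lemma innerBall_subset (p : M) : innerBall n p ⊆ (chart n p).target :=
  (innerBall_subset_outerBall p).trans (outerBall_subset p)

lemma exists_finite_cover (n : ℕ) (M : Type*) [TopologicalSpace M] [CompactSpace M]
    [ChartedSpace (EuclideanSpace ℝ (Fin n)) M] :
    ∃ s : Finset M, ⋃ p : s, chartSet (p : M) (innerBall n (p : M)) = univ := by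
  obtain ⟨s, -, hs⟩ := isCompact_univ.elim_nhds_subcover
    (fun p : M => chartSet p (innerBall n p)) fun p _ => by
      refine Filter.inter_mem ((chart n p).open_source.mem_nhds (mem_chart_source _ p)) ?_
      exact ((chart n p).continuousAt (mem_chart_source _ p)).preimage_mem_nhds
        (Metric.closedBall_mem_nhds _ (chartBump n p).rIn_pos)
  refine ⟨s, univ_subset_iff.1 (hs.trans fun x hx => ?_)⟩
  obtain ⟨p, hp, hx⟩ := mem_iUnion₂.1 hx
  exact mem_iUnion.2 ⟨⟨p, hp⟩, hx⟩

variable [IsManifold (𝓡 n) ∞ M] [MeasurableSpace M] [BorelSpace M]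

lemma map_chart_absolutelyContinuous (g : SmoothMetric n M) (p : M)
    {K : Set (EuclideanSpace ℝ (Fin n))} (hK : IsCompact K) (hKt : K ⊆ (chart n p).target) :
    Measure.map (chart n p) ((riemannianVolume g).restrict (chartSet p K)) ≪
      volume.restrict (chart n p).target := by
  obtain ⟨C, hC, -⟩ := exists_volume_comparable g p hK hKt
  exact ((Measure.absolutelyContinuous_of_le hC).trans
    (Measure.AbsolutelyContinuous.rfl.smul_left _)).trans
    (Measure.absolutelyContinuous_of_le (Measure.restrict_mono hKt le_rfl))

lemma exists_lintegral_chart_le (g : SmoothMetric n M) (p : M)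
    {K : Set (EuclideanSpace ℝ (Fin n))} (hK : IsCompact K) (hKt : K ⊆ (chart n p).target) :
    ∃ C : ℝ≥0, ∀ h : M → ENNReal, AEMeasurable h (riemannianVolume g) →
      ∫⁻ y in K, h ((chart n p).symm y) ≤ C * ∫⁻ x, h x ∂riemannianVolume g := by
  obtain ⟨C, -, hC⟩ := exists_volume_comparable g p hK hKt
  refine ⟨C, fun h hh => ?_⟩
  have hsymm : AEMeasurable (chart n p).symm (volume.restrict K) :=
    ((chart n p).symm.continuousOn.aemeasurable
      (chart n p).open_target.measurableSet).mono_measure (Measure.restrict_mono hKt le_rfl)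
  have hh' : AEMeasurable h (Measure.map (chart n p).symm (volume.restrict K)) :=
    hh.mono_ac ((Measure.absolutelyContinuous_of_le hC).trans
      (Measure.AbsolutelyContinuous.rfl.smul_left _))
  rw [← lintegral_map' hh' hsymm]
  refine (lintegral_mono' hC le_rfl).trans_eq ?_
  rw [lintegral_smul_measure, smul_eq_mul]

variable [CompactSpace M]

instance isFiniteMeasure_riemannianVolume (g : SmoothMetric n M) :
    IsFiniteMeasure (riemannianVolume g) := by
  obtain ⟨s, hs⟩ := exists_finite_cover n M
  refine ⟨?_⟩
  rw [← hs]
  refine (measure_iUnion_le _).trans_lt ?_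
  rw [tsum_fintype, ENNReal.sum_lt_top]
  intro p _
  obtain ⟨C, hC, -⟩ := exists_volume_comparable g (p : M) (isCompact_innerBall (p : M))
    (innerBall_subset (p : M))
  have h1 := Measure.le_iff.1 hC univ MeasurableSet.univ
  rw [Measure.map_apply_of_aemeasurable (aemeasurable_chart _ _) MeasurableSet.univ, preimage_univ,
    Measure.restrict_apply_univ, Measure.smul_apply, Measure.restrict_apply_univ] at h1
  refine h1.trans_lt ?_
  exact ENNReal.mul_lt_top (by simp) (isCompact_innerBall (p : M)).measure_lt_top

lemma ae_of_ae_chart (g : SmoothMetric n M) {P : M → Prop}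
    (h : ∀ p : M, ∀ᵐ y ∂volume.restrict (chart n p).target, P ((chart n p).symm y)) :
    ∀ᵐ x ∂riemannianVolume g, P x := by
  obtain ⟨s, hs⟩ := exists_finite_cover n M
  rw [← Measure.restrict_univ (μ := riemannianVolume g), ← hs, ae_restrict_iUnion_iff]
  intro p
  have h1 := (map_chart_absolutelyContinuous g (p : M) (isCompact_innerBall (p : M))
    (innerBall_subset (p : M))).ae_le (h p)
  have hm := measurableSet_chartSet (p : M) (isCompact_innerBall (n := n) (p : M)).measurableSet
  filter_upwards [ae_of_ae_map (aemeasurable_chart _ _) h1, ae_restrict_mem hm] with x hx hxp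
  rwa [(chart n (p : M)).left_inv hxp.1] at hx

lemma aestronglyMeasurable_of_chart (g : SmoothMetric n M) {F : M → ℝ}
    (h : ∀ p : M, AEStronglyMeasurable (fun y => F ((chart n p).symm y))
      (volume.restrict (chart n p).target)) : AEStronglyMeasurable F (riemannianVolume g) := by
  obtain ⟨s, hs⟩ := exists_finite_cover n M
  rw [← Measure.restrict_univ (μ := riemannianVolume g), ← hs, aestronglyMeasurable_iUnion_iff]
  intro p
  have h1 := (h p).mono_ac (map_chart_absolutelyContinuous g (p : M)
    (isCompact_innerBall (p : M)) (innerBall_subset (p : M)))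
  have hm := measurableSet_chartSet (p : M) (isCompact_innerBall (n := n) (p : M)).measurableSet
  refine (h1.comp_aemeasurable (aemeasurable_chart _ _)).congr ?_
  filter_upwards [ae_restrict_mem hm] with x hxp
  simp only [Function.comp]
  rw [(chart n (p : M)).left_inv hxp.1]

end Cover

/-! ### Pointwise properties of the metric -/

section Metric

variable {n : ℕ} {M : Type*} [TopologicalSpace M] [ChartedSpace (EuclideanSpace ℝ (Fin n)) M]
  [IsManifold (𝓡 n) ∞ M]

lemma metric_self_nonneg (g : SmoothMetric n M) (x : M) (v : TangentSpace (𝓡 n) x) :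
    0 ≤ g.inner x v v := by
  by_cases h : v = 0
  · simp [h]
  · exact (g.pos x v h).le

lemma abs_metric_le (g : SmoothMetric n M) (x : M) (v w : TangentSpace (𝓡 n) x) :
    |g.inner x v w| ≤ √(g.inner x v v) * √(g.inner x w w) := by
  let _ : RiemannianBundle (fun x : M => TangentSpace (𝓡 n) x) := ⟨g.toRiemannianMetric⟩
  have h : ∀ u : TangentSpace (𝓡 n) x, √(g.inner x u u) = ‖u‖ := fun u =>
    (norm_eq_sqrt_real_inner u).symm
  rw [h, h]
  exact abs_real_inner_le_norm v w

lemma metric_add_self_le (g : SmoothMetric n M) (x : M) (v w : TangentSpace (𝓡 n) x) :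
    g.inner x (v + w) (v + w) ≤ 2 * g.inner x v v + 2 * g.inner x w w := by
  -- The parallelogram identity: the two sides differ by `|v - w|²`.
  have h := metric_self_nonneg g x (v - w)
  have hs := g.symm x v w
  simp only [map_add, map_sub, add_apply, sub_apply] at h ⊢
  linarith

lemma surjective_coordMap (p : M) {y : EuclideanSpace ℝ (Fin n)} (hy : y ∈ (chart n p).target) :
    Function.Surjective (coordMap (n := n) p y) := by
  have hd := (mdifferentiable_chart (I := 𝓡 n) p).symm
  have hinj : Function.Injective (coordMap (n := n) p y) := hd.mfderiv_injective (x := y) hy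
  exact (LinearMap.injective_iff_surjective (f := (coordMap (n := n) p y).toLinearMap)).1 hinj

/-- The components `g(X, ∂_i)` of a tangent vector `X`. -/
def metricComp (g : SmoothMetric n M) (p : M) (y X : EuclideanSpace ℝ (Fin n)) (i : Fin n) : ℝ :=
  modelInner g ((chart n p).symm y) X (coordMap p y (EuclideanSpace.single i 1))

/-- A weak gradient is known only through its components `g(X, ∂_i)`. This formula recovers `g(X,
Y)` from them; measurability of the energy density and uniqueness of the gradient rest on it. -/
lemma modelInner_eq_inv (g : SmoothMetric n M) (p : M) {y : EuclideanSpace ℝ (Fin n)}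
    (hy : y ∈ (chart n p).target) (X Y : EuclideanSpace ℝ (Fin n)) :
    modelInner g ((chart n p).symm y) X Y =
      ∑ i, ∑ j, (metricMatrix g p y)⁻¹ i j * metricComp g p y X j * metricComp g p y Y i := by
  obtain ⟨ξ, rfl⟩ := surjective_coordMap p hy X
  obtain ⟨ζ, rfl⟩ := surjective_coordMap p hy Y
  have hG : IsUnit (metricMatrix g p y).det := (metricMatrix_det_pos g p hy).ne'.isUnit
  have hsymm : ∀ i j, metricMatrix g p y i j = metricMatrix g p y j i := fun i j =>
    g.symm _ _ _
  have hcomp : ∀ ξ : EuclideanSpace ℝ (Fin n), metricComp g p y (coordMap p y ξ) =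
      (metricMatrix g p y).mulVec ξ := by
    intro ξ
    ext i
    rw [metricComp, modelInner_sum]
    simp only [Matrix.mulVec, dotProduct]
    refine Finset.sum_congr rfl fun j _ => ?_
    rw [Finset.sum_eq_single i (fun k _ hk => by simp [hk]) (by simp), hsymm i j]
    simp [mul_comm]
  have hinv : (metricMatrix g p y)⁻¹.mulVec (metricComp g p y (coordMap p y ξ)) = ξ := by
    rw [hcomp, Matrix.mulVec_mulVec, Matrix.nonsing_inv_mul _ hG, Matrix.one_mulVec]
  rw [modelInner_sum]
  calc _ = ∑ i, ξ i * metricComp g p y (coordMap p y ζ) i := by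
        rw [hcomp]
        simp only [Matrix.mulVec, dotProduct, Finset.mul_sum, mul_assoc]
    _ = _ := by
        refine Finset.sum_congr rfl fun i _ => ?_
        rw [← Finset.sum_mul]
        congr 1
        exact (congrFun hinv i).symm

lemma continuousOn_metricMatrix_inv (g : SmoothMetric n M) (p : M) (i j : Fin n) :
    ContinuousOn (fun y => (metricMatrix g p y)⁻¹ i j) (chart n p).target := by
  have h1 : ContinuousOn (metricMatrix g p) (chart n p).target :=
    continuousOn_pi.2 fun i => continuousOn_pi.2 fun j => continuousOn_metric_coordVec g p _ _
  have h2 : ContinuousOn (fun y => (metricMatrix g p y).adjugate i j) (chart n p).target :=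
    ((continuous_id.matrix_adjugate.matrix_elem i j).comp_continuousOn h1)
  refine (((continuousOn_metricMatrix_det g p).inv₀
    fun y hy => (metricMatrix_det_pos g p hy).ne').mul h2).congr fun y hy => ?_
  simp [Matrix.inv_def, Ring.inverse_eq_inv']

lemma exists_coordMap_bound (g : SmoothMetric n M) (p : M) {K : Set (EuclideanSpace ℝ (Fin n))}
    (hK : IsCompact K) (hKt : K ⊆ (chart n p).target) : ∃ C : ℝ, 0 < C ∧ ∀ y ∈ K, ∀ v,
      modelInner g ((chart n p).symm y) (coordMap p y v) (coordMap p y v) ≤ C * ‖v‖ ^ 2 := by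
  have hb : ∀ i j, ∃ C : ℝ, ∀ y ∈ K, ‖metricMatrix g p y i j‖ ≤ C := fun i j =>
    hK.exists_bound_of_continuousOn ((continuousOn_metric_coordVec g p _ _).mono hKt)
  choose C hC using hb
  refine ⟨∑ i, ∑ j, |C i j| + 1, by positivity, fun y hy v => ?_⟩
  rw [modelInner_sum]
  have hv : ∀ i, |v i| ≤ ‖v‖ := fun i => PiLp.norm_apply_le v i
  calc ∑ i, ∑ j, v i * metricMatrix g p y i j * v j
      ≤ ∑ i, ∑ j, |C i j| * ‖v‖ ^ 2 := by
        refine Finset.sum_le_sum fun i _ => Finset.sum_le_sum fun j _ => ?_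
        refine (le_abs_self _).trans ?_
        rw [abs_mul, abs_mul]
        have h1 : |metricMatrix g p y i j| ≤ |C i j| := (hC i j y hy).trans (le_abs_self _)
        calc _ ≤ ‖v‖ * |C i j| * ‖v‖ := by gcongr <;> apply hv
          _ = _ := by ring
    _ ≤ _ := by
        simp only [← Finset.sum_mul]
        gcongr
        linarith

/-- Pointwise comparison with the model norm; it makes sequences that are Cauchy in `g_x` converge
in the topology of the tangent space. No uniformity in `x` is needed for that. -/
lemma exists_metric_coercive (g : SmoothMetric n M) (x : M) : ∃ δ > 0,
    ∀ v : EuclideanSpace ℝ (Fin n), δ * ‖v‖ ^ 2 ≤ modelInner g x v v := by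
  let b : EuclideanSpace ℝ (Fin n) →L[ℝ] EuclideanSpace ℝ (Fin n) →L[ℝ] ℝ := g.inner x
  exact exists_coercive_of_finiteDimensional (LinearMap.mk₂ ℝ (fun v w => b v w) (by simp)
    (by simp) (by simp) (by simp)) (C := ‖b‖) (fun v w => b.le_opNorm₂ v w)
    (fun v hv => g.pos x v hv)

lemma continuous_modelInner (g : SmoothMetric n M) (x : M) :
    Continuous fun z : EuclideanSpace ℝ (Fin n) × EuclideanSpace ℝ (Fin n) =>
      modelInner g x z.1 z.2 := by
  let b : EuclideanSpace ℝ (Fin n) →L[ℝ] EuclideanSpace ℝ (Fin n) →L[ℝ] ℝ := g.inner x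
  change Continuous fun z : EuclideanSpace ℝ (Fin n) × EuclideanSpace ℝ (Fin n) => b z.1 z.2
  fun_prop

end Metric

/-! ### Weak gradients -/

lemma memLp_two_of_lintegral_sq {α : Type*} [MeasurableSpace α] {μ : Measure α} {f : α → ℝ}
    (hf : AEStronglyMeasurable f μ) (h : ∫⁻ x, ‖f x‖ₑ ^ 2 ∂μ < ⊤) : MemLp f 2 μ := by
  refine ⟨hf, ?_⟩
  rw [eLpNorm_lt_top_iff_lintegral_rpow_enorm_lt_top two_ne_zero (by simp)]
  simpa using h

lemma lintegral_sq_lt_top {α : Type*} [MeasurableSpace α] {μ : Measure α} {f : α → ℝ}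
    (hf : MemLp f 2 μ) : ∫⁻ x, ‖f x‖ₑ ^ 2 ∂μ < ⊤ := by
  have := (eLpNorm_lt_top_iff_lintegral_rpow_enorm_lt_top two_ne_zero (by simp)).1 hf.2
  simpa using this

lemma integrable_of_lintegral_sq {α : Type*} [MeasurableSpace α] {μ : Measure α}
    [IsFiniteMeasure μ] {f : α → ℝ} (hf : AEStronglyMeasurable f μ)
    (h : ∫⁻ x, ‖f x‖ₑ ^ 2 ∂μ < ⊤) : Integrable f μ :=
  (memLp_two_of_lintegral_sq hf h).integrable one_le_two

lemma lintegral_sq_Lp {α : Type*} [MeasurableSpace α] {μ : Measure α} (f : Lp ℝ 2 μ) :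
    ∫⁻ x, ‖f x‖ₑ ^ 2 ∂μ = ENNReal.ofReal (‖f‖ ^ 2) := by
  rw [← real_inner_self_eq_norm_sq, L2.inner_def,
    ofReal_integral_eq_lintegral_ofReal (L2.integrable_inner f f)]
  · refine lintegral_congr fun x => ?_
    rw [real_inner_self_eq_norm_sq, ← ofReal_norm, ← ENNReal.ofReal_pow (norm_nonneg _)]
  · exact Filter.Eventually.of_forall fun x => real_inner_self_nonneg

section Gradient

variable {n : ℕ} {M : Type*} [TopologicalSpace M] [ChartedSpace (EuclideanSpace ℝ (Fin n)) M]
  [IsManifold (𝓡 n) ∞ M] {g : SmoothMetric n M} {f f' : M → ℝ}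
  {X X' : (x : M) → TangentSpace (𝓡 n) x}

lemma IsWeakGradient.sub (h : IsWeakGradient g f X) (h' : IsWeakGradient g f' X') :
    IsWeakGradient g (f - f') (X - X') := by
  have := h.add (h'.smul (-1))
  rwa [neg_one_smul, neg_one_smul, ← sub_eq_add_neg, ← sub_eq_add_neg] at this

lemma IsWeakGradient.aestronglyMeasurable_comp (h : IsWeakGradient g f X) (p : M)
    (v : EuclideanSpace ℝ (Fin n)) : AEStronglyMeasurable
      (fun y => g.inner ((chart n p).symm y) (X ((chart n p).symm y)) (coordVec p y v))
      (volume.restrict (chart n p).target) :=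
  (h p v).2.1.aestronglyMeasurable

variable [MeasurableSpace M] [BorelSpace M]

lemma isWeakGradient_weakGradient (f : W12 g) : IsWeakGradient g f.1 (weakGradient f) :=
  f.2.choose_spec.1

lemma memL2Field_weakGradient (f : W12 g) : MemL2Field g (weakGradient f) :=
  f.2.choose_spec.2

variable (g) in
/-- The form `∫ f h ρ`, for a weight `ρ` for which it converges. -/
def weightForm (ρ : M → ℝ)
    (hρ : ∀ f h : W12 g, Integrable (fun x => f.1 x * h.1 x * ρ x) (riemannianVolume g)) :
    W12 g →ₗ[ℝ] W12 g →ₗ[ℝ] ℝ :=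
  LinearMap.mk₂ ℝ (fun f h => ∫ x, f.1 x * h.1 x * ρ x ∂riemannianVolume g)
    (fun f f' h => by
      rw [← integral_add (hρ f h) (hρ f' h)]
      refine integral_congr_ae ?_
      filter_upwards [Lp.coeFn_add f.1 f'.1] with x hx
      rw [Submodule.coe_add, hx, Pi.add_apply]
      ring)
    (fun c f h => by
      rw [smul_eq_mul, ← integral_const_mul]
      refine integral_congr_ae ?_
      filter_upwards [Lp.coeFn_smul c f.1] with x hx
      rw [Submodule.coe_smul, hx, Pi.smul_apply, smul_eq_mul]
      ring)
    (fun f h h' => by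
      rw [← integral_add (hρ f h) (hρ f h')]
      refine integral_congr_ae ?_
      filter_upwards [Lp.coeFn_add h.1 h'.1] with x hx
      rw [Submodule.coe_add, hx, Pi.add_apply]
      ring)
    (fun c f h => by
      rw [smul_eq_mul, ← integral_const_mul]
      refine integral_congr_ae ?_
      filter_upwards [Lp.coeFn_smul c h.1] with x hx
      rw [Submodule.coe_smul, hx, Pi.smul_apply, smul_eq_mul]
      ring)

lemma weightForm_apply {ρ : M → ℝ}
    (hρ : ∀ f h : W12 g, Integrable (fun x => f.1 x * h.1 x * ρ x) (riemannianVolume g))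
    (f h : W12 g) :
    weightForm g ρ hρ f h = ∫ x, f.1 x * h.1 x * ρ x ∂riemannianVolume g := rfl

lemma weightForm_comm {ρ : M → ℝ}
    (hρ : ∀ f h : W12 g, Integrable (fun x => f.1 x * h.1 x * ρ x) (riemannianVolume g))
    (f h : W12 g) : weightForm g ρ hρ f h = weightForm g ρ hρ h f :=
  integral_congr_ae (Filter.Eventually.of_forall fun x => by
    change f.1 x * h.1 x * ρ x = h.1 x * f.1 x * ρ x
    ring)

/-- The factor `1` is kept so that this is the convergence hypothesis of `weightForm` for the
constant weight. -/
lemma integrable_mul_W12 (f h : W12 g) :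
    Integrable (fun x => f.1 x * h.1 x * (1 : ℝ)) (riemannianVolume g) := by
  simpa [Pi.mul_def] using (Lp.memLp f.1).integrable_mul (Lp.memLp h.1)

lemma weightForm_one_self (f : W12 g) :
    weightForm g (fun _ => 1) integrable_mul_W12 f f = ‖f.1‖ ^ 2 := by
  rw [weightForm_apply, ← real_inner_self_eq_norm_sq, L2.inner_def]
  refine integral_congr_ae (Filter.Eventually.of_forall fun x => ?_)
  simp [pow_two]

variable [CompactSpace M]

lemma IsWeakGradient.aestronglyMeasurable_inner (h : IsWeakGradient g f X)
    (h' : IsWeakGradient g f' X') :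
    AEStronglyMeasurable (fun x => g.inner x (X x) (X' x)) (riemannianVolume g) := by
  refine aestronglyMeasurable_of_chart g fun p => ?_
  have hm := (chart n p).open_target.measurableSet
  have h1 : AEStronglyMeasurable (fun y => ∑ i, ∑ j, (metricMatrix g p y)⁻¹ i j *
      metricComp g p y (X ((chart n p).symm y)) j * metricComp g p y (X' ((chart n p).symm y)) i)
      (volume.restrict (chart n p).target) := by
    refine Finset.aestronglyMeasurable_fun_sum _ fun i _ =>
      Finset.aestronglyMeasurable_fun_sum _ fun j _ => ?_
    exact (((continuousOn_metricMatrix_inv g p i j).aestronglyMeasurable hm).mul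
      (h.aestronglyMeasurable_comp p _)).mul (h'.aestronglyMeasurable_comp p _)
  refine h1.congr ?_
  filter_upwards [ae_restrict_mem hm] with y hy
  exact (modelInner_eq_inv g p hy _ _).symm

/-- Uniqueness of the weak gradient: the components vanish by the fundamental lemma of the calculus
of variations, and the inverse Gram matrix then gives `g(X, X) = 0`. It is what makes the chosen
`weakGradient` linear up to null sets. -/
lemma ae_eq_zero_of_isWeakGradient_zero (h : IsWeakGradient g (0 : M → ℝ) X) :
    ∀ᵐ x ∂riemannianVolume g, X x = 0 := by
  refine ae_of_ae_chart g fun p => ?_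
  have ho := (chart n p).open_target
  have h1 : ∀ i : Fin n, ∀ᵐ y ∂(volume : Measure (EuclideanSpace ℝ (Fin n))),
      y ∈ (chart n p).target →
        metricComp g p y (X ((chart n p).symm y)) i = 0 := by
    intro i
    obtain ⟨-, h2, h3⟩ := h p (EuclideanSpace.single i 1)
    refine ho.ae_eq_zero_of_integral_contDiff_smul_eq_zero h2 fun η hη hc hs => ?_
    have h4 := h3 η hη hc hs
    simp only [Pi.zero_apply, zero_mul, integral_zero, zero_eq_neg] at h4
    rw [← h4, ← setIntegral_eq_integral_of_forall_compl_eq_zero (s := (chart n p).target)]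
    · exact integral_congr_ae (Filter.Eventually.of_forall fun y => mul_comm _ _)
    · intro y hy
      rw [image_eq_zero_of_notMem_tsupport fun h => hy (hs h), zero_smul]
  rw [ae_restrict_iff' ho.measurableSet]
  filter_upwards [ae_all_iff.2 h1] with y hy hyt
  by_contra hne
  refine (g.pos _ _ hne).ne' ?_
  have h5 := modelInner_eq_inv g p hyt (X ((chart n p).symm y)) (X ((chart n p).symm y))
  simp only [hy _ hyt, mul_zero, Finset.sum_const_zero] at h5
  exact h5

lemma IsWeakGradient.ae_eq (h : IsWeakGradient g f X) (h' : IsWeakGradient g f' X')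
    (hf : f =ᵐ[riemannianVolume g] f') : ∀ᵐ x ∂riemannianVolume g, X x = X' x := by
  have h1 : IsWeakGradient g (0 : M → ℝ) (X - X') := by
    refine (h.sub h').congr ?_
    filter_upwards [hf] with x hx
    simp [hx]
  filter_upwards [ae_eq_zero_of_isWeakGradient_zero h1] with x hx
  exact sub_eq_zero.1 hx

lemma integrable_inner_of_memL2Field (h : IsWeakGradient g f X) (h' : IsWeakGradient g f' X')
    (hX : MemL2Field g X) (hX' : MemL2Field g X') :
    Integrable (fun x => g.inner x (X x) (X' x)) (riemannianVolume g) := by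
  obtain ⟨G, hG, hXG⟩ := hX
  obtain ⟨G', hG', hXG'⟩ := hX'
  refine (hG.integrable_mul hG').mono (h.aestronglyMeasurable_inner h') ?_
  filter_upwards [hXG, hXG'] with x h1 h2
  refine (abs_metric_le g x _ _).trans ((mul_le_mul h1 h2 (Real.sqrt_nonneg _)
    ((Real.sqrt_nonneg _).trans h1)).trans (le_abs_self _))

/-! ### The forms on the Sobolev space -/

lemma weakGradient_add (f h : W12 g) : ∀ᵐ x ∂riemannianVolume g,
    weakGradient (f + h) x = weakGradient f x + weakGradient h x :=
  (isWeakGradient_weakGradient _).ae_eq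
    ((isWeakGradient_weakGradient f).add (isWeakGradient_weakGradient h)) (Lp.coeFn_add f.1 h.1)

lemma weakGradient_smul (c : ℝ) (f : W12 g) : ∀ᵐ x ∂riemannianVolume g,
    weakGradient (c • f) x = c • weakGradient f x :=
  (isWeakGradient_weakGradient _).ae_eq
    ((isWeakGradient_weakGradient f).smul c) (Lp.coeFn_smul c f.1)

lemma weakGradient_sub (f h : W12 g) : ∀ᵐ x ∂riemannianVolume g,
    weakGradient (f - h) x = weakGradient f x - weakGradient h x :=
  (isWeakGradient_weakGradient _).ae_eq
    ((isWeakGradient_weakGradient f).sub (isWeakGradient_weakGradient h)) (Lp.coeFn_sub f.1 h.1)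

lemma integrable_inner_weakGradient (f h : W12 g) :
    Integrable (fun x => g.inner x (weakGradient f x) (weakGradient h x)) (riemannianVolume g) :=
  integrable_inner_of_memL2Field (isWeakGradient_weakGradient f) (isWeakGradient_weakGradient h)
    (memL2Field_weakGradient f) (memL2Field_weakGradient h)

variable (g) in
/-- The form `∫ ∇f · ∇h`. -/
def dirichletForm : W12 g →ₗ[ℝ] W12 g →ₗ[ℝ] ℝ :=
  LinearMap.mk₂ ℝ
    (fun f h => ∫ x, g.inner x (weakGradient f x) (weakGradient h x) ∂riemannianVolume g)
    (fun f f' h => by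
      rw [← integral_add (integrable_inner_weakGradient f h) (integrable_inner_weakGradient f' h)]
      refine integral_congr_ae ?_
      filter_upwards [weakGradient_add f f'] with x hx
      rw [hx, map_add, add_apply])
    (fun c f h => by
      rw [smul_eq_mul, ← integral_const_mul]
      refine integral_congr_ae ?_
      filter_upwards [weakGradient_smul c f] with x hx
      rw [hx, map_smul, smul_apply, smul_eq_mul])
    (fun f h h' => by
      rw [← integral_add (integrable_inner_weakGradient f h) (integrable_inner_weakGradient f h')]
      refine integral_congr_ae ?_
      filter_upwards [weakGradient_add h h'] with x hx
      rw [hx, map_add])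
    (fun c f h => by
      rw [smul_eq_mul, ← integral_const_mul]
      refine integral_congr_ae ?_
      filter_upwards [weakGradient_smul c h] with x hx
      rw [hx, map_smul, smul_eq_mul])

lemma dirichletForm_apply (f h : W12 g) : dirichletForm g f h =
    ∫ x, g.inner x (weakGradient f x) (weakGradient h x) ∂riemannianVolume g := rfl

lemma dirichletForm_comm (f h : W12 g) : dirichletForm g f h = dirichletForm g h f :=
  integral_congr_ae (Filter.Eventually.of_forall fun x => g.symm x _ _)

lemma dirichletForm_self_nonneg (f : W12 g) : 0 ≤ dirichletForm g f f :=
  integral_nonneg fun x => metric_self_nonneg g x _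

variable (g) in
/-- The inner product `∫ ∇f · ∇h + f h` of the Sobolev space. -/
def sobolevForm : W12 g →ₗ[ℝ] W12 g →ₗ[ℝ] ℝ :=
  dirichletForm g + weightForm g (fun _ => 1) integrable_mul_W12

lemma sobolevForm_apply (f h : W12 g) : sobolevForm g f h =
    dirichletForm g f h + weightForm g (fun _ => 1) integrable_mul_W12 f h := rfl

lemma sobolevForm_comm (f h : W12 g) : sobolevForm g f h = sobolevForm g h f := by
  rw [sobolevForm_apply, sobolevForm_apply, dirichletForm_comm, weightForm_comm]

lemma norm_sq_le_sobolevForm (f : W12 g) : ‖f.1‖ ^ 2 ≤ sobolevForm g f f := by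
  rw [sobolevForm_apply, weightForm_one_self]
  linarith [dirichletForm_self_nonneg f]

lemma dirichletForm_le_sobolevForm (f : W12 g) : dirichletForm g f f ≤ sobolevForm g f f := by
  rw [sobolevForm_apply, weightForm_one_self]
  linarith [sq_nonneg ‖f.1‖]

lemma sobolevForm_self_nonneg (f : W12 g) : 0 ≤ sobolevForm g f f :=
  (sq_nonneg _).trans (norm_sq_le_sobolevForm f)

lemma sobolevForm_self_pos (f : W12 g) (hf : f ≠ 0) : 0 < sobolevForm g f f := by
  refine lt_of_lt_of_le ?_ (norm_sq_le_sobolevForm f)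
  have : f.1 ≠ 0 := fun e => hf (Subtype.ext e)
  positivity

lemma lintegral_inner_weakGradient (f : W12 g) :
    ∫⁻ x, ENNReal.ofReal (g.inner x (weakGradient f x) (weakGradient f x)) ∂riemannianVolume g =
      ENNReal.ofReal (dirichletForm g f f) := by
  rw [dirichletForm_apply, ofReal_integral_eq_lintegral_ofReal (integrable_inner_weakGradient f f)]
  exact Filter.Eventually.of_forall fun x => metric_self_nonneg g x _

/-- A nonnegative symmetric form satisfies the Cauchy–Schwarz inequality. -/
lemma abs_form_le {H : Type*} [AddCommGroup H] [Module ℝ H] {Q : H →ₗ[ℝ] H →ₗ[ℝ] ℝ}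
    (hQ : ∀ f h, Q f h = Q h f) (hnn : ∀ f, 0 ≤ Q f f) (f h : H) :
    |Q f h| ≤ √(Q f f) * √(Q h h) := by
  have h1 : ∀ t : ℝ, 0 ≤ Q h h * (t * t) + 2 * Q f h * t + Q f f := by
    intro t
    have := hnn (f + t • h)
    simp only [map_add, map_smul, LinearMap.add_apply, LinearMap.smul_apply, smul_eq_mul,
      hQ h f] at this
    linarith
  have h2 := discrim_le_zero h1
  rw [discrim] at h2
  rw [← Real.sqrt_mul (hnn f), ← Real.sqrt_sq_eq_abs]
  exact Real.sqrt_le_sqrt (by linarith)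

lemma bilinForm_eq {V : M → ℝ}
    (hV : ∀ f h : W12 g, Integrable (fun x => f.1 x * h.1 x * V x) (riemannianVolume g))
    (f h : W12 g) : bilinForm g V f h = (dirichletForm g - weightForm g V hV) f h := by
  rw [LinearMap.sub_apply, LinearMap.sub_apply, dirichletForm_apply, weightForm_apply,
    ← integral_sub (integrable_inner_weakGradient f h) (hV f h), bilinForm]
  refine integral_congr_ae (Filter.Eventually.of_forall fun x => ?_)
  change _ - V x * f.1 x * h.1 x = _ - f.1 x * h.1 x * V x
  ring

end Gradient

/-! ### Completeness of the Sobolev space -/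

lemma lintegral_le_of_tendsto {α : Type*} [MeasurableSpace α] {ν : Measure α}
    {F : ℕ → α → ENNReal} {f : α → ENNReal} {A : ENNReal} (hF : ∀ k, AEMeasurable (F k) ν)
    (hlim : ∀ᵐ x ∂ν, Filter.Tendsto (fun k => F k x) Filter.atTop (𝓝 (f x)))
    (hA : ∀ᶠ k in Filter.atTop, ∫⁻ x, F k x ∂ν ≤ A) : ∫⁻ x, f x ∂ν ≤ A := by
  calc ∫⁻ x, f x ∂ν = ∫⁻ x, Filter.liminf (fun k => F k x) Filter.atTop ∂ν := by
        refine lintegral_congr_ae ?_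
        filter_upwards [hlim] with x hx
        exact hx.liminf_eq.symm
    _ ≤ Filter.liminf (fun k => ∫⁻ x, F k x ∂ν) Filter.atTop := lintegral_liminf_le' hF
    _ ≤ A := by
        refine Filter.liminf_le_of_le (by isBoundedDefault) fun b hb => ?_
        obtain ⟨k, hk, hk'⟩ := (hb.and hA).exists
        exact hk.trans hk'

/-- By Cauchy–Schwarz, `L²` convergence on the compact support of `η` implies `L¹` convergence of
the products. -/
lemma tendsto_setIntegral_mul_test {n : ℕ} {U : Set (EuclideanSpace ℝ (Fin n))}
    {F : ℕ → EuclideanSpace ℝ (Fin n) → ℝ} {f η : EuclideanSpace ℝ (Fin n) → ℝ}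
    (hF : ∀ k, LocallyIntegrableOn (F k) U) (hf : LocallyIntegrableOn f U) (hη : Continuous η)
    (hc : HasCompactSupport η) (hs : tsupport η ⊆ U)
    (hlim : Filter.Tendsto (fun k => ∫⁻ y in tsupport η, ‖F k y - f y‖ₑ ^ 2) Filter.atTop (𝓝 0)) :
    Filter.Tendsto (fun k => ∫ y in U, F k y * η y) Filter.atTop (𝓝 (∫ y in U, f y * η y)) := by
  have hK : IsCompact (tsupport η) := hc
  have hKm := hK.measurableSet
  refine tendsto_integral_of_L1 _ (integrableOn_mul_test hf hη hc hs).aestronglyMeasurable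
    (Filter.Eventually.of_forall fun k => integrableOn_mul_test (hF k) hη hc hs) ?_
  obtain ⟨B, hB⟩ := hη.bounded_above_of_compact_support hc
  have h1 : ∀ k, ∫⁻ y in U, ‖F k y * η y - f y * η y‖ₑ ≤
      ENNReal.ofReal B * (volume (tsupport η) *
        ∫⁻ y in tsupport η, ‖F k y - f y‖ₑ ^ 2) ^ (1 / 2 : ℝ) := by
    intro k
    have hm : AEMeasurable (fun y => ‖F k y - f y‖ₑ) (volume.restrict (tsupport η)) :=
      (((hF k).integrableOn_compact_subset hs hK).sub
        (hf.integrableOn_compact_subset hs hK)).aestronglyMeasurable.enorm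
    calc ∫⁻ y in U, ‖F k y * η y - f y * η y‖ₑ
        ≤ ∫⁻ y, ‖F k y * η y - f y * η y‖ₑ := setLIntegral_le_lintegral _ _
      _ ≤ ∫⁻ y, (tsupport η).indicator (fun y => ENNReal.ofReal B * ‖F k y - f y‖ₑ) y := by
          refine lintegral_mono fun y => ?_
          by_cases hy : y ∈ tsupport η
          · rw [indicator_of_mem hy, ← sub_mul, enorm_mul, mul_comm]
            gcongr
            rw [← ofReal_norm]
            exact ENNReal.ofReal_le_ofReal (hB y)
          · simp [hy, image_eq_zero_of_notMem_tsupport hy]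
      _ = ENNReal.ofReal B * ∫⁻ y in tsupport η, ‖F k y - f y‖ₑ := by
          rw [lintegral_indicator hKm, lintegral_const_mul' _ _ (by simp)]
      _ ≤ _ := by
          gcongr _ * ?_
          have h2 := sq_lintegral_le hm
          rw [Measure.restrict_apply_univ] at h2
          calc _ = ((∫⁻ y in tsupport η, ‖F k y - f y‖ₑ) ^ 2) ^ (1 / 2 : ℝ) := by
                rw [← ENNReal.rpow_natCast, ← ENNReal.rpow_mul]
                norm_num
            _ ≤ _ := by gcongr
  refine tendsto_of_tendsto_of_tendsto_of_le_of_le tendsto_const_nhds ?_ (fun _ => bot_le) h1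
  have h3 := ENNReal.Tendsto.const_mul hlim (a := volume (tsupport η))
    (Or.inr hK.measure_lt_top.ne)
  rw [mul_zero] at h3
  have h4 := (ENNReal.continuous_rpow_const (y := (1 / 2 : ℝ))).tendsto 0 |>.comp h3
  rw [ENNReal.zero_rpow_of_pos (by norm_num)] at h4
  have h5 := ENNReal.Tendsto.const_mul h4 (a := ENNReal.ofReal B) (Or.inr ENNReal.ofReal_ne_top)
  rw [mul_zero] at h5
  exact h5

section Complete

variable {n : ℕ} {M : Type*} [TopologicalSpace M] [ChartedSpace (EuclideanSpace ℝ (Fin n)) M]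
  [IsManifold (𝓡 n) ∞ M]

/-- The covector `g(X, ∂_v)`, in the coordinates of the chart at `p`. -/
def gradCovector (g : SmoothMetric n M) (p : M) (X : (x : M) → TangentSpace (𝓡 n) x)
    (y : EuclideanSpace ℝ (Fin n)) : EuclideanSpace ℝ (Fin n) →L[ℝ] ℝ :=
  ContinuousLinearMap.comp
    (show EuclideanSpace ℝ (Fin n) →L[ℝ] ℝ from
      g.inner ((chart n p).symm y) (X ((chart n p).symm y)))
    (coordMap p y)

lemma gradCovector_apply (g : SmoothMetric n M) (p : M) (X : (x : M) → TangentSpace (𝓡 n) x)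
    (y v : EuclideanSpace ℝ (Fin n)) : gradCovector g p X y v =
      g.inner ((chart n p).symm y) (X ((chart n p).symm y)) (coordVec p y v) := rfl

lemma gradCovector_sub (g : SmoothMetric n M) (p : M) (X X' : (x : M) → TangentSpace (𝓡 n) x)
    (y : EuclideanSpace ℝ (Fin n)) :
    gradCovector g p (X - X') y = gradCovector g p X y - gradCovector g p X' y := by
  ext v
  rw [sub_apply, gradCovector_apply, gradCovector_apply, gradCovector_apply, Pi.sub_apply, map_sub,
    sub_apply]

variable {g : SmoothMetric n M}

/-- The limit of the sequence `X` of vector fields, where it exists. -/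
def fieldLimit (X : ℕ → (x : M) → TangentSpace (𝓡 n) x) (x : M) : TangentSpace (𝓡 n) x :=
  Filter.limUnder Filter.atTop fun k => (show EuclideanSpace ℝ (Fin n) from X k x)

/-- The squared length of the difference of two vector fields. -/
def sqDist (g : SmoothMetric n M) (X X' : (x : M) → TangentSpace (𝓡 n) x) (x : M) : ENNReal :=
  ENNReal.ofReal (g.inner x (X x - X' x) (X x - X' x))

lemma tendsto_sqDist {X : ℕ → (x : M) → TangentSpace (𝓡 n) x}
    {Y Z : (x : M) → TangentSpace (𝓡 n) x} {x : M}
    (h : Filter.Tendsto (fun k => X k x) Filter.atTop (𝓝 (Y x))) :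
    Filter.Tendsto (fun k => sqDist g Z (X k) x) Filter.atTop (𝓝 (sqDist g Z Y x)) := by
  let z : EuclideanSpace ℝ (Fin n) := Z x
  let y : EuclideanSpace ℝ (Fin n) := Y x
  let W : ℕ → EuclideanSpace ℝ (Fin n) := fun k => X k x
  have hW : Filter.Tendsto W Filter.atTop (𝓝 y) := h
  have h1 : Filter.Tendsto (fun k => z - W k) Filter.atTop (𝓝 (z - y)) :=
    tendsto_const_nhds.sub hW
  exact (ENNReal.continuous_ofReal.tendsto _).comp
    (((continuous_modelInner g x).tendsto _).comp (h1.prodMk_nhds h1))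

variable [MeasurableSpace M]

/-- As in Riesz–Fischer: the weights `2 ^ k` against the bounds `4⁻ᵏ` still give a convergent sum.
So at almost every `x` the squared lengths of the increments are `O(2⁻ᵏ)`, and the sequence is
Cauchy with ratio `√(1 / 2)`. -/
lemma ae_tendsto_fieldLimit {X : ℕ → (x : M) → TangentSpace (𝓡 n) x}
    (hm : ∀ k, AEMeasurable (sqDist g (X (k + 1)) (X k)) (riemannianVolume g))
    (hX : ∀ k, ∫⁻ x, sqDist g (X (k + 1)) (X k) x ∂riemannianVolume g ≤
      ENNReal.ofReal ((1 / 4) ^ k)) :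
    ∀ᵐ x ∂riemannianVolume g,
      Filter.Tendsto (fun k => X k x) Filter.atTop (𝓝 (fieldLimit X x)) := by
  have hm' : ∀ k, AEMeasurable (fun x => ENNReal.ofReal (2 ^ k) * sqDist g (X (k + 1)) (X k) x)
      (riemannianVolume g) := fun k => (hm k).const_mul _
  have hsum : ∫⁻ x, ∑' k : ℕ, ENNReal.ofReal (2 ^ k) * sqDist g (X (k + 1)) (X k) x
      ∂riemannianVolume g ≠ ⊤ := by
    rw [lintegral_tsum hm']
    have hle : ∀ k : ℕ, ∫⁻ x, ENNReal.ofReal (2 ^ k) * sqDist g (X (k + 1)) (X k) x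
        ∂riemannianVolume g ≤ ENNReal.ofReal ((1 / 2) ^ k) := by
      intro k
      rw [lintegral_const_mul' _ _ (by simp)]
      calc _ ≤ ENNReal.ofReal (2 ^ k) * ENNReal.ofReal ((1 / 4) ^ k) := by
            gcongr _ * ?_
            exact hX k
        _ = _ := by
            rw [← ENNReal.ofReal_mul (by positivity), ← mul_pow]
            norm_num
    refine ne_top_of_le_ne_top ?_ (ENNReal.tsum_le_tsum hle)
    have hs : Summable fun k : ℕ => (1 / 2 : ℝ) ^ k :=
      summable_geometric_of_lt_one (by norm_num) (by norm_num)
    rw [← ENNReal.ofReal_tsum_of_nonneg (fun k => by positivity) hs]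
    exact ENNReal.ofReal_ne_top
  filter_upwards [ae_lt_top' (AEMeasurable.tsum hm') hsum] with x hx
  obtain ⟨δ, hδ, hδx⟩ := exists_metric_coercive g x
  set S := (∑' k : ℕ, ENNReal.ofReal (2 ^ k) * sqDist g (X (k + 1)) (X k) x).toReal with hS
  let Y : ℕ → EuclideanSpace ℝ (Fin n) := fun k => X k x
  have hY : CauchySeq Y := by
    refine cauchySeq_of_le_geometric (√(1 / 2)) (√(S / δ)) ?_ fun k => ?_
    · rw [Real.sqrt_lt' one_pos]
      norm_num
    · have h1 : ENNReal.ofReal (2 ^ k) * sqDist g (X (k + 1)) (X k) x ≤ ENNReal.ofReal S := by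
        rw [hS, ENNReal.ofReal_toReal hx.ne]
        exact ENNReal.le_tsum k
      have hS0 : 0 ≤ S := ENNReal.toReal_nonneg
      rw [sqDist, ← ENNReal.ofReal_mul (by positivity), ENNReal.ofReal_le_ofReal_iff hS0] at h1
      have h2 : δ * ‖Y (k + 1) - Y k‖ ^ 2 ≤ g.inner x (X (k + 1) x - X k x) (X (k + 1) x - X k x) :=
        hδx _
      have h3 : ‖Y (k + 1) - Y k‖ ^ 2 ≤ S / δ * (1 / 2) ^ k := by
        rw [div_mul_eq_mul_div, le_div_iff₀ hδ, one_div, inv_pow, ← div_eq_mul_inv,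
          le_div_iff₀ (by positivity)]
        calc ‖Y (k + 1) - Y k‖ ^ 2 * δ * 2 ^ k = 2 ^ k * (δ * ‖Y (k + 1) - Y k‖ ^ 2) := by ring
          _ ≤ _ := (mul_le_mul_of_nonneg_left h2 (by positivity)).trans h1
      rw [dist_comm, dist_eq_norm, ← Real.sqrt_sq (norm_nonneg (Y (k + 1) - Y k))]
      calc _ ≤ √(S / δ * (1 / 2) ^ k) := Real.sqrt_le_sqrt h3
        _ = _ := by
          rw [Real.sqrt_mul (by positivity)]
          congr 1
          rw [Real.sqrt_eq_rpow, Real.sqrt_eq_rpow, ← Real.rpow_natCast, ← Real.rpow_natCast,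
            ← Real.rpow_mul (by norm_num), ← Real.rpow_mul (by norm_num), mul_comm]
  exact hY.tendsto_limUnder

variable [BorelSpace M]

/-- Cauchy–Schwarz in `g` bounds the covector by `|X|` times the length of the coordinate vectors,
which is bounded on `K`. -/
lemma exists_lintegral_gradCovector_le (g : SmoothMetric n M) (p : M)
    {K : Set (EuclideanSpace ℝ (Fin n))} (hK : IsCompact K) (hKt : K ⊆ (chart n p).target) :
    ∃ C : ℝ≥0, ∀ X : (x : M) → TangentSpace (𝓡 n) x,
      AEMeasurable (fun x => ENNReal.ofReal (g.inner x (X x) (X x))) (riemannianVolume g) →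
      ∫⁻ y in K, ‖gradCovector g p X y‖ₑ ^ 2 ≤
        C * ∫⁻ x, ENNReal.ofReal (g.inner x (X x) (X x)) ∂riemannianVolume g := by
  obtain ⟨C₁, hC₁, hb⟩ := exists_coordMap_bound g p hK hKt
  obtain ⟨C₂, hC₂⟩ := exists_lintegral_chart_le g p hK hKt
  refine ⟨C₁.toNNReal * C₂, fun X hX => ?_⟩
  have hpt : ∀ y ∈ K, ‖gradCovector g p X y‖ₑ ^ 2 ≤ ENNReal.ofReal C₁ *
      ENNReal.ofReal (g.inner _ (X ((chart n p).symm y)) (X ((chart n p).symm y))) := by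
    intro y hy
    set q := g.inner _ (X ((chart n p).symm y)) (X ((chart n p).symm y)) with hq
    have hq0 : 0 ≤ q := metric_self_nonneg g _ _
    have h1 : ‖gradCovector g p X y‖ ≤ √(C₁ * q) := by
      refine ContinuousLinearMap.opNorm_le_bound _ (Real.sqrt_nonneg _) fun v => ?_
      rw [gradCovector_apply, Real.norm_eq_abs]
      refine (abs_metric_le g _ _ _).trans ?_
      rw [← hq, ← Real.sqrt_mul hq0, ← Real.sqrt_sq (norm_nonneg v),
        ← Real.sqrt_mul (by positivity)]
      refine Real.sqrt_le_sqrt ?_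
      calc _ ≤ q * (C₁ * ‖v‖ ^ 2) := mul_le_mul_of_nonneg_left (hb y hy v) hq0
        _ = _ := by ring
    rw [← ENNReal.ofReal_mul hC₁.le, ← ofReal_norm, ← ENNReal.ofReal_pow (norm_nonneg _)]
    refine ENNReal.ofReal_le_ofReal ?_
    calc _ ≤ √(C₁ * q) ^ 2 := by gcongr
      _ = _ := Real.sq_sqrt (by positivity)
  calc ∫⁻ y in K, ‖gradCovector g p X y‖ₑ ^ 2
      ≤ ∫⁻ y in K, ENNReal.ofReal C₁ *
          ENNReal.ofReal (g.inner _ (X ((chart n p).symm y)) (X ((chart n p).symm y))) :=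
        setLIntegral_mono' hK.measurableSet hpt
    _ = ENNReal.ofReal C₁ * ∫⁻ y in K,
          ENNReal.ofReal (g.inner _ (X ((chart n p).symm y)) (X ((chart n p).symm y))) :=
        lintegral_const_mul' _ _ (by simp)
    _ ≤ ENNReal.ofReal C₁ * (C₂ *
          ∫⁻ x, ENNReal.ofReal (g.inner x (X x) (X x)) ∂riemannianVolume g) := by
        gcongr _ * ?_
        exact hC₂ _ hX
    _ = _ := by
        push_cast
        rw [mul_assoc]
        rfl

/-- If functions converge in `L²` and their weak gradients converge in `L²`, then the limit of the
gradients is the weak gradient of the limit. -/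
lemma isWeakGradient_of_tendsto {F : ℕ → M → ℝ} {f : M → ℝ}
    {X : ℕ → (x : M) → TangentSpace (𝓡 n) x} {Y : (x : M) → TangentSpace (𝓡 n) x}
    (hFX : ∀ k, IsWeakGradient g (F k) (X k)) (hF : ∀ k, MemLp (F k) 2 (riemannianVolume g))
    (hf : MemLp f 2 (riemannianVolume g))
    (hlim : Filter.Tendsto (fun k => ∫⁻ x, ‖F k x - f x‖ₑ ^ 2 ∂riemannianVolume g)
      Filter.atTop (𝓝 0))
    (hY : ∀ᵐ x ∂riemannianVolume g, Filter.Tendsto (fun k => X k x) Filter.atTop (𝓝 (Y x)))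
    (hXYm : ∀ k, AEMeasurable (sqDist g (X k) Y) (riemannianVolume g))
    (hXYfin : ∀ k, ∫⁻ x, sqDist g (X k) Y x ∂riemannianVolume g < ⊤)
    (hXY : Filter.Tendsto (fun k => ∫⁻ x, sqDist g (X k) Y x ∂riemannianVolume g)
      Filter.atTop (𝓝 0)) : IsWeakGradient g f Y := by
  intro p v
  have ho := (chart n p).open_target
  have hm := ho.measurableSet
  have hcm : AEStronglyMeasurable
      (fun y => g.inner ((chart n p).symm y) (Y ((chart n p).symm y)) (coordVec p y v))
      (volume.restrict (chart n p).target) := by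
    refine aestronglyMeasurable_of_tendsto_ae Filter.atTop
      (fun k => (hFX k).aestronglyMeasurable_comp p v) ?_
    filter_upwards [ae_chart_of_ae g p hY] with y hy
    exact ((continuous_modelInner g ((chart n p).symm y)).tendsto _).comp
      (hy.prodMk_nhds (tendsto_const_nhds (x := coordMap p y v)))
  have hfm : AEStronglyMeasurable (fun y => f ((chart n p).symm y))
      (volume.restrict (chart n p).target) := by
    obtain ⟨f', hf', hff'⟩ := hf.1
    have hsymm : AEMeasurable (chart n p).symm (volume.restrict (chart n p).target) :=
      (chart n p).symm.continuousOn.aemeasurable hm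
    refine (hf'.measurable.comp_aemeasurable hsymm).aestronglyMeasurable.congr ?_
    filter_upwards [ae_chart_of_ae g p hff'] with y hy
    exact hy.symm
  have hcomp : ∀ K : Set (EuclideanSpace ℝ (Fin n)), IsCompact K → K ⊆ (chart n p).target →
      ∃ C : ℝ≥0, ∀ k, ∫⁻ y in K, ‖g.inner ((chart n p).symm y) (X k ((chart n p).symm y))
        (coordVec p y v) - g.inner ((chart n p).symm y) (Y ((chart n p).symm y))
        (coordVec p y v)‖ₑ ^ 2 ≤ C * ∫⁻ x, sqDist g (X k) Y x ∂riemannianVolume g := by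
    intro K hK hKt
    obtain ⟨C, hC⟩ := exists_lintegral_gradCovector_le g p hK hKt
    refine ⟨‖v‖₊ ^ 2 * C, fun k => ?_⟩
    calc _ ≤ ∫⁻ y in K, ‖v‖ₑ ^ 2 * ‖gradCovector g p (X k - Y) y‖ₑ ^ 2 := by
          refine lintegral_mono fun y => ?_
          rw [← mul_pow, mul_comm]
          gcongr
          refine le_trans (le_of_eq ?_) (ContinuousLinearMap.le_opENorm _ _)
          rw [gradCovector_sub]
          rfl
      _ = ‖v‖ₑ ^ 2 * ∫⁻ y in K, ‖gradCovector g p (X k - Y) y‖ₑ ^ 2 :=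
          lintegral_const_mul' _ _ (by simp)
      _ ≤ ‖v‖ₑ ^ 2 * (C * ∫⁻ x, sqDist g (X k) Y x ∂riemannianVolume g) := by
          gcongr _ * ?_
          exact hC (X k - Y) (hXYm k)
      _ = _ := by
          push_cast
          rw [mul_assoc]
          rfl
  have hc : LocallyIntegrableOn
      (fun y => g.inner ((chart n p).symm y) (Y ((chart n p).symm y)) (coordVec p y v))
      (chart n p).target := by
    refine (locallyIntegrableOn_iff ho.isLocallyClosed).2 fun K hKt hK => ?_
    obtain ⟨C, hC⟩ := hcomp K hK hKt
    have h1 := (hFX 0 p v).2.1.integrableOn_compact_subset hKt hK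
    have : IsFiniteMeasure (volume.restrict K) := ⟨by simpa using hK.measure_lt_top⟩
    have h2 := integrable_of_lintegral_sq
      (h1.aestronglyMeasurable.sub (hcm.mono_measure (Measure.restrict_mono hKt le_rfl)))
      ((hC 0).trans_lt (ENNReal.mul_lt_top (by simp) (hXYfin 0)))
    refine (h1.sub h2).congr (Filter.Eventually.of_forall fun y => ?_)
    simp
  have hfl : LocallyIntegrableOn (fun y => f ((chart n p).symm y)) (chart n p).target := by
    refine (locallyIntegrableOn_iff ho.isLocallyClosed).2 fun K hKt hK => ?_
    obtain ⟨C, hC⟩ := exists_lintegral_chart_le g p hK hKt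
    have : IsFiniteMeasure (volume.restrict K) := ⟨by simpa using hK.measure_lt_top⟩
    refine integrable_of_lintegral_sq (hfm.mono_measure (Measure.restrict_mono hKt le_rfl)) ?_
    exact (hC (fun x => ‖f x‖ₑ ^ 2) (hf.1.enorm.pow_const 2)).trans_lt
      (ENNReal.mul_lt_top (by simp) (lintegral_sq_lt_top hf))
  refine ⟨hfl, hc, fun η hη hηc hηs => ?_⟩
  have hd : Continuous fun y => fderiv ℝ η y v :=
    (hη.continuous_fderiv (by simp)).clm_apply continuous_const
  have hdc : HasCompactSupport fun y => fderiv ℝ η y v := hηc.fderiv_apply ℝ v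
  have hds : tsupport (fun y => fderiv ℝ η y v) ⊆ (chart n p).target :=
    (tsupport_fderiv_apply_subset ℝ v).trans hηs
  have hl1 := tendsto_setIntegral_mul_test (fun k => (hFX k p v).1) hfl hd hdc hds (by
    obtain ⟨C, hC⟩ := exists_lintegral_chart_le g p hdc hds
    have h1 := ENNReal.Tendsto.const_mul hlim (a := C) (Or.inr ENNReal.coe_ne_top)
    rw [mul_zero] at h1
    exact tendsto_of_tendsto_of_tendsto_of_le_of_le tendsto_const_nhds h1 (fun _ => bot_le)
      fun k => hC (fun x => ‖F k x - f x‖ₑ ^ 2) (((hF k).1.sub hf.1).enorm.pow_const 2))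
  have hl2 := tendsto_setIntegral_mul_test (fun k => (hFX k p v).2.1) hc hη.continuous hηc hηs (by
    obtain ⟨C, hC⟩ := hcomp _ hηc hηs
    have h1 := ENNReal.Tendsto.const_mul hXY (a := C) (Or.inr ENNReal.coe_ne_top)
    rw [mul_zero] at h1
    exact tendsto_of_tendsto_of_tendsto_of_le_of_le tendsto_const_nhds h1 (fun _ => bot_le) hC)
  refine tendsto_nhds_unique hl1 (hl2.neg.congr fun k => ?_)
  exact ((hFX k p v).2.2 η hη hηc hηs).symm

variable [CompactSpace M]

lemma aemeasurable_sqDist {f f' : M → ℝ} {X X' : (x : M) → TangentSpace (𝓡 n) x}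
    (h : IsWeakGradient g f X) (h' : IsWeakGradient g f' X') :
    AEMeasurable (sqDist g X X') (riemannianVolume g) :=
  ((h.sub h').aestronglyMeasurable_inner (h.sub h')).aemeasurable.ennreal_ofReal

/-- The functions converge in `L²`, the gradients almost everywhere to a field `Y`. Fatou's lemma
upgrades the latter to `L²` convergence, and the weak gradient relation passes to the limit. -/
theorem exists_tendsto_sobolevForm (u : ℕ → W12 g)
    (hu : ∀ N k m, N ≤ k → N ≤ m → sobolevForm g (u k - u m) (u k - u m) < (1 / 4) ^ N) :
    ∃ f, Filter.Tendsto (fun k => sobolevForm g (u k - f) (u k - f)) Filter.atTop (𝓝 0) := by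
  have hcauchy : CauchySeq fun k => (u k).1 := by
    refine cauchySeq_of_le_geometric (1 / 2) 1 (by norm_num) fun k => ?_
    rw [one_mul, dist_eq_norm]
    have h1 := (norm_sq_le_sobolevForm (u k - u (k + 1))).trans
      (hu k k (k + 1) le_rfl (Nat.le_succ k)).le
    have h2 : ((1 : ℝ) / 4) ^ k = ((1 / 2) ^ k) ^ 2 := by
      rw [← pow_mul, mul_comm, pow_mul]
      norm_num
    rw [h2] at h1
    exact le_of_sq_le_sq h1 (by positivity)
  obtain ⟨F, hF⟩ := cauchySeq_tendsto_of_complete hcauchy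
  let X : ℕ → (x : M) → TangentSpace (𝓡 n) x := fun k => weakGradient (u k)
  have hX : ∀ k, IsWeakGradient g (u k).1 (X k) := fun k => isWeakGradient_weakGradient _
  have hdist : ∀ N k m, N ≤ k → N ≤ m →
      ∫⁻ x, sqDist g (X k) (X m) x ∂riemannianVolume g ≤ ENNReal.ofReal ((1 / 4) ^ N) := by
    intro N k m hk hm
    have h1 : ∫⁻ x, sqDist g (X k) (X m) x ∂riemannianVolume g =
        ENNReal.ofReal (dirichletForm g (u k - u m) (u k - u m)) := by
      rw [← lintegral_inner_weakGradient]
      refine lintegral_congr_ae ?_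
      filter_upwards [weakGradient_sub (u k) (u m)] with x hx
      rw [hx]
      rfl
    rw [h1]
    exact ENNReal.ofReal_le_ofReal ((dirichletForm_le_sobolevForm _).trans (hu N k m hk hm).le)
  have hXm : ∀ k m, AEMeasurable (sqDist g (X k) (X m)) (riemannianVolume g) := fun k m =>
    aemeasurable_sqDist (hX k) (hX m)
  set Y := fieldLimit X with hYdef
  have hY : ∀ᵐ x ∂riemannianVolume g, Filter.Tendsto (fun k => X k x) Filter.atTop (𝓝 (Y x)) :=
    ae_tendsto_fieldLimit (fun k => hXm _ _) fun k => hdist k (k + 1) k (Nat.le_succ k) le_rfl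
  have hYlim : ∀ k, ∀ᵐ x ∂riemannianVolume g, Filter.Tendsto
      (fun m => sqDist g (X k) (X m) x) Filter.atTop (𝓝 (sqDist g (X k) Y x)) := fun k => by
    filter_upwards [hY] with x hx using tendsto_sqDist hx
  have hXYm : ∀ k, AEMeasurable (sqDist g (X k) Y) (riemannianVolume g) := fun k =>
    aemeasurable_of_tendsto_metrizable_ae Filter.atTop (hXm k) (hYlim k)
  -- Fatou in the second index of the Cauchy estimate.
  have hXY : ∀ k, ∫⁻ x, sqDist g (X k) Y x ∂riemannianVolume g ≤ ENNReal.ofReal ((1 / 4) ^ k) :=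
    fun k => lintegral_le_of_tendsto (hXm k) (hYlim k)
      (Filter.eventually_atTop.2 ⟨k, fun m hm => hdist k k m le_rfl hm⟩)
  have hgeom : Filter.Tendsto (fun k : ℕ => ((1 : ℝ) / 4) ^ k) Filter.atTop (𝓝 0) :=
    tendsto_pow_atTop_nhds_zero_of_lt_one (by norm_num) (by norm_num)
  have hgeom' : Filter.Tendsto (fun k : ℕ => ENNReal.ofReal (((1 : ℝ) / 4) ^ k)) Filter.atTop
      (𝓝 0) := by
    have h := (ENNReal.continuous_ofReal.tendsto 0).comp hgeom
    rw [ENNReal.ofReal_zero] at h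
    exact h
  have hFnorm : Filter.Tendsto (fun k => ‖(u k).1 - F‖ ^ 2) Filter.atTop (𝓝 0) := by
    have := (tendsto_iff_norm_sub_tendsto_zero.1 hF).pow 2
    simpa using this
  have hFlim : Filter.Tendsto (fun k => ∫⁻ x, ‖(u k).1 x - F x‖ₑ ^ 2 ∂riemannianVolume g)
      Filter.atTop (𝓝 0) := by
    have h1 : ∀ k, ∫⁻ x, ‖(u k).1 x - F x‖ₑ ^ 2 ∂riemannianVolume g =
        ENNReal.ofReal (‖(u k).1 - F‖ ^ 2) := by
      intro k
      rw [← lintegral_sq_Lp]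
      refine lintegral_congr_ae ?_
      filter_upwards [Lp.coeFn_sub (u k).1 F] with x hx
      rw [hx, Pi.sub_apply]
    simp only [h1]
    have h := (ENNReal.continuous_ofReal.tendsto 0).comp hFnorm
    rw [ENNReal.ofReal_zero] at h
    exact h
  have hgrad : IsWeakGradient g F Y :=
    isWeakGradient_of_tendsto hX (fun k => Lp.memLp _) (Lp.memLp F) hFlim hY hXYm
      (fun k => (hXY k).trans_lt ENNReal.ofReal_lt_top)
      (tendsto_of_tendsto_of_tendsto_of_le_of_le tendsto_const_nhds hgeom' (fun _ => bot_le) hXY)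
  have hmem : MemL2Field g Y := by
    refine ⟨fun x => √(g.inner x (Y x) (Y x)), memLp_two_of_lintegral_sq
      (Real.continuous_sqrt.comp_aestronglyMeasurable (hgrad.aestronglyMeasurable_inner hgrad)) ?_,
      Filter.Eventually.of_forall fun x => le_rfl⟩
    -- Square integrability of `Y` from `|Y|² ≤ 2 |X₀ - Y|² + 2 |X₀|²`.
    have hpt : ∀ x, ‖√(g.inner x (Y x) (Y x))‖ₑ ^ 2 ≤ 2 * sqDist g (X 0) Y x +
        2 * ENNReal.ofReal (g.inner x (X 0 x) (X 0 x)) := by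
      intro x
      have h0 := metric_self_nonneg g x (Y x)
      have h1 := metric_add_self_le g x (-(X 0 x - Y x)) (X 0 x)
      have e : -(X 0 x - Y x) + X 0 x = Y x := by abel
      rw [e] at h1
      simp only [map_neg, neg_apply, neg_neg] at h1
      rw [Real.enorm_eq_ofReal (Real.sqrt_nonneg _), ← ENNReal.ofReal_pow (Real.sqrt_nonneg _),
        Real.sq_sqrt h0, sqDist]
      refine (ENNReal.ofReal_le_ofReal h1).trans_eq ?_
      rw [ENNReal.ofReal_add (mul_nonneg zero_le_two (metric_self_nonneg g x _))
        (mul_nonneg zero_le_two (metric_self_nonneg g x _)), ENNReal.ofReal_mul zero_le_two,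
        ENNReal.ofReal_mul zero_le_two, ENNReal.ofReal_ofNat]
    refine (lintegral_mono hpt).trans_lt ?_
    rw [lintegral_add_left' ((hXYm 0).const_mul 2), lintegral_const_mul' _ _ (by simp),
      lintegral_const_mul' _ _ (by simp)]
    refine ENNReal.add_lt_top.2 ⟨ENNReal.mul_lt_top (by simp) ?_, ENNReal.mul_lt_top (by simp) ?_⟩
    · exact (hXY 0).trans_lt ENNReal.ofReal_lt_top
    · exact (lintegral_inner_weakGradient (u 0)).trans_lt ENNReal.ofReal_lt_top
  let f : W12 g := ⟨F, Y, hgrad, hmem⟩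
  refine ⟨f, ?_⟩
  have hdir : ∀ k, dirichletForm g (u k - f) (u k - f) ≤ (1 / 4) ^ k := by
    intro k
    refine (ENNReal.ofReal_le_ofReal_iff (by positivity)).1 (le_trans (le_of_eq ?_) (hXY k))
    rw [← lintegral_inner_weakGradient]
    refine lintegral_congr_ae ?_
    filter_upwards [weakGradient_sub (u k) f,
      (isWeakGradient_weakGradient f).ae_eq hgrad Filter.EventuallyEq.rfl] with x hx hx'
    rw [hx, hx']
    rfl
  have hle : ∀ k, sobolevForm g (u k - f) (u k - f) ≤ (1 / 4) ^ k + ‖(u k).1 - F‖ ^ 2 := by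
    intro k
    rw [sobolevForm_apply, weightForm_one_self]
    exact add_le_add (hdir k) le_rfl
  refine tendsto_of_tendsto_of_tendsto_of_le_of_le tendsto_const_nhds ?_
    (fun k => sobolevForm_self_nonneg _) hle
  simpa using hgeom.add hFnorm

end Complete

/-! ### Localisation in a chart -/

section Localisation

variable {n : ℕ} {M : Type*} [TopologicalSpace M] [ChartedSpace (EuclideanSpace ℝ (Fin n)) M]

/-- The function `f`, cut off around `p`, in the coordinates of the chart at `p`. -/
def localFun (n : ℕ) {M : Type*} [TopologicalSpace M]
    [ChartedSpace (EuclideanSpace ℝ (Fin n)) M] (p : M) (f : M → ℝ)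
    (y : EuclideanSpace ℝ (Fin n)) : ℝ :=
  f ((chart n p).symm y) * chartBump n p y

lemma hasCompactSupport_chartBump (p : M) : HasCompactSupport (chartBump n p) :=
  (chartBump n p).hasCompactSupport

lemma tsupport_chartBump (p : M) : tsupport (chartBump n p) = outerBall n p :=
  (chartBump n p).tsupport_eq

lemma tsupport_chartBump_subset (p : M) : tsupport (chartBump n p) ⊆ (chart n p).target :=
  (tsupport_chartBump p).le.trans (outerBall_subset p)

lemma contDiff_chartBump (p : M) : ContDiff ℝ ∞ (chartBump n p) := (chartBump n p).contDiff

lemma chartBump_eq_zero {p : M} {y : EuclideanSpace ℝ (Fin n)} (hy : y ∉ outerBall n p) :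
    chartBump n p y = 0 :=
  image_eq_zero_of_notMem_tsupport (by rwa [tsupport_chartBump (n := n) p])

lemma fderiv_chartBump_eq_zero {p : M} {y : EuclideanSpace ℝ (Fin n)} (hy : y ∉ outerBall n p) :
    fderiv ℝ (chartBump n p) y = 0 :=
  image_eq_zero_of_notMem_tsupport fun h =>
    hy (tsupport_chartBump (n := n) p ▸ tsupport_fderiv_subset ℝ h)

lemma localFun_eq_zero {p : M} {f : M → ℝ} {y : EuclideanSpace ℝ (Fin n)}
    (hy : y ∉ outerBall n p) : localFun n p f y = 0 := by
  rw [localFun, chartBump_eq_zero (n := n) (p := p) hy, mul_zero]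

lemma localFun_chart {p x : M} (f : M → ℝ) (hx : x ∈ chartSet p (innerBall n p)) :
    localFun n p f (chart n p x) = f x := by
  rw [localFun, (chart n p).left_inv hx.1, (chartBump n p).one_of_mem_closedBall hx.2, mul_one]

lemma hasCompactSupport_localFun (p : M) (f : M → ℝ) : HasCompactSupport (localFun n p f) :=
  HasCompactSupport.intro (isCompact_outerBall p) fun _ hy => localFun_eq_zero hy

variable [IsManifold (𝓡 n) ∞ M]

/-- The differential of `localFun`, for a function with weak gradient `X`. -/
def localCovector (g : SmoothMetric n M) (p : M) (f : M → ℝ)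
    (X : (x : M) → TangentSpace (𝓡 n) x) (y : EuclideanSpace ℝ (Fin n)) :
    EuclideanSpace ℝ (Fin n) →L[ℝ] ℝ :=
  chartBump n p y • gradCovector g p X y + f ((chart n p).symm y) • fderiv ℝ (chartBump n p) y

lemma localCovector_apply (g : SmoothMetric n M) (p : M) (f : M → ℝ)
    (X : (x : M) → TangentSpace (𝓡 n) x) (y v : EuclideanSpace ℝ (Fin n)) :
    localCovector g p f X y v =
      g.inner ((chart n p).symm y) (X ((chart n p).symm y)) (coordVec p y v) * chartBump n p y +
        f ((chart n p).symm y) * fderiv ℝ (chartBump n p) y v := by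
  rw [← gradCovector_apply, mul_comm (gradCovector g p X y v)]
  rfl

lemma localCovector_eq_zero {g : SmoothMetric n M} {p : M} {f : M → ℝ}
    {X : (x : M) → TangentSpace (𝓡 n) x} {y : EuclideanSpace ℝ (Fin n)}
    (hy : y ∉ outerBall n p) : localCovector g p f X y = 0 := by
  rw [localCovector, chartBump_eq_zero hy, fderiv_chartBump_eq_zero hy, zero_smul, smul_zero,
    add_zero]

lemma integrable_of_eq_sum_smul {α G ι : Type*} [MeasurableSpace α] {ν : Measure α}
    [NormedAddCommGroup G] [NormedSpace ℝ G] [Fintype ι] {c : α → G} {a : ι → α → ℝ} {e : ι → G}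
    (h : ∀ y, c y = ∑ i, a i y • e i) (ha : ∀ i, Integrable (a i) ν) : Integrable c ν := by
  rw [funext h]
  exact integrable_finsetSum Finset.univ fun i _ => (ha i).smul_const (e i)

lemma integrable_clm_of_apply {c : EuclideanSpace ℝ (Fin n) → EuclideanSpace ℝ (Fin n) →L[ℝ] ℝ}
    (h : ∀ v, Integrable (fun y => c y v)) : Integrable c := by
  refine integrable_of_eq_sum_smul (a := fun (i : Fin n) y => c y (EuclideanSpace.single i 1))
    (e := fun i => EuclideanSpace.proj i) (fun y => ?_) fun i => h _
  refine ContinuousLinearMap.coe_injective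
    ((EuclideanSpace.basisFun (Fin n) ℝ).toBasis.ext fun j => ?_)
  simp [PiLp.single_apply]

lemma integrable_mul_test {U : Set (EuclideanSpace ℝ (Fin n))}
    {u η : EuclideanSpace ℝ (Fin n) → ℝ} (hu : LocallyIntegrableOn u U) (hη : Continuous η)
    (hc : HasCompactSupport η) (hs : tsupport η ⊆ U) : Integrable (fun y => u y * η y) :=
  (integrableOn_iff_integrable_of_support_subset fun _ hy => hs (subset_tsupport _
    (right_ne_zero_of_mul hy))).1 (integrableOn_mul_test hu hη hc hs)

lemma setIntegral_mul_test {U : Set (EuclideanSpace ℝ (Fin n))}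
    {u η : EuclideanSpace ℝ (Fin n) → ℝ} (hs : tsupport η ⊆ U) :
    ∫ y in U, u y * η y = ∫ y, u y * η y :=
  setIntegral_eq_integral_of_forall_compl_eq_zero fun y hy => by
    rw [image_eq_zero_of_notMem_tsupport fun h => hy (hs h), mul_zero]

/-- The product rule in weak form: a test function `η` on the whole space becomes the test function
`chartBump * η`, supported in the chart. -/
lemma IsWeakGradient.isWeakFDeriv_localFun {g : SmoothMetric n M} {f : M → ℝ}
    {X : (x : M) → TangentSpace (𝓡 n) x} (h : IsWeakGradient g f X) (p : M) :
    IsWeakFDeriv volume (localFun n p f) (localCovector g p f X) := by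
  have hb := contDiff_chartBump (n := n) p
  have hbc := hasCompactSupport_chartBump (n := n) p
  have hbs := tsupport_chartBump_subset (n := n) p
  have hb' : ∀ v, Continuous fun y => fderiv ℝ (chartBump n p) y v := fun v =>
    (hb.continuous_fderiv (by simp)).clm_apply continuous_const
  have hbs' : ∀ v, tsupport (fun y => fderiv ℝ (chartBump n p) y v) ⊆ (chart n p).target :=
    fun v => (tsupport_fderiv_apply_subset ℝ v).trans hbs
  refine ⟨integrable_mul_test (h p 0).1 hb.continuous hbc hbs, integrable_clm_of_apply fun v => ?_,
    fun η hη hc v => ?_⟩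
  · simp only [localCovector_apply]
    exact (integrable_mul_test (h p v).2.1 hb.continuous hbc hbs).add
      (integrable_mul_test (h p v).1 (hb' v) (hbc.fderiv_apply ℝ v) (hbs' v))
  · obtain ⟨h1, h2, h3⟩ := h p v
    have hηb : tsupport (fun y => chartBump n p y * η y) ⊆ (chart n p).target :=
      (tsupport_mul_subset_left).trans hbs
    have h4 := h3 (fun y => chartBump n p y * η y) (hb.mul hη) hbc.mul_right hηb
    have hη' : Continuous fun y => fderiv ℝ η y v :=
      (hη.continuous_fderiv (by simp)).clm_apply continuous_const
    have hfd : ∀ y, fderiv ℝ (fun y => chartBump n p y * η y) y v =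
        chartBump n p y * fderiv ℝ η y v + fderiv ℝ (chartBump n p) y v * η y := by
      intro y
      rw [fderiv_fun_mul (hb.differentiable (by simp) y) (hη.differentiable (by simp) y)]
      simp only [add_apply, smul_apply, smul_eq_mul]
      ring
    have hs1 : tsupport (fun y => chartBump n p y * fderiv ℝ η y v) ⊆ (chart n p).target :=
      (tsupport_mul_subset_left).trans hbs
    have hs2 : tsupport (fun y => fderiv ℝ (chartBump n p) y v * η y) ⊆ (chart n p).target :=
      (tsupport_mul_subset_left).trans (hbs' v)
    have i1 := integrable_mul_test (η := fun y => chartBump n p y * fderiv ℝ η y v) h1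
      (hb.continuous.mul hη') hbc.mul_right hs1
    have i2 := integrable_mul_test (η := fun y => fderiv ℝ (chartBump n p) y v * η y) h1
      ((hb' v).mul hη.continuous)
      (hbc.fderiv_apply ℝ v).mul_right hs2
    have i3 := integrable_mul_test (η := fun y => chartBump n p y * η y) h2
      (hb.continuous.mul hη.continuous) hbc.mul_right hηb
    rw [setIntegral_mul_test ((tsupport_fderiv_apply_subset ℝ v).trans hηb),
      setIntegral_mul_test hηb] at h4
    simp only [hfd, mul_add] at h4
    rw [integral_add i1 i2] at h4
    have e1 : ∫ y, localFun n p f y * fderiv ℝ η y v =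
        ∫ y, f ((chart n p).symm y) * (chartBump n p y * fderiv ℝ η y v) :=
      integral_congr_ae (Filter.Eventually.of_forall fun y => by
        simp only [localFun]
        ring)
    have e2 : ∫ y, localCovector g p f X y v * η y =
        ∫ y, (g.inner ((chart n p).symm y) (X ((chart n p).symm y)) (coordVec p y v) *
          (chartBump n p y * η y) +
          f ((chart n p).symm y) * (fderiv ℝ (chartBump n p) y v * η y)) :=
      integral_congr_ae (Filter.Eventually.of_forall fun y => by
        simp only [localCovector_apply]
        ring)
    rw [e1, e2, integral_add i3 i2]
    linarith

variable [MeasurableSpace M] [BorelSpace M] [CompactSpace M]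

/-- Cutting off is bounded from `W^{1,2}(M)` to the Sobolev space of the model space: the bump `b`
satisfies `0 ≤ b ≤ 1` and `|db| ≤ B`, and the covector is `b ∇f + f db`. -/
lemma exists_lintegral_local_le (g : SmoothMetric n M) (p : M) : ∃ C : ℝ≥0, ∀ f : W12 g,
    (∫⁻ y, ‖localFun n p f.1 y‖ₑ ^ 2) + ∫⁻ y, ‖localCovector g p f.1 (weakGradient f) y‖ₑ ^ 2 ≤
      C * ENNReal.ofReal (sobolevForm g f f) := by
  have hK := isCompact_outerBall (n := n) p
  have hKm := hK.measurableSet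
  obtain ⟨C₁, hC₁⟩ := exists_lintegral_chart_le g p hK (outerBall_subset p)
  obtain ⟨C₂, hC₂⟩ := exists_lintegral_gradCovector_le g p hK (outerBall_subset p)
  obtain ⟨B, hB⟩ := hK.exists_bound_of_continuousOn
    ((contDiff_chartBump (n := n) p).continuous_fderiv (by simp)).continuousOn
  refine ⟨C₁ + 2 * (C₂ + B.toNNReal ^ 2 * C₁), fun f => ?_⟩
  set S := ENNReal.ofReal (sobolevForm g f f)
  set X := weakGradient f
  have hwg := isWeakGradient_weakGradient f
  have hfm : AEMeasurable (fun x => ‖f.1 x‖ₑ ^ 2) (riemannianVolume g) :=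
    (Lp.aestronglyMeasurable f.1).enorm.pow_const 2
  have hf : ∫⁻ y in outerBall n p, ‖f.1 ((chart n p).symm y)‖ₑ ^ 2 ≤ C₁ * S := by
    refine (hC₁ _ hfm).trans ?_
    rw [lintegral_sq_Lp]
    gcongr
    exact ENNReal.ofReal_le_ofReal (norm_sq_le_sobolevForm f)
  have hX : ∫⁻ y in outerBall n p, ‖gradCovector g p X y‖ₑ ^ 2 ≤ C₂ * S := by
    refine (hC₂ X (hwg.aestronglyMeasurable_inner hwg).aemeasurable.ennreal_ofReal).trans ?_
    rw [lintegral_inner_weakGradient]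
    gcongr
    exact ENNReal.ofReal_le_ofReal (dirichletForm_le_sobolevForm f)
  have hb1 : ∀ y, ‖chartBump n p y‖ₑ ≤ 1 := fun y => by
    rw [Real.enorm_eq_ofReal (chartBump n p).nonneg]
    exact ENNReal.ofReal_le_one.2 (chartBump n p).le_one
  have hb2 : ∀ y ∈ outerBall n p, ‖fderiv ℝ (chartBump n p) y‖ₑ ≤ B.toNNReal := fun y hy => by
    rw [← ofReal_norm]
    exact ENNReal.ofReal_le_ofReal (hB y hy)
  have h1 : ∫⁻ y, ‖localFun n p f.1 y‖ₑ ^ 2 ≤ C₁ * S := by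
    rw [← setLIntegral_eq_of_support_subset (s := outerBall n p)]
    · refine le_trans (lintegral_mono fun y => ?_) hf
      rw [localFun, enorm_mul]
      gcongr
      exact mul_le_of_le_one_right' (hb1 y)
    · intro y hy
      by_contra hn
      exact hy (by simp [localFun_eq_zero hn])
  have hgm : AEMeasurable (fun y => ‖f.1 ((chart n p).symm y)‖ₑ ^ 2)
      (volume.restrict (outerBall n p)) :=
    (((hwg p 0).1.aestronglyMeasurable).mono_measure
      (Measure.restrict_mono (outerBall_subset p) le_rfl)).enorm.pow_const 2
  have h2 : ∫⁻ y, ‖localCovector g p f.1 X y‖ₑ ^ 2 ≤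
      2 * (C₂ * S + (B.toNNReal : ENNReal) ^ 2 * (C₁ * S)) := by
    rw [← setLIntegral_eq_of_support_subset (s := outerBall n p)]
    · calc ∫⁻ y in outerBall n p, ‖localCovector g p f.1 X y‖ₑ ^ 2
          ≤ ∫⁻ y in outerBall n p, 2 * (‖gradCovector g p X y‖ₑ ^ 2 +
            (B.toNNReal : ENNReal) ^ 2 * ‖f.1 ((chart n p).symm y)‖ₑ ^ 2) := by
            refine setLIntegral_mono_ae' hKm (Filter.Eventually.of_forall fun y hy => ?_)
            refine (enorm_sq_le_of_sub _
              (f.1 ((chart n p).symm y) • fderiv ℝ (chartBump n p) y)).trans ?_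
            rw [localCovector, add_sub_cancel_right, enorm_smul, enorm_smul,
              mul_comm ((B.toNNReal : ENNReal) ^ 2), ← mul_pow ‖f.1 _‖ₑ]
            gcongr
            · exact mul_le_of_le_one_left' (hb1 y)
            · exact hb2 y hy
        _ = 2 * ((∫⁻ y in outerBall n p, ‖gradCovector g p X y‖ₑ ^ 2) +
            (B.toNNReal : ENNReal) ^ 2 *
              ∫⁻ y in outerBall n p, ‖f.1 ((chart n p).symm y)‖ₑ ^ 2) := by
            rw [lintegral_const_mul' _ _ (by simp), lintegral_add_right' _ (hgm.const_mul _),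
              lintegral_const_mul' _ _ (by simp)]
        _ ≤ _ := by gcongr
    · intro y hy
      by_contra hn
      refine hy ?_
      change ‖localCovector g p f.1 X y‖ₑ ^ 2 = 0
      rw [localCovector_eq_zero hn, ← ofReal_norm, norm_zero, ENNReal.ofReal_zero,
        zero_pow two_ne_zero]
  calc _ ≤ C₁ * S + 2 * (C₂ * S + (B.toNNReal : ENNReal) ^ 2 * (C₁ * S)) := add_le_add h1 h2
    _ = _ := by
      push_cast
      ring

end Localisation

/-! ### Rellich compactness -/

section Global

variable {n : ℕ} {M : Type*} [TopologicalSpace M] [ChartedSpace (EuclideanSpace ℝ (Fin n)) M]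
  [IsManifold (𝓡 n) ∞ M] [MeasurableSpace M] [BorelSpace M]

lemma exists_lintegral_chartSet_le (g : SmoothMetric n M) (p : M) : ∃ C : ℝ≥0, ∀ f : W12 g,
    ∫⁻ x in chartSet p (innerBall n p), ‖f.1 x‖ₑ ^ 2 ∂riemannianVolume g ≤
      C * ∫⁻ y, ‖localFun n p f.1 y‖ₑ ^ 2 := by
  have hK := isCompact_innerBall (n := n) p
  have hKs := measurableSet_chartSet (n := n) p hK.measurableSet
  obtain ⟨C, hC, -⟩ := exists_volume_comparable g p hK (innerBall_subset p)
  refine ⟨C, fun f => ?_⟩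
  have hC' : Measure.map (chart n p) ((riemannianVolume g).restrict
      (chartSet p (innerBall n p))) ≤ (C : ENNReal) • volume :=
    hC.trans (Measure.le_iff'.2 fun S => by
      rw [Measure.smul_apply, Measure.smul_apply, smul_eq_mul, smul_eq_mul]
      gcongr
      exact Measure.restrict_le_self)
  have hum : AEMeasurable (fun y => ‖localFun n p f.1 y‖ₑ ^ 2)
      (Measure.map (chart n p) ((riemannianVolume g).restrict (chartSet p (innerBall n p)))) :=
    (((isWeakGradient_weakGradient f).isWeakFDeriv_localFun
      p).integrable.aestronglyMeasurable.mono_ac ((Measure.absolutelyContinuous_of_le hC').trans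
        (Measure.AbsolutelyContinuous.rfl.smul_left _))).enorm.pow_const 2
  calc ∫⁻ x in chartSet p (innerBall n p), ‖f.1 x‖ₑ ^ 2 ∂riemannianVolume g
      = ∫⁻ x in chartSet p (innerBall n p), ‖localFun n p f.1 (chart n p x)‖ₑ ^ 2
          ∂riemannianVolume g :=
        setLIntegral_congr_fun hKs fun x hx => by simp only [localFun_chart f.1 hx]
    _ = ∫⁻ y, ‖localFun n p f.1 y‖ₑ ^ 2 ∂Measure.map (chart n p)
          ((riemannianVolume g).restrict (chartSet p (innerBall n p))) :=
        (lintegral_map' hum (aemeasurable_chart p _)).symm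
    _ ≤ ∫⁻ y, ‖localFun n p f.1 y‖ₑ ^ 2 ∂((C : ENNReal) • volume) := lintegral_mono' hC' le_rfl
    _ = _ := lintegral_smul_measure _ _

variable (g : SmoothMetric n M)

lemma integrable_mollify_localFun (p : M) (φ : ContDiffBump (0 : EuclideanSpace ℝ (Fin n)))
    (x : EuclideanSpace ℝ (Fin n)) (f : W12 g) :
    Integrable fun y => φ.normed volume (x - y) • localFun n p f.1 y := by
  have hc : Continuous fun y => φ.normed volume (x - y) :=
    φ.continuous_normed.comp (continuous_const.sub continuous_id)
  obtain ⟨B, hB⟩ := (φ.hasCompactSupport_normed (μ := volume)).exists_bound_of_continuous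
    φ.continuous_normed
  exact ((isWeakGradient_weakGradient f).isWeakFDeriv_localFun p).integrable.bdd_smul B
    hc.aestronglyMeasurable (Filter.Eventually.of_forall fun y => hB _)

lemma localFun_congr (p : M) {f h : M → ℝ} (hfh : f =ᵐ[riemannianVolume g] h) :
    localFun n p f =ᵐ[volume] localFun n p h := by
  have h1 := (ae_restrict_iff' (chart n p).open_target.measurableSet).1 (ae_chart_of_ae g p hfh)
  filter_upwards [h1] with y hy
  by_cases hyt : y ∈ outerBall n p
  · rw [localFun, localFun, hy (outerBall_subset p hyt)]
  · rw [localFun_eq_zero hyt, localFun_eq_zero hyt]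

/-- The value at `x` of the mollification of `localFun`, as a linear functional. -/
def localFunctional (p : M) (φ : ContDiffBump (0 : EuclideanSpace ℝ (Fin n)))
    (x : EuclideanSpace ℝ (Fin n)) : W12 g →ₗ[ℝ] ℝ where
  toFun f := mollify volume φ (localFun n p f.1) x
  map_add' f h := by
    rw [mollify, mollify, mollify, ← integral_add (integrable_mollify_localFun g p φ x f)
      (integrable_mollify_localFun g p φ x h)]
    refine integral_congr_ae ?_
    filter_upwards [localFun_congr g p (Lp.coeFn_add f.1 h.1)] with y hy
    rw [Submodule.coe_add, hy, ← smul_add, localFun, localFun, localFun, Pi.add_apply, add_mul]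
  map_smul' c f := by
    rw [mollify, mollify, RingHom.id_apply, ← integral_smul]
    refine integral_congr_ae ?_
    filter_upwards [localFun_congr g p (Lp.coeFn_smul c f.1)] with y hy
    rw [Submodule.coe_smul, hy, localFun, localFun, Pi.smul_apply]
    simp only [smul_eq_mul]
    ring

variable [CompactSpace M]

/-- Jensen bounds the squared value by the average of `|u|²` against a bounded kernel, hence by the
`L²` norm of the cut-off function. -/
lemma exists_abs_localFunctional_le (p : M) (φ : ContDiffBump (0 : EuclideanSpace ℝ (Fin n)))
    (x : EuclideanSpace ℝ (Fin n)) :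
    ∃ A, ∀ f, |localFunctional g p φ x f| ≤ A * √(sobolevForm g f f) := by
  obtain ⟨C, hC⟩ := exists_lintegral_local_le g p
  obtain ⟨B, hB⟩ := (φ.hasCompactSupport_normed (μ := volume)).exists_bound_of_continuous
    φ.continuous_normed
  refine ⟨√(B.toNNReal * C), fun f => ?_⟩
  have hc : Continuous fun y => φ.normed volume (x - y) :=
    φ.continuous_normed.comp (continuous_const.sub continuous_id)
  have hone : ∫⁻ y, ‖φ.normed volume (x - y)‖ₑ ≤ 1 := by
    rw [lintegral_sub_left_eq_self (fun z => ‖φ.normed volume z‖ₑ) x, lintegral_enorm_normed]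
  have h1 : ‖localFunctional g p φ x f‖ₑ ^ 2 ≤
      ENNReal.ofReal (B.toNNReal * C * sobolevForm g f f) := by
    calc ‖localFunctional g p φ x f‖ₑ ^ 2
        ≤ ∫⁻ y, ‖φ.normed volume (x - y)‖ₑ * ‖localFun n p f.1 y‖ₑ ^ 2 :=
          sq_enorm_integral_smul_le hc.aemeasurable ((isWeakGradient_weakGradient
            f).isWeakFDeriv_localFun p).integrable.aestronglyMeasurable hone
      _ ≤ ∫⁻ y, (B.toNNReal : ENNReal) * ‖localFun n p f.1 y‖ₑ ^ 2 := by
          refine lintegral_mono fun y => ?_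
          gcongr
          rw [← ofReal_norm]
          exact ENNReal.ofReal_le_ofReal (hB _)
      _ = B.toNNReal * ∫⁻ y, ‖localFun n p f.1 y‖ₑ ^ 2 := lintegral_const_mul' _ _ (by simp)
      _ ≤ B.toNNReal * (C * ENNReal.ofReal (sobolevForm g f f)) := by
          gcongr
          exact le_self_add.trans (hC f)
      _ = _ := by
          rw [ENNReal.ofReal_mul (by positivity), ENNReal.ofReal_mul (by positivity),
            ENNReal.ofReal_coe_nnreal, ENNReal.ofReal_coe_nnreal, mul_assoc]
  rw [Real.enorm_eq_ofReal_abs, ← ENNReal.ofReal_pow (abs_nonneg _),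
    ENNReal.ofReal_le_ofReal_iff (mul_nonneg (by positivity) (sobolevForm_self_nonneg f))] at h1
  rw [← Real.sqrt_mul (by positivity)]
  exact Real.le_sqrt_of_sq_le h1

/-- Up to finitely many bounded linear functionals, the `L²` norm is small compared with the
Sobolev norm. -/
theorem exists_finite_norm_sq_le {ε : ℝ} (hε : 0 < ε) :
    ∃ (N : ℕ) (l : Fin N → W12 g →ₗ[ℝ] ℝ),
      (∀ j, ∃ A, ∀ f, |l j f| ≤ A * √(sobolevForm g f f)) ∧
      ∀ f, (∀ j, l j f = 0) → ‖f.1‖ ^ 2 ≤ ε * sobolevForm g f f := by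
  obtain ⟨s, hs⟩ := exists_finite_cover n M
  choose C₁ hC₁ using exists_lintegral_chartSet_le g
  choose C₂ hC₂ using exists_lintegral_local_le g
  -- After the constants `C₁ p` and `C₂ p`, each of the `s.card` charts contributes at most `ε /
  -- (s.card + 1)`; the added ones keep the denominators positive.
  set δ : M → ℝ := fun p => ε / ((s.card + 1) * (C₁ p * C₂ p + 1)) with hδdef
  have hδ : ∀ p, 0 < δ p := fun p => by positivity
  choose φ t ht using fun p : M => exists_finite_mollify_test
    (μ := (volume : Measure (EuclideanSpace ℝ (Fin n)))) (isCompact_outerBall (n := n) p) (hδ p)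
  let l : (Σ p : s, t p) → W12 g →ₗ[ℝ] ℝ := fun j => localFunctional g j.1 (φ j.1) j.2
  obtain ⟨N, ⟨e⟩⟩ := Finite.exists_equiv_fin (Σ p : s, t (p : M))
  refine ⟨N, fun j => l (e.symm j), fun j => exists_abs_localFunctional_le g _ _ _, fun f hf => ?_⟩
  have hf' : ∀ j, l j f = 0 := fun j => by simpa using hf (e j)
  have hS := sobolevForm_self_nonneg f
  have hp : ∀ p : s, ∫⁻ x in chartSet (p : M) (innerBall n (p : M)), ‖f.1 x‖ₑ ^ 2
      ∂riemannianVolume g ≤ ENNReal.ofReal (ε / (s.card + 1) * sobolevForm g f f) := by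
    intro p
    have h1 := ht p _ _ ((isWeakGradient_weakGradient f).isWeakFDeriv_localFun (p : M))
      (fun y hy => localFun_eq_zero hy) fun x hx => hf' ⟨p, ⟨x, hx⟩⟩
    calc _ ≤ (C₁ p : ENNReal) * ∫⁻ y, ‖localFun n (p : M) f.1 y‖ₑ ^ 2 := hC₁ p f
      _ ≤ C₁ p * (ENNReal.ofReal (δ p) * (C₂ p * ENNReal.ofReal (sobolevForm g f f))) := by
          gcongr
          exact h1.trans (by gcongr; exact hC₂ p f)
      _ = ENNReal.ofReal (δ p * (C₁ p * C₂ p) * sobolevForm g f f) := by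
          rw [ENNReal.ofReal_mul (mul_nonneg (hδ p).le (by positivity)),
            ENNReal.ofReal_mul (hδ p).le, ENNReal.ofReal_mul (by positivity),
            ENNReal.ofReal_coe_nnreal, ENNReal.ofReal_coe_nnreal]
          ring
      _ ≤ _ := by
          refine ENNReal.ofReal_le_ofReal (mul_le_mul_of_nonneg_right ?_ hS)
          have h0 : (0 : ℝ) ≤ C₁ p * C₂ p := by positivity
          rw [hδdef, div_mul_eq_mul_div, div_le_div_iff₀ (by positivity) (by positivity)]
          have : 0 ≤ ε * ((s.card : ℝ) + 1) := by positivity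
          nlinarith
  have h2 : ENNReal.ofReal (‖f.1‖ ^ 2) ≤ ENNReal.ofReal (ε * sobolevForm g f f) := by
    rw [← lintegral_sq_Lp, ← setLIntegral_univ, ← hs]
    refine (lintegral_iUnion_le _ _).trans ?_
    rw [tsum_fintype]
    refine (Finset.sum_le_sum fun p _ => hp p).trans ?_
    rw [Finset.sum_const, Finset.card_univ, Fintype.card_coe, nsmul_eq_mul,
      ← ENNReal.ofReal_natCast, ← ENNReal.ofReal_mul (by positivity), ← mul_assoc]
    refine ENNReal.ofReal_le_ofReal (mul_le_mul_of_nonneg_right ?_ hS)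
    rw [mul_div_assoc', div_le_iff₀ (by positivity)]
    nlinarith
  exact (ENNReal.ofReal_le_ofReal_iff (mul_nonneg hε.le hS)).1 h2

/-! ### The weighted Sobolev inequality -/

/-- The measure `|w| dvol`, pushed to the chart, satisfies `ν(S) ≤ A |S| ^ (1 - 2 / n)`: this is the
weak Lorentz bound with `p = n / 2`, combined with the comparability of volumes. The weighted
Sobolev inequality then applies to the cut-off function, which equals `f` over the inner ball. The
condition `n ≥ 3` makes both `p > 1` and the dimension exceed `2`. -/
lemma exists_lintegral_mul_chart_le (hn : 3 ≤ n) (g : SmoothMetric n M) {w : M → ℝ}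
    (hw : MemLorentz (riemannianVolume g) w ((n : ℝ) / 2) ⊤) (p : M) : ∃ C : ℝ≥0, ∀ f : W12 g,
      ∫⁻ x in chartSet p (innerBall n p), ‖f.1 x‖ₑ ^ 2 * ‖w x‖ₑ ∂riemannianVolume g ≤
        C * ENNReal.ofReal (sobolevForm g f f) := by
  have hn' : (3 : ℝ) ≤ n := by exact_mod_cast hn
  have hK := isCompact_innerBall (n := n) p
  have hKs := measurableSet_chartSet (n := n) p hK.measurableSet
  obtain ⟨C₀, hC₀⟩ := exists_setLIntegral_le_of_memLorentz (by linarith) hw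
  obtain ⟨C₁, hC₁, -⟩ := exists_volume_comparable g p hK (innerBall_subset p)
  obtain ⟨C₂, hC₂⟩ := exists_weighted_sobolev (volume : Measure (EuclideanSpace ℝ (Fin n)))
    (by rw [finrank_euclideanSpace_fin]; exact hn)
  obtain ⟨C₃, hC₃⟩ := exists_lintegral_local_le g p
  have hexp : 0 ≤ 1 - 2 / (n : ℝ) := by
    have : 2 / (n : ℝ) ≤ 1 := (div_le_one (by linarith)).2 (by linarith)
    linarith
  set μ := (riemannianVolume g).restrict (chartSet p (innerBall n p)) with hμ
  have hc : AEMeasurable (chart n p) μ := aemeasurable_chart p _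
  have hwm : AEMeasurable (fun x => ‖w x‖ₑ) μ := hw.1.enorm.mono_measure Measure.restrict_le_self
  set ν := (μ.withDensity fun x => ‖w x‖ₑ).map (chart n p) with hν
  have hc' : AEMeasurable (chart n p) (μ.withDensity fun x => ‖w x‖ₑ) :=
    hc.mono_ac (withDensity_absolutelyContinuous _ _)
  have hνle : ∀ S, MeasurableSet S → ν S ≤ ((C₀ * C₁ ^ (1 - 2 / (n : ℝ)) : ℝ≥0) : ENNReal) *
      volume S ^ (1 - 2 / (Module.finrank ℝ (EuclideanSpace ℝ (Fin n)) : ℝ)) := by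
    intro S hS
    have hT : MeasurableSet (chartSet p (innerBall n p) ∩ chart n p ⁻¹' S) := by
      have := measurableSet_chartSet (n := n) p (hK.measurableSet.inter hS)
      rwa [chartSet, preimage_inter, ← inter_assoc] at this
    have e1 : ν S = ∫⁻ x in chartSet p (innerBall n p) ∩ chart n p ⁻¹' S, ‖w x‖ₑ
        ∂riemannianVolume g := by
      rw [hν, Measure.map_apply_of_aemeasurable hc' hS, withDensity_apply', hμ,
        Measure.restrict_restrict' hKs, inter_comm]
    have e2 : riemannianVolume g (chartSet p (innerBall n p) ∩ chart n p ⁻¹' S) ≤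
        C₁ * volume S := by
      have := hC₁ S
      rw [Measure.map_apply_of_aemeasurable hc hS, hμ, Measure.restrict_apply' hKs,
        inter_comm] at this
      refine this.trans ?_
      rw [Measure.smul_apply, smul_eq_mul]
      gcongr
      exact Measure.restrict_le_self
    rw [e1, finrank_euclideanSpace_fin]
    refine (hC₀ _ (measure_lt_top _ _)).trans ?_
    rw [one_div_div, ENNReal.coe_mul, ENNReal.coe_rpow_of_nonneg _ hexp, mul_assoc,
      ← ENNReal.mul_rpow_of_nonneg _ _ hexp]
    gcongr
  refine ⟨C₂ * (C₀ * C₁ ^ (1 - 2 / (n : ℝ))) * C₃, fun f => ?_⟩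
  have hwf := (isWeakGradient_weakGradient f).isWeakFDeriv_localFun p
  have h1 := hC₂ ν _ hνle _ _ hwf (hasCompactSupport_localFun p _)
  have h2 : ∫⁻ y, ‖localCovector g p f.1 (weakGradient f) y‖ₑ ^ 2 ≤
      C₃ * ENNReal.ofReal (sobolevForm g f f) := le_add_self.trans (hC₃ f)
  have hνac : ν ≪ volume := by
    refine Measure.AbsolutelyContinuous.mk fun S hS h0 => ?_
    have := hνle S hS
    rw [h0, ENNReal.zero_rpow_of_pos, mul_zero] at this
    · exact le_antisymm this bot_le
    · rw [finrank_euclideanSpace_fin, sub_pos, div_lt_one (by linarith)]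
      linarith
  have hum : AEMeasurable (fun y => ‖localFun n p f.1 y‖ₑ ^ 2) ν :=
    (hwf.integrable.aestronglyMeasurable.mono_ac hνac).enorm.pow_const 2
  have h3 : ∫⁻ y, ‖localFun n p f.1 y‖ₑ ^ 2 ∂ν =
      ∫⁻ x in chartSet p (innerBall n p), ‖f.1 x‖ₑ ^ 2 * ‖w x‖ₑ ∂riemannianVolume g := by
    have hum' := hum.comp_aemeasurable hc'
    rw [hν, lintegral_map' hum hc']
    refine (lintegral_withDensity_eq_lintegral_mul₀' hwm hum').trans ?_
    refine setLIntegral_congr_fun hKs fun x hx => ?_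
    simp only [Pi.mul_apply, Function.comp_apply, localFun_chart f.1 hx]
    rw [mul_comm]
  rw [← h3]
  refine h1.trans ?_
  calc _ ≤ (C₂ : ENNReal) * ((C₀ * C₁ ^ (1 - 2 / (n : ℝ)) : ℝ≥0) : ENNReal) *
        (C₃ * ENNReal.ofReal (sobolevForm g f f)) := by gcongr
    _ = _ := by
      push_cast
      ring

lemma exists_lintegral_mul_le (hn : 3 ≤ n) (g : SmoothMetric n M) {w : M → ℝ}
    (hw : MemLorentz (riemannianVolume g) w ((n : ℝ) / 2) ⊤) : ∃ C : ℝ≥0, ∀ f : W12 g,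
      ∫⁻ x, ‖f.1 x‖ₑ ^ 2 * ‖w x‖ₑ ∂riemannianVolume g ≤
        C * ENNReal.ofReal (sobolevForm g f f) := by
  obtain ⟨s, hs⟩ := exists_finite_cover n M
  choose C hC using fun p : M => exists_lintegral_mul_chart_le hn g hw p
  refine ⟨∑ p : s, C p, fun f => ?_⟩
  rw [← setLIntegral_univ, ← hs]
  refine (lintegral_iUnion_le _ _).trans ?_
  rw [tsum_fintype, ENNReal.ofNNReal_finsetSum, Finset.sum_mul]
  exact Finset.sum_le_sum fun p _ => hC p f

lemma integrable_mul_weight (hn : 3 ≤ n) {g : SmoothMetric n M} {w : M → ℝ}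
    (hw : MemLorentz (riemannianVolume g) w ((n : ℝ) / 2) ⊤) (f h : W12 g) :
    Integrable (fun x => f.1 x * h.1 x * w x) (riemannianVolume g) := by
  obtain ⟨C, hC⟩ := exists_lintegral_mul_le hn g hw
  have hfin : ∀ f : W12 g, ∫⁻ x, ‖f.1 x‖ₑ ^ 2 * ‖w x‖ₑ ∂riemannianVolume g < ⊤ := fun f =>
    (hC f).trans_lt (ENNReal.mul_lt_top ENNReal.coe_lt_top ENNReal.ofReal_lt_top)
  have hm : ∀ f : W12 g, AEMeasurable (fun x => ‖f.1 x‖ₑ ^ 2 * ‖w x‖ₑ) (riemannianVolume g) :=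
    fun f => ((Lp.aestronglyMeasurable f.1).enorm.pow_const 2).mul hw.1.enorm
  have hpt : ∀ a b c : ENNReal, a * b * c ≤ a ^ 2 * c + b ^ 2 * c := by
    intro a b c
    rw [← add_mul]
    gcongr
    rcases le_total a b with hab | hab
    · exact (mul_le_mul_left hab b).trans ((pow_two b).ge.trans le_add_self)
    · exact (mul_le_mul_right hab a).trans ((pow_two a).ge.trans le_self_add)
  refine ⟨((Lp.aestronglyMeasurable f.1).mul (Lp.aestronglyMeasurable h.1)).mul hw.1, ?_⟩
  calc ∫⁻ x, ‖f.1 x * h.1 x * w x‖ₑ ∂riemannianVolume g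
      ≤ ∫⁻ x, (‖f.1 x‖ₑ ^ 2 * ‖w x‖ₑ + ‖h.1 x‖ₑ ^ 2 * ‖w x‖ₑ) ∂riemannianVolume g :=
        lintegral_mono fun x => by
          rw [enorm_mul, enorm_mul]
          exact hpt _ _ _
    _ < ⊤ := by
      rw [lintegral_add_left' (hm f)]
      exact ENNReal.add_lt_top.2 ⟨hfin f, hfin h⟩

end Global

/-! ### The eigenspaces -/

lemma abs_form_le_of_self_le {H : Type*} [AddCommGroup H] [Module ℝ H]
    {Q D : H →ₗ[ℝ] H →ₗ[ℝ] ℝ} (hQ : ∀ f h, Q f h = Q h f) (hnn : ∀ f, 0 ≤ Q f f) {C : ℝ}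
    (hC : 0 ≤ C) (hQD : ∀ f, Q f f ≤ C * D f f) (f h : H) :
    |Q f h| ≤ C * √(D f f) * √(D h h) := by
  refine (abs_form_le hQ hnn f h).trans ?_
  calc √(Q f f) * √(Q h h) ≤ √(C * D f f) * √(C * D h h) := by
        gcongr
        · exact hQD f
        · exact hQD h
    _ = _ := by
        rw [Real.sqrt_mul hC, Real.sqrt_mul hC, mul_mul_mul_comm, Real.mul_self_sqrt hC, mul_assoc]

/-- `isGreatest_rank_formEigenspace_of_core`, for a form `B = D - N - U` with `N` compact
relative to `D` and `U` bounded relative to `N`. -/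
lemma isGreatest_rank_formEigenspace_of_perturbation {H : Type*} [AddCommGroup H] [Module ℝ H]
    {D N U B a : H →ₗ[ℝ] H →ₗ[ℝ] ℝ} (hB : ∀ f h, B f h = D f h - N f h - U f h)
    (hD : ∀ f h, D f h = D h f) (hN : ∀ f h, N f h = N h f) (hU : ∀ f h, U f h = U h f)
    (ha : ∀ f h, a f h = a h f) (hDpos : ∀ f, f ≠ 0 → 0 < D f f) (hN0 : ∀ f, 0 ≤ N f f)
    (hND : ∀ f, N f f ≤ D f f) (hpos : ∀ f, f ≠ 0 → 0 < a f f)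
    (hcomplete : ∀ u : ℕ → H, (∀ N k m, N ≤ k → N ≤ m → D (u k - u m) (u k - u m) < (1 / 4) ^ N) →
      ∃ f, Filter.Tendsto (fun k => D (u k - f) (u k - f)) Filter.atTop (𝓝 0))
    {K : ℝ} (hK0 : 0 ≤ K) (hK : ∀ f, |U f f| ≤ K * N f f) {δ : ℝ} (hδ : 0 < δ)
    (hlow : ∀ f, δ * N f f ≤ a f f) {C : ℝ} (hC : 0 ≤ C) (haC : ∀ f, a f f ≤ C * D f f)
    {J : Type*} [Finite J] (l : J → H →ₗ[ℝ] ℝ) (hl : ∀ j, ∃ A, ∀ f, |l j f| ≤ A * √(D f f))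
    (hcoer : ∀ f, (∀ j, l j f = 0) → N f f ≤ 1 / (2 * (1 + K)) * D f f) :
    IsGreatest {d : Cardinal | ∃ P : Submodule ℝ H, (∀ f ∈ P, B f f ≤ 0) ∧ Module.rank ℝ P = d}
      (Module.rank ℝ (Submodule.span ℝ
        (⋃ lam : Set.Iic (0 : ℝ), {f : H | ∀ h, B f h = lam * a f h}))) := by
  have hD0 : ∀ f, 0 ≤ D f f := fun f => (hN0 f).trans (hND f)
  have hBs : ∀ f h, B f h = B h f := fun f h => by rw [hB, hB, hD, hN, hU]
  have hNC : ∀ f h, |N f h| ≤ 1 * √(D f f) * √(D h h) :=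
    abs_form_le_of_self_le hN hN0 zero_le_one fun f => by
      rw [one_mul]
      exact hND f
  -- `B` itself is indefinite, so Cauchy–Schwarz is applied to the shift `B + (1 + K) N = D + K N -
  -- U`, which lies between `D` and `(1 + 2 K) D`.
  have hQC : ∀ f h, |(B + (1 + K) • N) f h| ≤ (1 + 2 * K) * √(D f f) * √(D h h) := by
    have hQ : ∀ f h, (B + (1 + K) • N) f h = B f h + (1 + K) * N f h := fun f h => rfl
    refine abs_form_le_of_self_le (fun f h => ?_) (fun f => ?_) (by positivity) fun f => ?_
    · rw [hQ, hQ, hBs, hN]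
    · rw [hQ, hB]
      linarith [(abs_le.1 (hK f)).2, hD0 f]
    · rw [hQ, hB]
      have := mul_le_mul_of_nonneg_left (hND f) hK0
      linarith [(abs_le.1 (hK f)).1]
  -- On the kernel of the functionals `(1 + K) N ≤ D / 2`, so `B ≥ D / 2`. Everywhere `B + (1 + K) N
  -- ≥ 0` and `N ≤ a / δ`, which gives the lower bound `-(1 + K) / δ` for the Rayleigh quotient.
  refine isGreatest_rank_formEigenspace_of_core (C := (1 + 2 * K) + (1 + K))
    (C' := C) (c := 1 / 2) (K := (1 + K) / δ) hD hDpos hcomplete hBs ha (fun f h => ?_)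
    (abs_form_le_of_self_le ha (fun f => (mul_nonneg hδ.le (hN0 f)).trans (hlow f)) hC haC)
    hpos l hl one_half_pos (fun f hf => ?_) fun f => ?_
  · have e : B f h = (B + (1 + K) • N) f h - (1 + K) * N f h := by
      simp only [LinearMap.add_apply, LinearMap.smul_apply, smul_eq_mul]
      ring
    rw [e]
    refine (abs_sub _ _).trans ?_
    rw [abs_mul, abs_of_nonneg (by positivity : 0 ≤ 1 + K)]
    have := mul_le_mul_of_nonneg_left (hNC f h) (by positivity : 0 ≤ 1 + K)
    linarith [hQC f h]
  · have h1 := hcoer f hf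
    rw [div_mul_eq_mul_div, one_mul, le_div_iff₀ (by positivity)] at h1
    rw [hB]
    linarith [(abs_le.1 (hK f)).2]
  · have h1 : (1 + K) * N f f ≤ (1 + K) / δ * a f f := by
      have := mul_le_mul_of_nonneg_left (hlow f) (by positivity : 0 ≤ (1 + K) / δ)
      rwa [← mul_assoc, div_mul_cancel₀ _ hδ.ne'] at this
    rw [hB]
    linarith [(abs_le.1 (hK f)).2, hD0 f]

section Eigenspaces

variable {n : ℕ} {M : Type*} [TopologicalSpace M] [ChartedSpace (EuclideanSpace ℝ (Fin n)) M]
  [IsManifold (𝓡 n) ∞ M] [MeasurableSpace M] [BorelSpace M]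
  {g : SmoothMetric n M}

lemma integrable_mul_of_memLp_top {V : M → ℝ} (hV : MemLp V ⊤ (riemannianVolume g))
    (f h : W12 g) :
    Integrable (fun x => f.1 x * h.1 x * V x) (riemannianVolume g) := by
  simpa [Pi.mul_def] using
    ((Lp.memLp f.1).integrable_mul (Lp.memLp h.1)).mul_of_top_left hV

lemma exists_abs_weightForm_self_le {V : M → ℝ} (hV : MemLp V ⊤ (riemannianVolume g)) :
    ∃ K : ℝ, 0 ≤ K ∧
      ∀ f, |weightForm g V (integrable_mul_of_memLp_top hV) f f| ≤ K * ‖f.1‖ ^ 2 := by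
  obtain ⟨K, hK⟩ : ∃ K : ℝ≥0, ∀ᵐ x ∂riemannianVolume g, ‖V x‖ ≤ K := by
    refine ⟨(eLpNorm V ⊤ (riemannianVolume g)).toNNReal, ?_⟩
    filter_upwards [ae_le_eLpNormEssSup (f := V) (μ := riemannianVolume g)] with x hx
    rw [← eLpNorm_exponent_top, ← ENNReal.coe_toNNReal hV.2.ne] at hx
    exact_mod_cast hx
  refine ⟨K, K.2, fun f => ?_⟩
  rw [← weightForm_one_self, weightForm_apply, weightForm_apply, ← integral_const_mul]
  rw [← Real.norm_eq_abs]
  refine norm_integral_le_of_norm_le ((integrable_mul_W12 f f).const_mul _) ?_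
  filter_upwards [hK] with x hx
  rw [norm_mul, mul_one, mul_comm (K : ℝ), Real.norm_of_nonneg (mul_self_nonneg _)]
  exact mul_le_mul_of_nonneg_left hx (mul_self_nonneg _)

lemma le_weightForm_self {w : M → ℝ}
    (hρ : ∀ f h : W12 g, Integrable (fun x => f.1 x * h.1 x * w x) (riemannianVolume g))
    {δ : ℝ} (hw : ∀ᵐ x ∂riemannianVolume g, δ ≤ w x) (f : W12 g) :
    δ * ‖f.1‖ ^ 2 ≤ weightForm g w hρ f f := by
  rw [← weightForm_one_self, weightForm_apply, weightForm_apply, ← integral_const_mul]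
  refine integral_mono_ae ((integrable_mul_W12 f f).const_mul _) (hρ f f) ?_
  filter_upwards [hw] with x hx
  rw [mul_one, mul_comm δ]
  exact mul_le_mul_of_nonneg_left hx (mul_self_nonneg _)

lemma exists_pos_le_of_essInf_pos {α : Type*} [MeasurableSpace α] {ν : Measure α} {w : α → ℝ}
    (hw : 0 < essInf (fun x => (w x : EReal)) ν) : ∃ δ > 0, ∀ᵐ x ∂ν, δ ≤ w x := by
  obtain ⟨δ, h0, hδ⟩ := EReal.lt_iff_exists_real_btwn.1 hw
  refine ⟨δ, by exact_mod_cast h0, ?_⟩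
  filter_upwards [ae_lt_of_lt_essInf hδ] with x hx
  exact_mod_cast hx.le

/-- The weighted eigenspaces of `L = Δ + V` for the eigenvalues `λ ≤ 0`: their sum is direct, and
its dimension is the largest dimension of a subspace on which `B_L` is nonpositive. -/
theorem spanIsDirectSum_and_isGreatest [CompactSpace M] {V w : M → ℝ}
    (hV : MemLp V ⊤ (riemannianVolume g))
    (hρ : ∀ f h : W12 g, Integrable (fun x => f.1 x * h.1 x * w x) (riemannianVolume g))
    {δ : ℝ} (hδ : 0 < δ) (hw : ∀ᵐ x ∂riemannianVolume g, δ ≤ w x) {C : ℝ} (hC : 0 ≤ C)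
    (hwC : ∀ f, weightForm g w hρ f f ≤ C * sobolevForm g f f) :
    SpanIsDirectSum (fun lam : Set.Iic (0 : ℝ) => weightedEigenspace g V w lam) ∧
    IsGreatest
      {d : Cardinal | ∃ P : Submodule ℝ (W12 g), (∀ f ∈ P, bilinForm g V f f ≤ 0) ∧
        Module.rank ℝ P = d}
      (Module.rank ℝ
        (Submodule.span ℝ (⋃ lam : Set.Iic (0 : ℝ), weightedEigenspace g V w lam))) := by
  have hVi := integrable_mul_of_memLp_top hV
  obtain ⟨K, hK0, hK⟩ := exists_abs_weightForm_self_le hV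
  have hB := bilinForm_eq hVi
  have hE : (fun lam : Set.Iic (0 : ℝ) => weightedEigenspace g V w lam) =
      fun lam : Set.Iic (0 : ℝ) =>
        {f | ∀ h, (dirichletForm g - weightForm g V hVi) f h = lam * weightForm g w hρ f h} := by
    funext lam
    ext f
    exact forall_congr' fun h => by rw [hB]; rfl
  have hset : {d : Cardinal | ∃ P : Submodule ℝ (W12 g), (∀ f ∈ P, bilinForm g V f f ≤ 0) ∧
      Module.rank ℝ P = d} = {d | ∃ P : Submodule ℝ (W12 g),
        (∀ f ∈ P, (dirichletForm g - weightForm g V hVi) f f ≤ 0) ∧ Module.rank ℝ P = d} := by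
    simp only [hB]
  rw [hset, hE]
  have hlow := le_weightForm_self hρ hw
  have hpos : ∀ f, f ≠ 0 → 0 < weightForm g w hρ f f := fun f hf => by
    have : f.1 ≠ 0 := fun e => hf (Subtype.ext e)
    exact lt_of_lt_of_le (by positivity) (hlow f)
  obtain ⟨m, l, hl, hcoer⟩ := exists_finite_norm_sq_le g (ε := 1 / (2 * (1 + K))) (by positivity)
  simp only [← weightForm_one_self] at hK hlow hcoer
  have hN0 : ∀ f : W12 g, 0 ≤ weightForm g (fun _ => 1) integrable_mul_W12 f f := fun f =>
    (sq_nonneg ‖f.1‖).trans (weightForm_one_self f).ge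
  have hND : ∀ f : W12 g,
      weightForm g (fun _ => 1) integrable_mul_W12 f f ≤ sobolevForm g f f := fun f =>
    (weightForm_one_self f).le.trans (norm_sq_le_sobolevForm f)
  have hB' : ∀ f h, (dirichletForm g - weightForm g V hVi) f h = sobolevForm g f h -
      weightForm g (fun _ => 1) integrable_mul_W12 f h - weightForm g V hVi f h := fun f h => by
    rw [sobolevForm_apply, add_sub_cancel_right, LinearMap.sub_apply, LinearMap.sub_apply]
  refine ⟨spanIsDirectSum_formEigenspace (fun f h => ?_) (weightForm_comm hρ) hpos,
    isGreatest_rank_formEigenspace_of_perturbation hB' sobolevForm_comm (weightForm_comm _)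
      (weightForm_comm hVi) (weightForm_comm hρ) sobolevForm_self_pos hN0 hND hpos
      exists_tendsto_sobolevForm hK0 hK hδ hlow hC hwC l hl hcoer⟩
  rw [hB', hB', sobolevForm_comm, weightForm_comm, weightForm_comm hVi]

lemma eigenspace_eq (V : M → ℝ) (lam : ℝ) :
    eigenspace g V lam = weightedEigenspace g V (fun _ => 1) lam := by
  simp only [eigenspace, weightedEigenspace, mul_one]

end Eigenspaces

end RiemannianSobolev

end

/-! ### The main theorem. -/

open RiemannianSobolev

theorem mainTheorem6 (n : ℕ) (hn : 3 ≤ n) {M : Type*} [TopologicalSpace M] [CompactSpace M]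
    [T2Space M] [ChartedSpace (EuclideanSpace ℝ (Fin n)) M] [IsManifold (𝓡 n) ∞ M]
    [MeasurableSpace M] [BorelSpace M] (g : SmoothMetric n M)
    (V : M → ℝ) (hV : MemLp V ⊤ (riemannianVolume g))
    (w : M → ℝ) (hw : MemLorentz (riemannianVolume g) w ((n : ℝ) / 2) ⊤)
    (hw_pos : 0 < essInf (fun x => (w x : EReal)) (riemannianVolume g)) :
    SpanIsDirectSum (fun lam : Set.Iic (0 : ℝ) => eigenspace g V lam) ∧
    SpanIsDirectSum (fun lam : Set.Iic (0 : ℝ) => weightedEigenspace g V w lam) ∧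
    Module.rank ℝ (Submodule.span ℝ (⋃ lam : Set.Iic (0 : ℝ), weightedEigenspace g V w lam)) =
      Module.rank ℝ (Submodule.span ℝ (⋃ lam : Set.Iic (0 : ℝ), eigenspace g V lam)) ∧
    IsGreatest
      {d : Cardinal | ∃ P : Submodule ℝ (W12 g), (∀ f ∈ P, bilinForm g V f f ≤ 0) ∧
        Module.rank ℝ P = d}
      (Module.rank ℝ (Submodule.span ℝ (⋃ lam : Set.Iic (0 : ℝ), eigenspace g V lam))) := by
  obtain ⟨δ, hδ, hδw⟩ := exists_pos_le_of_essInf_pos hw_pos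
  obtain ⟨C, hC⟩ := exists_lintegral_mul_le hn g hw
  have hwC : ∀ f, weightForm g w (integrable_mul_weight hn hw) f f ≤ C * sobolevForm g f f := by
    intro f
    refine (ENNReal.ofReal_le_ofReal_iff (mul_nonneg C.coe_nonneg (sobolevForm_self_nonneg f))).1 ?_
    rw [ENNReal.ofReal_mul C.coe_nonneg, weightForm_apply]
    refine (ENNReal.ofReal_le_ofReal (le_abs_self _)).trans ?_
    rw [← Real.enorm_eq_ofReal_abs]
    refine ((enorm_integral_le_lintegral_enorm _).trans_eq (lintegral_congr fun x => ?_)).trans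
      ((hC f).trans_eq ?_)
    · rw [enorm_mul, enorm_mul, pow_two]
    · rw [ENNReal.ofReal_coe_nnreal]
  obtain ⟨h1, h2⟩ := spanIsDirectSum_and_isGreatest hV (integrable_mul_weight hn hw) hδ hδw
    C.coe_nonneg hwC
  obtain ⟨h3, h4⟩ := spanIsDirectSum_and_isGreatest (w := fun _ => 1) hV integrable_mul_W12
    zero_lt_one (Filter.Eventually.of_forall fun _ => le_rfl) zero_le_one fun f => by
      rw [weightForm_one_self, one_mul]
      exact norm_sq_le_sobolevForm f
  have e : (fun lam : Set.Iic (0 : ℝ) => eigenspace g V lam) =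
      fun lam : Set.Iic (0 : ℝ) => weightedEigenspace g V (fun _ => 1) lam :=
    funext fun lam => eigenspace_eq V lam
  rw [e]
  -- Both dimensions are the greatest element of one and the same set, in which the weight does not
  -- occur.
  exact ⟨h3, h1, h2.unique h4, h4⟩
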